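/- Let $\mathscr{G}=(V,E)$ be the square lattice $\mathbb{Z}^2$, the triangular lattice $\mathscr{T}$ or the hexagonal lattice $\mathscr{H}$, embedded in the plane as usual, and put $\lambda(\mathbb{Z}^2)=(2+\sqrt3)^2$, $\lambda(\mathscr{T})=3+2\sqrt2$, $\lambda(\mathscr{H})=\big(\tfrac{3+\sqrt5}{2}\big)^3$. Definitions. For $x\in V$ let $N(x)$ be its set of neighbours. Distinct vertices are $*$-adjacent if they lie on the boundary of a common face. For $A\subset V$, the clusters (resp. $*$-clusters) of $A$ are its connected components with respect to adjacency (resp. $*$-adjacency). Let $A^c_\infty$ be the infinite cluster of $A^c=V\setminus A$, which is unique if $A$ is finite (for infinite $A$: the union of all infinite clusters of $A^c$), and let $\partial^{\mathrm o}_{\infty,*}A$ be the set of vertices of $A^c_\infty$ that are $*$-adjacent to some vertex of $A$. Two sets $D_1,D_2\subset V$ with no vertex of $D_1$ $*$-adjacent to a vertex of $D_2$ are called interlocked if (1) there is $x\in(D_1\cup D_2)^c_\infty$ with $|N(x)\setminus(D_1\cup D_2)|=2$ and $N(x)\cap D_i\ne\emptyset$ for $i=1,2$; or (2) there are adjacent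 $x_1,x_2\in(D_1\cup D_2)^c_\infty$ such that $|N(x_i)\setminus D_i|=2$ and $N(x_i)\cap D_{3-i}=\emptyset$ for $i=1,2$. Two $*$-clusters of $A$ are in the same interlocked class if they are equal or are joined by a finite chain of $*$-clusters of $A$ in which consecutive members are interlocked. An interlocked cluster of $A$ is the union of all $*$-clusters of $A$ in one interlocked class. Let $\mathbb{P}_x$ be the law of the simple random walk $(S_n)_{n\ge0}$ on $\mathscr{G}$ started at $x$, and let $\tau_B=\inf\{n\ge0:S_n\in B\}$ and $\tau_y=\tau_{\{y\}}$. Statement. There exist constants $c=c(\mathscr{G})>0$ and $K=K(\mathscr{G})>0$ such that for every $A\subset V$, every finite interlocked cluster $D$ of $A$ that is not separated from infinity by the rest of $A$ (that is, $D\cap(A\setminus D)^c_\infty\neq\emptyset$), and all $x,y\in\partial^{\mathrm o}_{\infty,*}D$, $$\mathbb{P}_x(\tau_y<\tau_A)\ \ge\ K\,\lambda(\mathscr{G})^{-|D|+c\sqrt{|D|}} .$$ -/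

import Mathlib

open MeasureTheory

noncomputable section

namespace RegularLattice

/-- Vertices of the three regular planar lattices are coded by pairs of integers. -/
abbrev Vertex : Type := ℤ × ℤ

/-- `u` is joined to `v` in `H` by a path all of whose vertices lie in `F`
(that is, the graph distance of `u` and `v` in `F` is finite). -/
def ConnectedIn (H : SimpleGraph Vertex) (F : Set Vertex) (u v : Vertex) : Prop :=
  ∃ w : H.Walk u v, ∀ z ∈ w.support, z ∈ F

/-- `C` is a cluster of `A` with respect to the adjacency of `H`: a non-empty connected subset of
`A` which is not connected in `A` to any other vertex of `A`. -/
def IsCluster (H : SimpleGraph Vertex) (A C : Set Vertex) : Prop :=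
  C.Nonempty ∧ C ⊆ A ∧ (∀ u ∈ C, ∀ v ∈ C, ConnectedIn H C u v) ∧
    ∀ x ∈ A \ C, ∀ u ∈ C, ¬ ConnectedIn H A x u

/-- The square lattice: vertex `(a, b)` is placed at the point `(a, b)` of the plane. -/
def squareGraph : SimpleGraph Vertex where
  Adj u v := |u.1 - v.1| + |u.2 - v.2| = 1
  symm := ⟨by
    intro u v h
    rwa [abs_sub_comm v.1 u.1, abs_sub_comm v.2 u.2]⟩
  loopless := ⟨by intro u h; simp at h⟩

/-- The triangular lattice: vertex `(a, b)` is placed at `a + b * exp (i π / 3)`; the six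
neighbours of a vertex are obtained by adding `±(1, 0)`, `±(0, 1)`, `±(1, -1)`. -/
def triangularGraph : SimpleGraph Vertex where
  Adj u v := v - u ∈ ({(1, 0), (-1, 0), (0, 1), (0, -1), (1, -1), (-1, 1)} : Set Vertex)
  symm := ⟨by
    intro u v h
    rw [← neg_sub v u]
    rcases h with h | h | h | h | h | h <;> rw [h] <;> simp⟩
  loopless := ⟨by intro u h; simp [Prod.ext_iff] at h⟩

/-- The hexagonal lattice, in brick-wall coordinates: `(a, b)` is joined to `(a ± 1, b)`, and also
to `(a, b + 1)` if `a + b` is even and to `(a, b - 1)` if `a + b` is odd. Vertex `(a, b)` is placed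
at the point `(√3 / 2 * a, 3 / 2 * b + 1 / 4)` of the plane if `a + b` is even, and at
`(√3 / 2 * a, 3 / 2 * b - 1 / 4)` if `a + b` is odd; all edges then have length 1. -/
def hexagonalGraph : SimpleGraph Vertex where
  Adj u v :=
    (u.2 = v.2 ∧ |u.1 - v.1| = 1) ∨
      (u.1 = v.1 ∧ v.2 = u.2 + 1 ∧ Even (u.1 + u.2)) ∨
      (u.1 = v.1 ∧ u.2 = v.2 + 1 ∧ Even (v.1 + v.2))
  symm := ⟨by
    rintro u v (⟨h1, h2⟩ | ⟨h1, h2, h3⟩ | ⟨h1, h2, h3⟩)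
    · exact Or.inl ⟨h1.symm, by rwa [abs_sub_comm]⟩
    · exact Or.inr (Or.inr ⟨h1.symm, h2, h3⟩)
    · exact Or.inr (Or.inl ⟨h1.symm, h2, h3⟩)⟩
  loopless := ⟨by
    rintro u (⟨_, h2⟩ | ⟨_, h2, _⟩ | ⟨_, h2, _⟩)
    · simp at h2
    · omega
    · omega⟩

end RegularLattice

/-- The three regular planar lattices. -/
inductive RegularLattice : Type
  | square
  | triangular
  | hexagonal

namespace RegularLattice

/-- The graph of the lattice. -/
def graph : RegularLattice → SimpleGraph Vertex
  | square => squareGraph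
  | triangular => triangularGraph
  | hexagonal => hexagonalGraph

/-- The common degree of all vertices. -/
def deg : RegularLattice → ℕ
  | square => 4
  | triangular => 6
  | hexagonal => 3

/-- The constant `λ` of the lattice. -/
def lam : RegularLattice → ℝ
  | square => (2 + √3) ^ 2
  | triangular => 3 + 2 * √2
  | hexagonal => ((3 + √5) / 2) ^ 3

/-- `F` is the set of vertices surrounding a face of the lattice: a unit square, a triangle
(of one of the two orientations), or a hexagon. -/
def IsFace : RegularLattice → Set Vertex → Prop
  | square, F => ∃ a b : ℤ, F = {(a, b), (a + 1, b), (a + 1, b + 1), (a, b + 1)}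
  | triangular, F => ∃ a b : ℤ,
      F = {(a, b), (a + 1, b), (a, b + 1)} ∨ F = {(a + 1, b), (a + 1, b + 1), (a, b + 1)}
  | hexagonal, F => ∃ a b : ℤ, Even (a + b) ∧
      F = {(a, b), (a + 1, b), (a + 2, b), (a + 2, b + 1), (a + 1, b + 1), (a, b + 1)}

/-- `*`-adjacency: two distinct vertices are `*`-adjacent if they surround a common face. -/
def starGraph (L : RegularLattice) : SimpleGraph Vertex where
  Adj u v := u ≠ v ∧ ∃ F, L.IsFace F ∧ u ∈ F ∧ v ∈ F
  symm := ⟨fun _ _ ⟨h, F, hF, hu, hv⟩ => ⟨h.symm, F, hF, hv, hu⟩⟩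
  loopless := ⟨fun _ h => h.1 rfl⟩

/-- The `*`-clusters of `A`. -/
def IsStarCluster (L : RegularLattice) (A C : Set Vertex) : Prop :=
  IsCluster L.starGraph A C

/-- The exterior of `A`: the vertices that lie in an infinite cluster of the complement of `A`
(for finite `A` there is exactly one such cluster). -/
def exterior (L : RegularLattice) (A : Set Vertex) : Set Vertex :=
  {v | ∃ C, IsCluster L.graph Aᶜ C ∧ C.Infinite ∧ v ∈ C}

/-- The exterior outer `*`-boundary of `A`. -/
def exteriorStarBoundary (L : RegularLattice) (A : Set Vertex) : Set Vertex :=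
  {v | v ∈ L.exterior A ∧ ∃ u ∈ A, L.starGraph.Adj u v}

/-- `D₁` and `D₂` are interlocked. -/
def Interlocked (L : RegularLattice) (D₁ D₂ : Set Vertex) : Prop :=
  (∀ u ∈ D₁, ∀ v ∈ D₂, ¬ L.starGraph.Adj u v) ∧
    ((∃ x ∈ L.exterior (D₁ ∪ D₂),
        (L.graph.neighborSet x \ (D₁ ∪ D₂)).ncard = 2 ∧
        (L.graph.neighborSet x ∩ D₁).Nonempty ∧ (L.graph.neighborSet x ∩ D₂).Nonempty) ∨
      (∃ x₁ ∈ L.exterior (D₁ ∪ D₂), ∃ x₂ ∈ L.exterior (D₁ ∪ D₂),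
        L.graph.Adj x₁ x₂ ∧
        (L.graph.neighborSet x₁ \ D₁).ncard = 2 ∧ L.graph.neighborSet x₁ ∩ D₂ = ∅ ∧
        (L.graph.neighborSet x₂ \ D₂).ncard = 2 ∧ L.graph.neighborSet x₂ ∩ D₁ = ∅))

/-- Two `*`-clusters of `A` are in the same interlocked class if they are equal or joined by a
finite chain of `*`-clusters of `A` whose consecutive members are interlocked. -/
def SameInterlockedClass (L : RegularLattice) (A C C' : Set Vertex) : Prop :=
  Relation.ReflTransGen
    (fun B B' => L.IsStarCluster A B ∧ L.IsStarCluster A B' ∧ L.Interlocked B B') C C'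

/-- `D` is an interlocked cluster of `A`: the union of all `*`-clusters of `A` in one interlocked
class. -/
def IsInterlockedCluster (L : RegularLattice) (A D : Set Vertex) : Prop :=
  ∃ C₀, L.IsStarCluster A C₀ ∧
    D = ⋃₀ {C | L.IsStarCluster A C ∧ L.SameInterlockedClass A C₀ C}

open Classical in
/-- `S` is a simple random walk on the lattice started at `x`: a Markov chain with initial state
`x` which moves from a vertex to each of its neighbours with probability `1 / deg`. The second
condition says that, given any past `S 0 = p 0, …, S n = p n` of positive probability, the next
position is `p (n + 1)` with probability `1 / deg` if `p n` and `p (n + 1)` are adjacent, and with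
probability `0` otherwise. -/
structure IsRandomWalk (L : RegularLattice) {Ω : Type*} [MeasurableSpace Ω] (P : Measure Ω)
    (S : ℕ → Ω → Vertex) (x : Vertex) : Prop where
  measurable : ∀ n, Measurable (S n)
  start : ∀ᵐ ω ∂P, S 0 ω = x
  step : ∀ (n : ℕ) (p : ℕ → Vertex),
    P.real {ω | ∀ i ≤ n + 1, S i ω = p i} =
      P.real {ω | ∀ i ≤ n, S i ω = p i} *
        (if L.graph.Adj (p n) (p (n + 1)) then (L.deg : ℝ)⁻¹ else 0)

/-- The first time at which the trajectory `s` is in `A`; it is `⊤` if there is no such time. -/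
def hittingTime (s : ℕ → Vertex) (A : Set Vertex) : ℕ∞ :=
  ⨅ (n : ℕ) (_ : s n ∈ A), (n : ℕ∞)

end RegularLattice

end

/-! Let `u z` be the probability that the walk from `z` reaches `y` before `A`. This function is
non-negative, superharmonic off `A`, and equal to 1 at `y`, so a lower bound on `u x` follows once
`u` is shown not to drop too much from `y` to `x`. Along a path of free vertices `u` loses at most a
factor `growth` per step, up to a bounded factor in total, where `g = growth` is the larger root of
`g + 1 / g = deg`; this is the worst case, in which inner vertices have no free neighbours except
the two on the path (`Superharmonic.le_of_path`). As `lam = growth ^ tunnelRate`, what is needed is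
a path of free vertices round `D` with about `tunnelRate * |D|` edges, and a saving of order `√|D|`.

The path runs on a contour: the edges off a finite set `B` that lie along a face meeting `B`,
directed with `B` on the left. These edges form a circulation (`PlaneMap.balanced`). If `B` is
`*`-connected, its outer contour is connected, because the plane has no cohomology modulo 2 in
degree one (`contour_connected`), and it has at most `2 * tunnelRate * |B| + mergeGain` edges
(`len_le`). Hence two of its points are joined by a path of half that length. An interlocked cluster
`D` need not be `*`-connected, but two interlocked `*`-clusters can be joined by filling one vertex,
or two adjacent ones. This adds no faces, does not block the exterior, and shortens the contour by
at least `mergeGain`, which pays for the merger (`Filling.extend`, `exists_filling`). So the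
resulting set `B` satisfies the length bound with `|D|` in place of `|B|`.

The saving comes from contour vertices whose number of free neighbours is not 2: inside a path, a
third free neighbour lowers the rate by a fixed factor. Since `D` is a whole interlocked class, no
further cluster of `A` locks onto the contour (`Filling.unlocked`). Inspection of the left ends of
the rows of `B` then shows that every row without such a vertex is followed by a row with one
(`Unlocked.row`, `Unlocked.card_rows_le`). Rows of two directions meet in at most two vertices, so
there are at least a constant times `√|D|` such vertices (`Unlocked.card_le`). To have its share of
them on the path, the edges are weighted in their favour and a path of at most half the total weight
is taken (`exists_walk_le`, `exists_path`). -/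

/-! ### Rotation systems and contours -/

namespace RegularLattice

open Finset

open scoped Classical

/-- The number of vertices of a face. -/
def faceSize : RegularLattice → ℕ
  | square => 4
  | triangular => 3
  | hexagonal => 6

instance (L : RegularLattice) : NeZero L.deg := ⟨by cases L <;> simp [deg]⟩

instance (L : RegularLattice) : NeZero L.faceSize := ⟨by cases L <;> simp [faceSize]⟩

/-- A rotation system for the lattice: the neighbours `nb v i` of each vertex in counterclockwise
order, the face `lf v i` on the left of the edge from `v` to `nb v i`, and the vertices `cyc F k`
of each face in counterclockwise order. The field `exact` says that the plane is simply
connected. -/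
structure PlaneMap (L : RegularLattice) where
  Fc : Type
  nb : Vertex → Fin L.deg → Vertex
  lf : Vertex → Fin L.deg → Fc
  cyc : Fc → Fin L.faceSize → Vertex
  nb_inj : ∀ v, Function.Injective (nb v)
  adj_iff : ∀ u v, L.graph.Adj u v ↔ ∃ i, nb u i = v
  cyc_inj : ∀ F, Function.Injective (cyc F)
  isFace_iff : ∀ S, L.IsFace S ↔ ∃ F, S = Set.range (cyc F)
  lf_inj : ∀ v, Function.Injective (lf v)
  pos : ∀ v i, ∃ k, cyc (lf v i) k = v ∧ cyc (lf v i) (k + 1) = nb v i ∧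
    cyc (lf v i) (k - 1) = nb v (i + 1)
  lf_surj : ∀ F k, ∃ i, lf (cyc F k) i = F
  exact : ∀ c : Vertex → Vertex → ZMod 2, (∀ u v, c u v = c v u) →
    (∀ F, ∑ k, c (cyc F k) (cyc F (k + 1)) = 0) →
    ∃ g : Vertex → ZMod 2, ∀ u v, L.graph.Adj u v → g v = g u + c u v

namespace PlaneMap

variable {L : RegularLattice} (M : PlaneMap L)

theorem adj_nb (v : Vertex) (i : Fin L.deg) : L.graph.Adj v (M.nb v i) :=
  (M.adj_iff _ _).2 ⟨i, rfl⟩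

/-- The faces that meet `B`. -/
noncomputable def facesOf (B : Finset Vertex) : Finset M.Fc := B.biUnion fun v => univ.image (M.lf v)

theorem mem_facesOf {B : Finset Vertex} {F : M.Fc} :
    F ∈ M.facesOf B ↔ ∃ k, M.cyc F k ∈ B := by
  simp only [facesOf, mem_biUnion, mem_image, mem_univ, true_and]
  constructor
  · rintro ⟨v, hv, i, rfl⟩
    obtain ⟨k, hk, -⟩ := M.pos v i
    exact ⟨k, by rwa [hk]⟩
  · rintro ⟨k, hk⟩
    obtain ⟨i, hi⟩ := M.lf_surj F k
    exact ⟨_, hk, i, hi⟩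

theorem lf_mem_facesOf {B : Finset Vertex} {v : Vertex} (hv : v ∈ B) (i : Fin L.deg) :
    M.lf v i ∈ M.facesOf B := by
  simp only [facesOf, mem_biUnion, mem_image, mem_univ, true_and]
  exact ⟨v, hv, i, rfl⟩

theorem facesOf_mono {B B' : Finset Vertex} (h : B ⊆ B') : M.facesOf B ⊆ M.facesOf B' :=
  biUnion_subset_biUnion_of_subset_left _ h

theorem facesOf_union (B B' : Finset Vertex) :
    M.facesOf (B ∪ B') = M.facesOf B ∪ M.facesOf B' := by
  ext F; simp only [mem_facesOf, mem_union, exists_or]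

theorem facesOf_insert (v : Vertex) (B : Finset Vertex) :
    M.facesOf (insert v B) = univ.image (M.lf v) ∪ M.facesOf B := by
  simp [facesOf]

/-- Every face at `v` lies on the left of some edge that leaves `v`. -/
theorem exists_lf_eq {F : M.Fc} {v : Vertex} (h : ∃ k, M.cyc F k = v) : ∃ i, M.lf v i = F := by
  obtain ⟨k, rfl⟩ := h
  exact M.lf_surj F k

theorem mem_lf (v : Vertex) (i : Fin L.deg) : ∃ k, M.cyc (M.lf v i) k = v :=
  (M.pos v i).imp fun _ h => h.1

theorem nb_mem_lf (v : Vertex) (i : Fin L.deg) : ∃ k, M.cyc (M.lf v i) k = M.nb v i := by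
  obtain ⟨k, -, h, -⟩ := M.pos v i
  exact ⟨_, h⟩

theorem nb_mem_lf' (v : Vertex) (i : Fin L.deg) : ∃ k, M.cyc (M.lf v (i - 1)) k = M.nb v i := by
  obtain ⟨k, -, -, h⟩ := M.pos v (i - 1)
  rw [sub_add_cancel] at h
  exact ⟨_, h⟩

theorem lf_mem_of_nb {B : Finset Vertex} {v : Vertex} {i : Fin L.deg} (h : M.nb v i ∈ B) :
    M.lf v i ∈ M.facesOf B ∧ M.lf v (i - 1) ∈ M.facesOf B := by
  constructor
  · obtain ⟨k, hk⟩ := M.nb_mem_lf v i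
    exact M.mem_facesOf.2 ⟨k, hk ▸ h⟩
  · obtain ⟨k, hk⟩ := M.nb_mem_lf' v i
    exact M.mem_facesOf.2 ⟨k, hk ▸ h⟩

/-- The reverse of the edge from `u` to `nb u i`. -/
theorem exists_rev (u : Vertex) (i : Fin L.deg) :
    ∃ r, M.nb (M.nb u i) r = u ∧ M.lf (M.nb u i) r = M.lf u (i - 1) ∧
      M.lf (M.nb u i) (r - 1) = M.lf u i := by
  obtain ⟨k, hk, -, hk2⟩ := M.pos u (i - 1)
  rw [sub_add_cancel] at hk2
  obtain ⟨r, hr⟩ := M.lf_surj (M.lf u (i - 1)) (k - 1)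
  rw [hk2] at hr
  obtain ⟨k', hk', hk'2, -⟩ := M.pos (M.nb u i) r
  rw [hr] at hk' hk'2
  have e : k' = k - 1 := M.cyc_inj _ (hk'.trans hk2.symm)
  rw [e, sub_add_cancel, hk] at hk'2
  refine ⟨r, hk'2.symm, hr, ?_⟩
  obtain ⟨k2, h1, h2, -⟩ := M.pos u i
  obtain ⟨r', hr'⟩ := M.lf_surj (M.lf u i) (k2 + 1)
  rw [h2] at hr'
  obtain ⟨k3, h3, -, h4⟩ := M.pos (M.nb u i) r'
  rw [hr'] at h3 h4
  have e3 : k3 = k2 + 1 := M.cyc_inj _ (h3.trans h2.symm)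
  rw [e3, add_sub_cancel_right, h1] at h4
  have : r = r' + 1 := M.nb_inj _ (hk'2.symm.trans h4)
  rw [this, add_sub_cancel_right, hr']

/-- The edges along the contour of `B`, directed so that `B` is on the left. -/
def Dart (B : Finset Vertex) (u v : Vertex) : Prop :=
  u ∉ B ∧ v ∉ B ∧ ∃ i, M.nb u i = v ∧ M.lf u i ∈ M.facesOf B

variable {M} in
theorem Dart.adj {B : Finset Vertex} {u v : Vertex} (h : M.Dart B u v) : L.graph.Adj u v :=
  (M.adj_iff _ _).2 (h.2.2.imp fun _ h => h.1)

theorem dart_nb_iff {B : Finset Vertex} {u : Vertex} (hu : u ∉ B) (i : Fin L.deg) :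
    M.Dart B u (M.nb u i) ↔ M.nb u i ∉ B ∧ M.lf u i ∈ M.facesOf B := by
  constructor
  · rintro ⟨-, h, j, hj, hF⟩
    obtain rfl := M.nb_inj _ hj
    exact ⟨h, hF⟩
  · rintro ⟨h, hF⟩
    exact ⟨hu, h, i, rfl, hF⟩

theorem nb_dart_iff {B : Finset Vertex} {u : Vertex} (hu : u ∉ B) (i : Fin L.deg) :
    M.Dart B (M.nb u i) u ↔ M.nb u i ∉ B ∧ M.lf u (i - 1) ∈ M.facesOf B := by
  obtain ⟨r, h1, h2, -⟩ := M.exists_rev u i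
  by_cases h : M.nb u i ∈ B
  · exact ⟨fun h' => absurd h h'.1, fun h' => absurd h h'.1⟩
  · have := M.dart_nb_iff h r
    rw [h1, h2] at this
    rw [this]
    exact ⟨fun h' => ⟨h, h'.2⟩, fun h' => ⟨hu, h'.2⟩⟩

theorem sum_shift {α : Type*} [AddCommMonoid α] (g : Fin L.deg → α) :
    ∑ i, g (i - 1) = ∑ i, g i :=
  Fintype.sum_equiv (Equiv.subRight 1) _ _ fun _ => rfl

theorem sum_shift' {α : Type*} [AddCommMonoid α] (g : Fin L.deg → α) :
    ∑ i, g (i + 1) = ∑ i, g i :=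
  Fintype.sum_equiv (Equiv.addRight 1) _ _ fun _ => rfl

theorem sum_succ_face {α : Type*} [AddCommMonoid α] (g : Fin L.faceSize → α) :
    ∑ i, g (i + 1) = ∑ i, g i :=
  Fintype.sum_equiv (Equiv.addRight 1) _ _ fun _ => rfl

/-- The contour enters and leaves each vertex equally often. -/
theorem balanced_nb {B : Finset Vertex} (u : Vertex) :
    ∑ i, (if M.nb u i ∉ B ∧ M.lf u i ∈ M.facesOf B then (1 : ℤ) else 0) =
      ∑ i, (if M.nb u i ∉ B ∧ M.lf u (i - 1) ∈ M.facesOf B then (1 : ℤ) else 0) := by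
  -- A neighbour in `B` makes both faces beside its edge meet `B`, so each indicator is a
  -- difference. Summed round `u`, both sides become the number of faces at `u` meeting `B` minus
  -- the number of neighbours in `B`.
  have h1 : ∀ i, (if M.nb u i ∉ B ∧ M.lf u i ∈ M.facesOf B then (1 : ℤ) else 0) =
      (if M.lf u i ∈ M.facesOf B then 1 else 0) - (if M.nb u i ∈ B then 1 else 0) := by
    intro i
    by_cases h : M.nb u i ∈ B
    · simp [h, (M.lf_mem_of_nb h).1]
    · simp [h]
  have h2 : ∀ i, (if M.nb u i ∉ B ∧ M.lf u (i - 1) ∈ M.facesOf B then (1 : ℤ) else 0) =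
      (if M.lf u (i - 1) ∈ M.facesOf B then 1 else 0) - (if M.nb u i ∈ B then 1 else 0) := by
    intro i
    by_cases h : M.nb u i ∈ B
    · simp [h, (M.lf_mem_of_nb h).2]
    · simp [h]
  simp only [h1, h2, sum_sub_distrib]
  rw [sum_shift (fun i => if M.lf u i ∈ M.facesOf B then (1 : ℤ) else 0)]

theorem sum_nb {α : Type*} [AddCommMonoid α] {T : Finset Vertex} {u : Vertex} (g : Vertex → α)
    (h0 : ∀ v ∈ T, (∀ i, M.nb u i ≠ v) → g v = 0) (h1 : ∀ i, M.nb u i ∉ T → g (M.nb u i) = 0) :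
    ∑ v ∈ T, g v = ∑ i, g (M.nb u i) := by
  have e : ∑ i, g (M.nb u i) = ∑ v ∈ univ.image (M.nb u), g v := by
    rw [sum_image fun _ _ _ _ h => M.nb_inj u h]
  rw [e, sum_subset (subset_union_left (s₁ := T) (s₂ := univ.image (M.nb u))),
    sum_subset (subset_union_right (s₁ := T) (s₂ := univ.image (M.nb u)))]
  · intro v hv hv'
    simp only [mem_union, mem_image, mem_univ, true_and] at hv hv'
    exact h0 v (hv.resolve_right hv') fun i hi => hv' ⟨i, hi⟩
  · intro v hv hv'
    simp only [mem_union, mem_image, mem_univ, true_and] at hv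
    obtain ⟨i, rfl⟩ := hv.resolve_left hv'
    exact h1 i hv'

/-- The form of the balance that `cut_balanced` needs: sums over a finite set that is large enough
to contain the contour neighbours of `u`. -/
theorem balanced {B : Finset Vertex} {T : Finset Vertex} {u : Vertex}
    (hT : ∀ v, M.Dart B u v ∨ M.Dart B v u → v ∈ T) :
    ∑ v ∈ T, (if M.Dart B u v then (1 : ℤ) else 0) =
      ∑ v ∈ T, (if M.Dart B v u then (1 : ℤ) else 0) := by
  by_cases hu : u ∈ B
  · rw [sum_eq_zero, sum_eq_zero]
    · intro v _; rw [if_neg fun h => h.2.1 hu]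
    · intro v _; rw [if_neg fun h => h.1 hu]
  rw [M.sum_nb (u := u), M.sum_nb (u := u)]
  · have := M.balanced_nb (B := B) u
    simpa only [M.dart_nb_iff hu, M.nb_dart_iff hu] using this
  · intro v _ hv
    rw [if_neg]
    intro h
    obtain ⟨i, hi⟩ := (M.adj_iff _ _).1 h.adj.symm
    exact hv i hi
  · intro i hi
    rw [if_neg fun h => hi (hT _ (Or.inr h))]
  · intro v _ hv
    rw [if_neg]
    rintro ⟨-, -, i, hi, -⟩
    exact hv i hi
  · intro i hi
    rw [if_neg fun h => hi (hT _ (Or.inl h))]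

/-- The number of contour edges. -/
noncomputable def len (B : Finset Vertex) : ℤ :=
  ∑ F ∈ M.facesOf B, ∑ k, if M.cyc F k ∉ B ∧ M.cyc F (k + 1) ∉ B then (1 : ℤ) else 0

end PlaneMap

/-- Flow conservation across cuts. -/
theorem cut_balanced {α : Type*} [DecidableEq α] {T S : Finset α} (hS : S ⊆ T) {J : α → α → ℤ}
    (hJ : ∀ u ∈ S, ∑ v ∈ T, J u v = ∑ v ∈ T, J v u) :
    ∑ u ∈ S, ∑ v ∈ T \ S, J u v = ∑ u ∈ S, ∑ v ∈ T \ S, J v u := by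
  have h : ∀ K : α → α → ℤ, ∑ u ∈ S, ∑ v ∈ T \ S, K u v =
      ∑ u ∈ S, ∑ v ∈ T, K u v - ∑ u ∈ S, ∑ v ∈ S, K u v := by
    intro K
    rw [← sum_sub_distrib]
    refine sum_congr rfl fun u _ => ?_
    rw [← sum_sdiff hS]; ring
  rw [h J, h fun u v => J v u, sum_congr rfl hJ, sum_comm (s := S) (t := S)]

end RegularLattice

/-! ### The length and the connectedness of contours -/

namespace RegularLattice

open Finset

open scoped Classical

theorem Fin.cyclic_induction {n : ℕ} [NeZero n] {p : Fin n → Prop} (h : ∀ i, p i → p (i + 1))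
    {i : Fin n} (hi : p i) (j : Fin n) : p j := by
  have key : ∀ m : ℕ, p (i + Fin.ofNat n m) := by
    intro m
    induction m with
    | zero => simpa using hi
    | succ m ih =>
      have e : Fin.ofNat n (m + 1) = Fin.ofNat n m + 1 := by
        ext; simp [Fin.ofNat, Fin.val_add]
      rw [e, ← add_assoc]
      exact h _ ih
  have := key (j - i).val
  simpa using this

theorem Fin.cyclic_induction_sub {n : ℕ} [NeZero n] {p : Fin n → Prop}
    (h : ∀ i, p (i + 1) → p i) {i : Fin n} (hi : p i) (j : Fin n) : p j := by
  by_contra hj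
  refine Fin.cyclic_induction (p := fun i => ¬ p i) (fun i hi h' => hi (h i h')) hj i hi

/-! ### Paths inside a set of vertices -/

theorem connectedIn_iff {H : SimpleGraph Vertex} {F : Set Vertex} {u v : Vertex} :
    ConnectedIn H F u v ↔
      u ∈ F ∧ Relation.ReflTransGen (fun a b => a ∈ F ∧ b ∈ F ∧ H.Adj a b) u v := by
  constructor
  · rintro ⟨w, hw⟩
    refine ⟨hw _ w.start_mem_support, ?_⟩
    induction w with
    | nil => exact .refl
    | cons h p ih =>
      refine .head ⟨hw _ (by simp), hw _ (by simp), h⟩ (ih fun z hz => hw z (by simp [hz]))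
  · rintro ⟨hu, h⟩
    induction h with
    | refl => exact ⟨.nil, by simpa using hu⟩
    | tail _ hbc ih =>
      obtain ⟨w, hw⟩ := ih
      refine ⟨w.concat hbc.2.2, fun z hz => ?_⟩
      rw [SimpleGraph.Walk.support_concat] at hz
      simp only [List.mem_append, List.mem_singleton] at hz
      rcases hz with hz | rfl
      · exact hw z hz
      · exact hbc.2.1

namespace ConnectedIn

variable {H : SimpleGraph Vertex} {F F' : Set Vertex} {u v w : Vertex}

theorem refl (hu : u ∈ F) : ConnectedIn H F u u := connectedIn_iff.2 ⟨hu, .refl⟩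

theorem left_mem (h : ConnectedIn H F u v) : u ∈ F := (connectedIn_iff.1 h).1

theorem trans (h : ConnectedIn H F u v) (h' : ConnectedIn H F v w) : ConnectedIn H F u w :=
  connectedIn_iff.2 ⟨h.left_mem, (connectedIn_iff.1 h).2.trans (connectedIn_iff.1 h').2⟩

theorem symm (h : ConnectedIn H F u v) : ConnectedIn H F v u := by
  obtain ⟨w, hw⟩ := h
  exact ⟨w.reverse, by simpa using hw⟩

theorem right_mem (h : ConnectedIn H F u v) : v ∈ F := h.symm.left_mem

theorem of_adj (hu : u ∈ F) (hv : v ∈ F) (h : H.Adj u v) : ConnectedIn H F u v :=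
  connectedIn_iff.2 ⟨hu, .single ⟨hu, hv, h⟩⟩

theorem mono (hF : F ⊆ F') (h : ConnectedIn H F u v) : ConnectedIn H F' u v := by
  obtain ⟨w, hw⟩ := h
  exact ⟨w, fun z hz => hF (hw z hz)⟩

theorem induct {p : Vertex → Prop} (h : ConnectedIn H F u v) (hu : p u)
    (step : ∀ a b, a ∈ F → b ∈ F → H.Adj a b → p a → p b) : p v := by
  have := (connectedIn_iff.1 h).2
  induction this with
  | refl => exact hu
  | tail h1 hbc ih =>
    exact step _ _ hbc.1 hbc.2.1 hbc.2.2 (ih (connectedIn_iff.2 ⟨h.left_mem, h1⟩))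

/-- A path from a point of `p` to a point outside `p` leaves `p`. -/
theorem exists_exit {p : Vertex → Prop} (h : ConnectedIn H F u v) (hu : p u) (hv : ¬ p v) :
    ∃ a b, a ∈ F ∧ b ∈ F ∧ H.Adj a b ∧ p a ∧ ¬ p b := by
  by_contra hcon
  push Not at hcon
  exact hv (h.induct hu fun a b ha hb hab hp => hcon a b ha hb hab hp)

end ConnectedIn

/-- Half the growth of the length of the contour per vertex. -/
def tunnelRate : RegularLattice → ℕ
  | square => 2
  | triangular => 1
  | hexagonal => 3

/-- Minus the change of the length of the contour when two components are merged. -/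
def mergeGain : RegularLattice → ℕ
  | square => 4
  | triangular => 4
  | hexagonal => 6

/-- `B` is connected with respect to `*`-adjacency. -/
def StarConnected (L : RegularLattice) (B : Set Vertex) : Prop :=
  ∀ u ∈ B, ∀ v ∈ B, ConnectedIn L.starGraph B u v

theorem StarConnected.union {L : RegularLattice} {B B' : Set Vertex} (h : L.StarConnected B)
    (h' : L.StarConnected B') {u v : Vertex} (hu : u ∈ B) (hv : v ∈ B')
    (huv : u = v ∨ L.starGraph.Adj u v) : L.StarConnected (B ∪ B') := by
  have huv' : ConnectedIn L.starGraph (B ∪ B') u v := by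
    rcases huv with rfl | huv
    · exact .refl (Or.inl hu)
    · exact .of_adj (Or.inl hu) (Or.inr hv) huv
  have key : ∀ w ∈ B ∪ B', ConnectedIn L.starGraph (B ∪ B') u w := by
    rintro w (hw | hw)
    · exact (h u hu w hw).mono Set.subset_union_left
    · exact huv'.trans ((h' v hv w hw).mono Set.subset_union_right)
  intro a ha b hb
  exact (key a ha).symm.trans (key b hb)

namespace PlaneMap

variable {L : RegularLattice} (M : PlaneMap L)

theorem star_iff {u v : Vertex} :
    L.starGraph.Adj u v ↔ u ≠ v ∧ ∃ F, (∃ k, M.cyc F k = u) ∧ ∃ k, M.cyc F k = v := by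
  constructor
  · rintro ⟨h, S, hS, hu, hv⟩
    obtain ⟨F, rfl⟩ := (M.isFace_iff S).1 hS
    exact ⟨h, F, hu, hv⟩
  · rintro ⟨h, F, hu, hv⟩
    exact ⟨h, _, (M.isFace_iff _).2 ⟨F, rfl⟩, hu, hv⟩

theorem adj_cyc (F : M.Fc) (k : Fin L.faceSize) :
    ∃ i, M.lf (M.cyc F k) i = F ∧ M.nb (M.cyc F k) i = M.cyc F (k + 1) := by
  obtain ⟨i, hi⟩ := M.lf_surj F k
  obtain ⟨k', h1, h2, -⟩ := M.pos (M.cyc F k) i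
  rw [hi] at h1 h2
  obtain rfl := M.cyc_inj _ h1
  exact ⟨i, hi, h2.symm⟩

theorem star_of_adj (M : PlaneMap L) {u v : Vertex} (h : L.graph.Adj u v) : L.starGraph.Adj u v := by
  obtain ⟨i, rfl⟩ := (M.adj_iff u v).1 h
  exact M.star_iff.2 ⟨h.ne, M.lf u i, M.mem_lf u i, M.nb_mem_lf u i⟩

theorem exists_lf_mem_iff {B : Finset Vertex} {v : Vertex} (hv : v ∉ B) :
    (∃ i, M.lf v i ∈ M.facesOf B) ↔ ∃ u ∈ B, L.starGraph.Adj u v := by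
  constructor
  · rintro ⟨i, hi⟩
    obtain ⟨k, hk⟩ := M.mem_facesOf.1 hi
    exact ⟨_, hk, M.star_iff.2 ⟨fun h => hv (h ▸ hk), _, ⟨k, rfl⟩, M.mem_lf v i⟩⟩
  · rintro ⟨u, hu, huv⟩
    obtain ⟨-, F, ⟨k, rfl⟩, hv'⟩ := M.star_iff.1 huv
    obtain ⟨i, rfl⟩ := M.exists_lf_eq hv'
    exact ⟨i, M.mem_facesOf.2 ⟨k, hu⟩⟩

/-- The number of contour edges along the face `F`. -/
noncomputable def faceLen (B : Finset Vertex) (F : M.Fc) : ℤ :=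
  ∑ k, if M.cyc F k ∉ B ∧ M.cyc F (k + 1) ∉ B then (1 : ℤ) else 0

theorem len_eq (B : Finset Vertex) : M.len B = ∑ F ∈ M.facesOf B, M.faceLen B F := rfl

theorem faceLen_of_notMem {B : Finset Vertex} {F : M.Fc} (h : F ∉ M.facesOf B) :
    M.faceLen B F = L.faceSize := by
  have h' : ∀ k, M.cyc F k ∉ B := fun k hk => h (M.mem_facesOf.2 ⟨k, hk⟩)
  simp [faceLen, h']

theorem faceSize_ge : 3 ≤ L.faceSize := by cases L <;> simp [faceSize]

theorem deg_ge : 3 ≤ L.deg := by cases L <;> simp [deg]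

theorem Fin.ne_add_one {n : ℕ} [NeZero n] (hn : 2 ≤ n) (i : Fin n) : i ≠ i + 1 := by
  intro h
  have h1 : (1 : Fin n) = 0 := by simpa using h.symm
  have := Fin.one_eq_zero_iff.1 h1
  omega

/-- Exactly two edges of the face end at `v`; each of them was counted unless its other end is in
`B`. -/
theorem faceLen_insert {B : Finset Vertex} {v : Vertex} (hv : v ∉ B) (i : Fin L.deg) :
    M.faceLen (insert v B) (M.lf v i) = M.faceLen B (M.lf v i) -
      (if M.nb v i ∉ B then 1 else 0) - (if M.nb v (i + 1) ∉ B then 1 else 0) := by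
  obtain ⟨k, h1, h2, h3⟩ := M.pos v i
  have hne : k ≠ k - 1 := by
    have := Fin.ne_add_one (by have := faceSize_ge (L := L); omega) (k - 1)
    rw [sub_add_cancel] at this
    exact this.symm
  have hterm : ∀ m, (if M.cyc (M.lf v i) m ∉ insert v B ∧ M.cyc (M.lf v i) (m + 1) ∉ insert v B
      then (1 : ℤ) else 0) = (if M.cyc (M.lf v i) m ∉ B ∧ M.cyc (M.lf v i) (m + 1) ∉ B
      then (1 : ℤ) else 0) - (if m = k then (if M.nb v i ∉ B then 1 else 0) else 0) -
      (if m = k - 1 then (if M.nb v (i + 1) ∉ B then 1 else 0) else 0) := by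
    intro m
    by_cases hm : m = k
    · subst hm
      rw [h1, h2]
      simp [hne, hv]
    · by_cases hm' : m = k - 1
      · subst hm'
        rw [h3, sub_add_cancel, h1]
        simp [hne.symm, hv]
      · have a1 : M.cyc (M.lf v i) m ≠ v := fun h => hm (M.cyc_inj _ (h.trans h1.symm))
        have a2 : M.cyc (M.lf v i) (m + 1) ≠ v := fun h =>
          hm' (eq_sub_of_add_eq (M.cyc_inj _ (h.trans h1.symm)))
        simp [hm, hm', a1, a2]
  simp only [faceLen, hterm, sum_sub_distrib, sum_ite_eq', mem_univ, if_true]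

/-- The angles at a vertex add up to a full turn. This flatness makes the formula for the length
uniform in the lattice. -/
theorem two_mul_faceSize : ((L.faceSize : ℤ) - 2) * L.deg = 2 * L.faceSize := by
  cases L <;> simp [faceSize, deg]

/-- The change of the length of the contour when a vertex is added. -/
theorem len_insert {B : Finset Vertex} {v : Vertex} (hv : v ∉ B) :
    M.len (insert v B) = M.len B +
      (2 - ∑ i, if M.lf v i ∈ M.facesOf B then (1 : ℤ) else 0) * L.faceSize +
      2 * ∑ i, if M.nb v i ∈ B then (1 : ℤ) else 0 := by
  set I := univ.image (M.lf v) with hI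
  have e1 : M.len (insert v B) = ∑ F ∈ M.facesOf B \ I, M.faceLen B F +
      ∑ F ∈ I, M.faceLen (insert v B) F := by
    rw [len_eq, facesOf_insert, ← hI, ← sum_sdiff (subset_union_left (s₁ := I)),
      union_sdiff_left]
    congr 1
    refine sum_congr rfl fun F hF => ?_
    have hvF : ∀ k, M.cyc F k ≠ v := fun k hk => by
      obtain ⟨i, hi⟩ := M.exists_lf_eq ⟨k, hk⟩
      exact (mem_sdiff.1 hF).2 (mem_image.2 ⟨i, mem_univ _, hi⟩)
    simp [faceLen, hvF]
  have e2 : M.len B = ∑ F ∈ M.facesOf B \ I, M.faceLen B F +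
      ∑ F ∈ I, if F ∈ M.facesOf B then M.faceLen B F else 0 := by
    rw [len_eq, ← sum_filter, filter_mem_eq_inter, inter_comm,
      ← sdiff_union_inter (M.facesOf B) I, sum_union (disjoint_sdiff_inter _ _),
      sdiff_union_inter]
  have inj : ∀ i ∈ (univ : Finset (Fin L.deg)), ∀ j ∈ (univ : Finset (Fin L.deg)),
      M.lf v i = M.lf v j → i = j := fun _ _ _ _ h => M.lf_inj v h
  rw [e1, e2, hI, sum_image inj, sum_image inj]
  -- A face at `v` that did not meet `B` brings in all its edges except the two at `v`; a face
  -- counted before only loses edges at `v` with the other end off `B`.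
  have key : ∀ i, M.faceLen (insert v B) (M.lf v i) =
      (if M.lf v i ∈ M.facesOf B then M.faceLen B (M.lf v i) else 0) +
      (((L.faceSize : ℤ) - 2) - L.faceSize * (if M.lf v i ∈ M.facesOf B then 1 else 0) +
      (if M.nb v i ∈ B then 1 else 0) + (if M.nb v (i + 1) ∈ B then 1 else 0)) := by
    intro i
    rw [M.faceLen_insert hv]
    by_cases h : M.lf v i ∈ M.facesOf B
    · simp only [h, if_true, ite_not]
      split_ifs <;> ring
    · have h1 : M.nb v i ∉ B := fun h' => h (M.lf_mem_of_nb h').1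
      have h2 : M.nb v (i + 1) ∉ B := fun h' => h (by
        have := (M.lf_mem_of_nb h').2
        rwa [add_sub_cancel_right] at this)
      simp only [h, h1, h2, if_false, not_false_eq_true, if_true, M.faceLen_of_notMem h]
      ring
  rw [sum_congr rfl fun i _ => key i]
  simp only [sum_add_distrib, sum_sub_distrib, ← mul_sum]
  rw [sum_shift' (fun i => if M.nb v i ∈ B then (1 : ℤ) else 0)]
  have := two_mul_faceSize (L := L)
  simp only [sum_const, card_univ, Fintype.card_fin, nsmul_eq_mul]
  linear_combination this

theorem nb_count_le {B : Finset Vertex} (v : Vertex) :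
    (∑ i, if M.nb v i ∈ B then (1 : ℤ) else 0) ≤
      ∑ i, if M.lf v i ∈ M.facesOf B then (1 : ℤ) else 0 := by
  refine sum_le_sum fun i _ => ?_
  by_cases h : M.nb v i ∈ B
  · simp [h, (M.lf_mem_of_nb h).1]
  · simp only [h, if_false]; split_ifs <;> simp

/-- With `j` faces at `v` meeting `B` and `t` neighbours in `B`, the length changes by `(2 - j) *
faceSize + 2 * t`. Either `t = 0`, or `j ≥ 2` and `t < j`, or `t = j = deg`. The first case is
impossible on the triangular lattice, where the other vertices of a face at `v` are neighbours of
`v`. -/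
theorem len_insert_le {B : Finset Vertex} {v : Vertex} (hv : v ∉ B)
    (h : ∃ u ∈ B, L.starGraph.Adj u v) :
    M.len (insert v B) ≤ M.len B + 2 * L.tunnelRate := by
  obtain ⟨i, hi⟩ := (M.exists_lf_mem_iff hv).2 h
  rw [M.len_insert hv]
  have hle := M.nb_count_le (B := B) v
  have hj0 : ∀ i ∈ (univ : Finset (Fin L.deg)),
    (0 : ℤ) ≤ if M.lf v i ∈ M.facesOf B then (1 : ℤ) else 0 := fun i _ => by split_ifs <;> simp
  have hj1 : 1 ≤ ∑ i, if M.lf v i ∈ M.facesOf B then (1 : ℤ) else 0 := by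
    have := single_le_sum hj0 (mem_univ i)
    simpa [hi] using this
  have hj2 : (∃ i, M.nb v i ∈ B) → 2 ≤ ∑ i, if M.lf v i ∈ M.facesOf B then (1 : ℤ) else 0 := by
    rintro ⟨i, hi⟩
    have hne : i ≠ i - 1 := by
      have := Fin.ne_add_one (by have := deg_ge (L := L); omega) (i - 1)
      rw [sub_add_cancel] at this
      exact this.symm
    have := add_le_sum hj0 (mem_univ i) (mem_univ (i - 1)) hne
    simpa [M.lf_mem_of_nb hi] using this
  have ht0 : (¬ ∃ i, M.nb v i ∈ B) → (∑ i, if M.nb v i ∈ B then (1 : ℤ) else 0) = 0 := by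
    intro h
    push Not at h
    simp [h]
  have htri : L.faceSize = 3 → ∀ i, M.lf v i ∈ M.facesOf B → M.nb v i ∈ B ∨ M.nb v (i + 1) ∈ B := by
    intro hf i hi
    obtain ⟨m, hm⟩ := M.mem_facesOf.1 hi
    obtain ⟨k, h1, h2, h3⟩ := M.pos v i
    have : m = k ∨ m = k + 1 ∨ m = k - 1 := by
      clear h1 h2 h3 hm
      cases L <;> simp only [faceSize] at hf <;> first | omega | skip
      revert m k
      change ∀ m k : Fin 3, m = k ∨ m = k + 1 ∨ m = k - 1
      decide
    rcases this with rfl | rfl | rfl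
    · exact absurd (h1 ▸ hm) hv
    · exact Or.inl (h2 ▸ hm)
    · exact Or.inr (h3 ▸ hm)
  -- Equality means that face `i` meets `B` only if neighbour `i` is in `B`. A neighbour `i + 1` in
  -- `B` makes face `i` meet `B`, so membership spreads all the way round `v`.
  have heq : (∑ i, if M.nb v i ∈ B then (1 : ℤ) else 0) =
      (∑ i, if M.lf v i ∈ M.facesOf B then (1 : ℤ) else 0) →
      (∃ i, M.nb v i ∈ B) →
      (L.deg : ℤ) = ∑ i, if M.lf v i ∈ M.facesOf B then (1 : ℤ) else 0 := by
    rintro he ⟨i, hi⟩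
    have h1 := (sum_eq_sum_iff_of_le (fun i _ => by
      by_cases h : M.nb v i ∈ B
      · simp [h, (M.lf_mem_of_nb h).1]
      · simp only [h, if_false]; split_ifs <;> simp)).1 he
    have h2 : ∀ i, M.lf v i ∈ M.facesOf B → M.nb v i ∈ B := by
      intro i h
      by_contra h'
      have := h1 i (mem_univ i)
      simp [h, h'] at this
    have h3 : ∀ i, M.nb v i ∈ B := Fin.cyclic_induction_sub (fun i h => h2 i (by
      have := (M.lf_mem_of_nb h).2
      rwa [add_sub_cancel_right] at this)) hi
    simp [fun i => (M.lf_mem_of_nb (h3 i)).1]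
  set j := ∑ i, if M.lf v i ∈ M.facesOf B then (1 : ℤ) else 0
  set t := ∑ i, if M.nb v i ∈ B then (1 : ℤ) else 0
  by_cases hnb : ∃ i, M.nb v i ∈ B
  · have := hj2 hnb
    rcases hle.lt_or_eq with hlt | he
    · cases L <;> simp only [faceSize, tunnelRate] <;> push_cast <;> omega
    · have hd := heq he hnb
      cases L <;> simp only [faceSize, tunnelRate, deg] at hd ⊢ <;> push_cast at hd ⊢ <;> omega
  · have := ht0 hnb
    cases L
    · simp only [faceSize, tunnelRate]; push_cast; omega
    · exact absurd ((htri rfl i hi).elim (fun h => ⟨_, h⟩) fun h => ⟨_, h⟩) hnb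
    · simp only [faceSize, tunnelRate]; push_cast; omega

theorem len_empty : M.len ∅ = 0 := by simp [len, facesOf]

theorem len_singleton (v : Vertex) : M.len {v} = 2 * L.tunnelRate + L.mergeGain := by
  have := M.len_insert (notMem_empty v)
  rw [M.len_empty] at this
  simp only [insert_empty_eq] at this
  rw [this]
  cases L <;> simp [facesOf, faceSize, tunnelRate, mergeGain]

/-- Build `B` from one vertex by adding `*`-adjacent vertices, each at the price `2 * tunnelRate`;
the maximal subset that obeys the bound is all of `B`. -/
theorem len_le {B : Finset Vertex} (hB : B.Nonempty) (hc : L.StarConnected B) :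
    M.len B ≤ 2 * L.tunnelRate * B.card + L.mergeGain := by
  obtain ⟨v, hv⟩ := hB
  have hne : (B.powerset.filter fun E => v ∈ E ∧
      M.len E ≤ 2 * L.tunnelRate * E.card + L.mergeGain).Nonempty :=
    ⟨{v}, by simp [hv, M.len_singleton]⟩
  obtain ⟨E, hE, hmax⟩ := exists_max_image _ card hne
  simp only [mem_filter, mem_powerset] at hE hmax
  obtain ⟨hEB, hvE, hlen⟩ := hE
  by_cases hEq : E = B
  · rwa [hEq] at hlen
  obtain ⟨w, hwB, hwE⟩ : ∃ w ∈ B, w ∉ E := by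
    by_contra hcon
    push Not at hcon
    exact hEq (hEB.antisymm hcon)
  obtain ⟨a, b, ha, hb, hab, haE, hbE⟩ :=
    (hc v hv w hwB).exists_exit (p := fun z => z ∈ E) hvE hwE
  have h1 := M.len_insert_le hbE ⟨a, haE, hab⟩
  have h2 := hmax (insert b E) ⟨insert_subset hb hEB, mem_insert_of_mem hvE, by
    rw [card_insert_of_notMem hbE]; push_cast; linarith⟩
  rw [card_insert_of_notMem hbE] at h2
  omega

theorem len_union {B B' : Finset Vertex} (h : Disjoint (M.facesOf B) (M.facesOf B')) :
    M.len (B ∪ B') = M.len B + M.len B' := by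
  rw [len_eq, facesOf_union, sum_union h, len_eq, len_eq]
  congr 1
  · refine sum_congr rfl fun F hF => ?_
    have : ∀ k, M.cyc F k ∉ B' := fun k hk =>
      disjoint_left.1 h hF (M.mem_facesOf.2 ⟨k, hk⟩)
    simp [faceLen, this]
  · refine sum_congr rfl fun F hF => ?_
    have : ∀ k, M.cyc F k ∉ B := fun k hk =>
      disjoint_left.1 h (M.mem_facesOf.2 ⟨k, hk⟩) hF
    simp [faceLen, this]

/-- Two vertices are joined by an edge of the contour. -/
def Step (B : Finset Vertex) (u v : Vertex) : Prop := M.Dart B u v ∨ M.Dart B v u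

theorem step_cyc {B : Finset Vertex} {F : M.Fc} (hF : F ∈ M.facesOf B) {k : Fin L.faceSize}
    (h1 : M.cyc F k ∉ B) (h2 : M.cyc F (k + 1) ∉ B) :
    M.Dart B (M.cyc F k) (M.cyc F (k + 1)) := by
  obtain ⟨i, hi, hi'⟩ := M.adj_cyc F k
  exact ⟨h1, h2, i, hi', by rwa [hi]⟩

/-- The outer contour of a `*`-connected set is connected. -/
theorem contour_connected {B : Finset Vertex} (hB : L.StarConnected B) {v v' : Vertex}
    (hv : ∃ i, M.lf v i ∈ M.facesOf B) (hv' : ∃ i, M.lf v' i ∈ M.facesOf B)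
    (h : ConnectedIn L.graph (B : Set Vertex)ᶜ v v') :
    Relation.ReflTransGen (M.Step B) v v' := by
  set S : Set Vertex := {z | Relation.ReflTransGen (M.Step B) v z} with hS
  have hvB : v ∉ B := h.left_mem
  have hv'B : v' ∉ B := h.right_mem
  have hSB : ∀ z ∈ S, z ∉ B := by
    intro z hz
    rcases hz.cases_tail with rfl | ⟨y, -, hy | hy⟩
    exacts [hvB, hy.2.1, hy.1]
  have hstep : ∀ F ∈ M.facesOf B, ∀ k, M.cyc F k ∉ B → M.cyc F (k + 1) ∉ B →
      (M.cyc F k ∈ S ↔ M.cyc F (k + 1) ∈ S) := by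
    intro F hF k h1 h2
    have := M.step_cyc hF h1 h2
    exact ⟨fun h => h.tail (Or.inl this), fun h => h.tail (Or.inr this)⟩
  by_contra hcon
  change v' ∉ S at hcon
  -- A discrete Jordan argument. `S` is the contour component of `v`, and `c` marks the edges
  -- between `S` and `B`. On a face meeting `B` it is the coboundary of `σ`, because consecutive
  -- vertices off `B` are joined by a contour edge; on every other face it vanishes. So `c` is
  -- closed, hence exact.
  let σ : Vertex → ZMod 2 := fun z => if z ∈ S then 1 else 0
  let c : Vertex → Vertex → ZMod 2 := fun u w =>
    if (u ∈ S ∧ w ∈ B) ∨ (w ∈ S ∧ u ∈ B) then 1 else 0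
  have hc1 : ∀ F ∈ M.facesOf B, ∀ k, c (M.cyc F k) (M.cyc F (k + 1)) =
      σ (M.cyc F k) + σ (M.cyc F (k + 1)) := by
    intro F hF k
    have h0 := hstep F hF k
    have h1 := hSB (M.cyc F k)
    have h2 := hSB (M.cyc F (k + 1))
    have h3 : (1 : ZMod 2) + 1 = 0 := by decide
    simp only [c, σ]
    by_cases a1 : M.cyc F k ∈ S <;> by_cases a2 : M.cyc F (k + 1) ∈ S <;>
      simp [a1, a2, h1, h2, h3] at h0 ⊢ <;> tauto
  obtain ⟨g, hg⟩ := M.exact c (by intro u w; simp only [c, or_comm]) (by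
    intro F
    by_cases hF : F ∈ M.facesOf B
    · simp only [hc1 F hF, sum_add_distrib]
      rw [sum_succ_face (fun k => σ (M.cyc F k))]
      exact CharTwo.add_self_eq_zero _
    · have : ∀ k, M.cyc F k ∉ B := fun k hk => hF (M.mem_facesOf.2 ⟨k, hk⟩)
      simp [c, this])
  have hconst : ∀ F ∈ M.facesOf B, ∀ k m,
      g (M.cyc F k) + σ (M.cyc F k) = g (M.cyc F m) + σ (M.cyc F m) := by
    intro F hF k m
    refine Fin.cyclic_induction (p := fun m => g (M.cyc F k) + σ (M.cyc F k) =
      g (M.cyc F m) + σ (M.cyc F m)) (fun i hi => ?_) rfl m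
    obtain ⟨j, -, hj⟩ := M.adj_cyc F i
    have := hg _ _ (hj ▸ M.adj_nb _ j)
    rw [hi, this, hc1 F hF i]
    linear_combination -CharTwo.add_self_eq_zero (σ (M.cyc F (i + 1)))
  have hσB : ∀ z ∈ B, σ z = 0 := fun z hz => if_neg fun h => hSB z h hz
  have hgB : ∀ a ∈ B, ∀ b ∈ B, g a = g b := by
    intro a ha b hb
    refine (hB a ha b hb).induct (p := fun z => g a = g z) rfl fun x y hx hy hxy h => ?_
    obtain ⟨-, F, ⟨k, rfl⟩, ⟨m, rfl⟩⟩ := M.star_iff.1 hxy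
    have := hconst F (M.mem_facesOf.2 ⟨k, hx⟩) k m
    rw [hσB _ hx, hσB _ hy, add_zero, add_zero] at this
    exact h.trans this
  -- `c` vanishes on edges off `B`, so `g v = g v'`. But `g + σ` is constant on each face meeting
  -- `B`, and hence, `B` being `*`-connected, takes one value on all of them; so `σ v = σ v'`, a
  -- contradiction.
  have hgv : g v = g v' := by
    refine h.induct (p := fun z => g v = g z) rfl fun x y hx hy hxy h => ?_
    rw [hg x y hxy, h]
    have hx' : x ∉ B := hx
    have hy' : y ∉ B := hy
    simp [c, hx', hy']
  have hface : ∀ z, (∃ i, M.lf z i ∈ M.facesOf B) → ∃ b ∈ B, g z + σ z = g b := by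
    rintro z ⟨i, hi⟩
    obtain ⟨m, hm⟩ := M.mem_facesOf.1 hi
    obtain ⟨k, hk⟩ := M.mem_lf z i
    refine ⟨_, hm, ?_⟩
    have := hconst _ hi k m
    rwa [hk, hσB _ hm, add_zero] at this
  obtain ⟨b, hb, h1⟩ := hface v hv
  obtain ⟨b', hb', h2⟩ := hface v' hv'
  rw [hgB b hb b' hb', ← h2, hgv] at h1
  have h3 := add_left_cancel h1
  have h4 : v ∈ S := Relation.ReflTransGen.refl
  simp [σ, h4, hcon] at h3

end PlaneMap

end RegularLattice

/-! ### The three lattices -/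

namespace RegularLattice

open Finset

/-- One sum serves each half-line, the other being empty; modulo 2 they need no signs. -/
theorem exists_primitive (s : ℤ → ZMod 2) : ∃ σ : ℤ → ZMod 2, ∀ n, σ (n + 1) = σ n + s n := by
  refine ⟨fun n => ∑ i ∈ Ico 0 n, s i + ∑ i ∈ Ico n 0, s i, fun n => ?_⟩
  dsimp only
  rcases le_or_gt 0 n with h | h
  · have e : Ico 0 (n + 1) = insert n (Ico 0 n) := by ext x; simp; omega
    rw [e, sum_insert (by simp), Ico_eq_empty_of_le h, Ico_eq_empty_of_le (by omega : 0 ≤ n + 1)]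
    simp [add_comm]
  · have e : Ico n 0 = insert n (Ico (n + 1) 0) := by ext x; simp; omega
    rw [e, sum_insert (by simp), Ico_eq_empty_of_le h.le, Ico_eq_empty_of_le (by omega : n + 1 ≤ 0)]
    have := CharTwo.add_self_eq_zero (s n)
    simp only [sum_empty, zero_add]
    linear_combination -this

/-- Closed cochains modulo 2 on the square grid are exact. -/
theorem exists_potential (h w : ℤ → ℤ → ZMod 2)
    (hc : ∀ a b, h a b + w (a + 1) b + h a (b + 1) + w a b = 0) :
    ∃ g : Vertex → ZMod 2, (∀ a b, g (a + 1, b) = g (a, b) + h a b) ∧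
      ∀ a b, g (a, b + 1) = g (a, b) + w a b := by
  obtain ⟨W, hW⟩ := exists_primitive (w 0)
  choose H hH using fun b => exists_primitive fun a => h a b
  have h1 : ∀ a b, H b (a + 1) - H b 0 + W b = H b a - H b 0 + W b + h a b := by
    intro a b; rw [hH]; ring
  refine ⟨fun v => H v.2 v.1 - H v.2 0 + W v.2, h1, fun a b => ?_⟩
  dsimp only
  induction a using Int.induction_on with
  | zero => rw [hW]; ring
  | succ a ih =>
    rw [h1, h1, ih]
    have := hc a b
    have t1 := CharTwo.add_self_eq_zero (h a b)
    have t2 := CharTwo.add_self_eq_zero (w (a + 1) b)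
    linear_combination this - t1 - t2
  | pred a ih =>
    have h2 := h1 (-a - 1) (b + 1)
    have h3 := h1 (-a - 1) b
    have := hc (-a - 1) b
    rw [sub_add_cancel] at h2 h3 this
    rw [h2, h3] at ih
    have t1 := CharTwo.add_self_eq_zero (h (-a - 1) (b + 1))
    have t2 := CharTwo.add_self_eq_zero (w (-a - 1) b)
    linear_combination ih + this - t1 - t2

/-! ### The rotation system of the square lattice -/

theorem abs_add_abs_eq_one {x y : ℤ} (h : |x| + |y| = 1) :
    (x = 1 ∧ y = 0) ∨ (x = 0 ∧ y = 1) ∨ (x = -1 ∧ y = 0) ∨ (x = 0 ∧ y = -1) := by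
  rcases abs_cases x with hx | hx <;> rcases abs_cases y with hy | hy <;> omega

def squareNb (v : Vertex) : Fin 4 → Vertex :=
  ![(v.1 + 1, v.2), (v.1, v.2 + 1), (v.1 - 1, v.2), (v.1, v.2 - 1)]

def squareLf (v : Vertex) : Fin 4 → Vertex :=
  ![(v.1, v.2), (v.1 - 1, v.2), (v.1 - 1, v.2 - 1), (v.1, v.2 - 1)]

def squareCyc (F : Vertex) : Fin 4 → Vertex :=
  ![(F.1, F.2), (F.1 + 1, F.2), (F.1 + 1, F.2 + 1), (F.1, F.2 + 1)]

theorem squareNb_adj_iff (u v : Vertex) : squareGraph.Adj u v ↔ ∃ i, squareNb u i = v := by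
  obtain ⟨a, b⟩ := u
  obtain ⟨a', b'⟩ := v
  constructor
  · intro h
    rcases abs_add_abs_eq_one h with h | h | h | h
    · exact ⟨2, by simp [squareNb]; omega⟩
    · exact ⟨3, by simp [squareNb]; omega⟩
    · exact ⟨0, by simp [squareNb]; omega⟩
    · exact ⟨1, by simp [squareNb]; omega⟩
  · rintro ⟨i, hi⟩
    fin_cases i <;> simp [squareNb] at hi <;> obtain ⟨rfl, rfl⟩ := hi <;> simp [squareGraph]

theorem squareNb_injective (v : Vertex) : Function.Injective (squareNb v) := by
  intro i j h
  fin_cases i <;> fin_cases j <;> simp [squareNb] at h ⊢ <;> omega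

theorem squareCyc_injective : ∀ F, Function.Injective (squareCyc F) := by
  rintro ⟨a, b⟩ i j h
  fin_cases i <;> fin_cases j <;> simp [squareCyc] at h ⊢

theorem square_isFace_iff (S : Set Vertex) : square.IsFace S ↔ ∃ F, S = Set.range (squareCyc F) := by
  have : ∀ F, Set.range (squareCyc F) =
      {(F.1, F.2), (F.1 + 1, F.2), (F.1 + 1, F.2 + 1), (F.1, F.2 + 1)} := by
    intro F; ext x; simp [squareCyc, Matrix.range_cons]; tauto
  exact ⟨fun ⟨a, b, h⟩ => ⟨(a, b), h.trans (this (a, b)).symm⟩,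
    fun ⟨F, h⟩ => ⟨F.1, F.2, h.trans (this F)⟩⟩

theorem squareLf_injective (v : Vertex) : Function.Injective (squareLf v) := by
  obtain ⟨a, b⟩ := v
  intro i j h
  fin_cases i <;> fin_cases j <;> simp [squareLf] at h ⊢ <;> omega

theorem square_pos : ∀ (v : Vertex) (i : Fin 4), ∃ k : Fin 4, squareCyc (squareLf v i) k = v ∧
    squareCyc (squareLf v i) (k + 1) = squareNb v i ∧ squareCyc (squareLf v i) (k - 1) = squareNb v (i + 1) := by
  intro v i
  refine ⟨i, ?_⟩
  obtain ⟨a, b⟩ := v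
  fin_cases i <;> refine ⟨?_, ?_, ?_⟩ <;>
    first | rfl | (ext <;> simp [squareCyc, squareLf, squareNb])

theorem square_lf_surj : ∀ (F : Vertex) (k : Fin 4), ∃ i, squareLf (squareCyc F k) i = F := by
  intro F k
  refine ⟨k, ?_⟩
  obtain ⟨a, b⟩ := F
  fin_cases k <;> simp [squareCyc, squareLf]

theorem square_exact (c : Vertex → Vertex → ZMod 2) (hc : ∀ u v, c u v = c v u)
    (hF : ∀ F, ∑ k, c (squareCyc F k) (squareCyc F (k + 1)) = 0) :
    ∃ g : Vertex → ZMod 2, ∀ u v, squareGraph.Adj u v → g v = g u + c u v := by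
  have hF' : ∀ a b : ℤ, c (a, b) (a + 1, b) + c (a + 1, b) (a + 1, b + 1) +
      c (a, b + 1) (a + 1, b + 1) + c (a, b) (a, b + 1) = 0 := by
    intro a b
    have h : ∑ k : Fin 4, c (squareCyc (a, b) k) (squareCyc (a, b) (k + 1)) = 0 := hF (a, b)
    rw [Fin.sum_univ_four] at h
    rw [hc (a, b + 1), hc (a, b) (a, b + 1)]
    exact h
  obtain ⟨g, h1, h2⟩ := exists_potential (fun a b => c (a, b) (a + 1, b))
    (fun a b => c (a, b) (a, b + 1)) hF'
  refine ⟨g, fun u v huv => ?_⟩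
  obtain ⟨a, b⟩ := u
  obtain ⟨i, rfl⟩ := (squareNb_adj_iff _ v).1 huv
  have t : ∀ x : ZMod 2, x + x = 0 := CharTwo.add_self_eq_zero
  fin_cases i
  · exact h1 a b
  · exact h2 a b
  · have := h1 (a - 1) b
    simp only [sub_add_cancel] at this
    change g (a - 1, b) = g (a, b) + c (a, b) (a - 1, b)
    rw [hc]
    linear_combination -this + t (g (a, b)) - t (g (a, b)) - t (c (a - 1, b) (a, b))
  · have := h2 a (b - 1)
    simp only [sub_add_cancel] at this
    change g (a, b - 1) = g (a, b) + c (a, b) (a, b - 1)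
    rw [hc]
    linear_combination -this - t (c (a, b - 1) (a, b))

/-- The rotation system of the square lattice. -/
def squareMap : PlaneMap square where
  Fc := Vertex
  nb := squareNb
  lf := squareLf
  cyc := squareCyc
  nb_inj := squareNb_injective
  adj_iff := squareNb_adj_iff
  cyc_inj := squareCyc_injective
  isFace_iff := square_isFace_iff
  lf_inj := squareLf_injective
  pos := square_pos
  lf_surj := square_lf_surj
  exact := square_exact

/-! ### The rotation system of the triangular lattice -/

def triNb (v : Vertex) : Fin 6 → Vertex :=
  ![(v.1 + 1, v.2), (v.1, v.2 + 1), (v.1 - 1, v.2 + 1), (v.1 - 1, v.2), (v.1, v.2 - 1),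
    (v.1 + 1, v.2 - 1)]

def triLf (v : Vertex) : Fin 6 → Vertex × Bool :=
  ![((v.1, v.2), true), ((v.1 - 1, v.2), false), ((v.1 - 1, v.2), true),
    ((v.1 - 1, v.2 - 1), false), ((v.1, v.2 - 1), true), ((v.1, v.2 - 1), false)]

def triCyc (F : Vertex × Bool) : Fin 3 → Vertex :=
  if F.2 = true then ![(F.1.1, F.1.2), (F.1.1 + 1, F.1.2), (F.1.1, F.1.2 + 1)]
  else ![(F.1.1 + 1, F.1.2), (F.1.1 + 1, F.1.2 + 1), (F.1.1, F.1.2 + 1)]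

theorem triNb_adj_iff (u v : Vertex) : triangularGraph.Adj u v ↔ ∃ i, triNb u i = v := by
  obtain ⟨a, b⟩ := u
  obtain ⟨a', b'⟩ := v
  constructor
  · intro h
    simp only [triangularGraph, Set.mem_insert_iff, Set.mem_singleton_iff, Prod.mk_sub_mk,
      Prod.mk.injEq] at h
    rcases h with h | h | h | h | h | h
    · exact ⟨0, by simp [triNb]; omega⟩
    · exact ⟨3, by simp [triNb]; omega⟩
    · exact ⟨1, by simp [triNb]; omega⟩
    · exact ⟨4, by simp [triNb]; omega⟩
    · exact ⟨5, by simp [triNb]; omega⟩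
    · exact ⟨2, by simp [triNb]; omega⟩
  · rintro ⟨i, hi⟩
    fin_cases i <;> simp [triNb] at hi <;> obtain ⟨rfl, rfl⟩ := hi <;> simp [triangularGraph]

theorem triNb_injective (v : Vertex) : Function.Injective (triNb v) := by
  intro i j h
  fin_cases i <;> fin_cases j <;> simp [triNb] at h ⊢ <;> omega

theorem triCyc_injective : ∀ F, Function.Injective (triCyc F) := by
  rintro ⟨⟨a, b⟩, _ | _⟩ <;> intro i j h <;>
    fin_cases i <;> fin_cases j <;> simp [triCyc] at h ⊢

theorem tri_isFace_iff (S : Set Vertex) : triangular.IsFace S ↔ ∃ F, S = Set.range (triCyc F) := by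
  have h1 : ∀ v : Vertex, Set.range (triCyc (v, true)) =
      {(v.1, v.2), (v.1 + 1, v.2), (v.1, v.2 + 1)} := by
    intro F; ext x; simp [triCyc, Matrix.range_cons]; tauto
  have h2 : ∀ v : Vertex, Set.range (triCyc (v, false)) =
      {(v.1 + 1, v.2), (v.1 + 1, v.2 + 1), (v.1, v.2 + 1)} := by
    intro F; ext x; simp [triCyc, Matrix.range_cons]; tauto
  constructor
  · rintro ⟨a, b, h | h⟩
    · exact ⟨((a, b), true), h.trans (h1 (a, b)).symm⟩
    · exact ⟨((a, b), false), h.trans (h2 (a, b)).symm⟩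
  · rintro ⟨⟨v, _ | _⟩, h⟩
    · exact ⟨v.1, v.2, Or.inr (h.trans (h2 v))⟩
    · exact ⟨v.1, v.2, Or.inl (h.trans (h1 v))⟩

theorem triLf_injective (v : Vertex) : Function.Injective (triLf v) := by
  obtain ⟨a, b⟩ := v
  intro i j h
  fin_cases i <;> fin_cases j <;> simp [triLf] at h ⊢ <;> omega

theorem tri_pos : ∀ (v : Vertex) (i : Fin 6), ∃ k : Fin 3, triCyc (triLf v i) k = v ∧
    triCyc (triLf v i) (k + 1) = triNb v i ∧ triCyc (triLf v i) (k - 1) = triNb v (i + 1) := by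
  intro v i
  obtain ⟨a, b⟩ := v
  refine ⟨![0, 0, 1, 1, 2, 2] i, ?_⟩
  fin_cases i <;> refine ⟨?_, ?_, ?_⟩ <;>
    first | rfl | (ext <;> simp [triCyc, triLf, triNb])

theorem tri_lf_surj : ∀ (F : Vertex × Bool) (k : Fin 3), ∃ i, triLf (triCyc F k) i = F := by
  rintro ⟨⟨a, b⟩, _ | _⟩ <;> intro k
  · refine ⟨![1, 3, 5] k, ?_⟩
    fin_cases k <;> simp [triCyc, triLf]
  · refine ⟨![0, 2, 4] k, ?_⟩
    fin_cases k <;> simp [triCyc, triLf]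

/-- The two triangles of a unit square share the diagonal, which cancels modulo 2; so the square
grid has a potential, and one of the triangles gives its increment along the diagonal. -/
theorem tri_exact (c : Vertex → Vertex → ZMod 2) (hc : ∀ u v, c u v = c v u)
    (hF : ∀ F, ∑ k, c (triCyc F k) (triCyc F (k + 1)) = 0) :
    ∃ g : Vertex → ZMod 2, ∀ u v, triangularGraph.Adj u v → g v = g u + c u v := by
  have t : ∀ x : ZMod 2, x + x = 0 := CharTwo.add_self_eq_zero
  have hu : ∀ a b : ℤ, c (a, b) (a + 1, b) + c (a + 1, b) (a, b + 1) +
      c (a, b + 1) (a, b) = 0 := by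
    intro a b
    have h : ∑ k : Fin 3, c (triCyc ((a, b), true) k) (triCyc ((a, b), true) (k + 1)) = 0 :=
      hF ((a, b), true)
    rw [Fin.sum_univ_three] at h
    exact h
  have hd : ∀ a b : ℤ, c (a + 1, b) (a + 1, b + 1) + c (a + 1, b + 1) (a, b + 1) +
      c (a, b + 1) (a + 1, b) = 0 := by
    intro a b
    have h : ∑ k : Fin 3, c (triCyc ((a, b), false) k) (triCyc ((a, b), false) (k + 1)) = 0 :=
      hF ((a, b), false)
    rw [Fin.sum_univ_three] at h
    exact h
  obtain ⟨g, h1, h2⟩ := exists_potential (fun a b => c (a, b) (a + 1, b))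
    (fun a b => c (a, b) (a, b + 1)) (by
      intro a b
      have e1 := hu a b
      have e2 := hd a b
      rw [hc (a, b + 1) (a, b)] at e1
      rw [hc (a + 1, b + 1) (a, b + 1), hc (a, b + 1) (a + 1, b)] at e2
      linear_combination e1 + e2 - t (c (a + 1, b) (a, b + 1)))
  refine ⟨g, fun u v huv => ?_⟩
  obtain ⟨a, b⟩ := u
  obtain ⟨i, rfl⟩ := (triNb_adj_iff _ v).1 huv
  have hdiag : ∀ a b : ℤ, g (a, b + 1) = g (a + 1, b) + c (a + 1, b) (a, b + 1) := by
    intro a b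
    have e1 := hu a b
    rw [hc (a, b + 1) (a, b)] at e1
    linear_combination h2 a b - h1 a b + e1 - t (c (a + 1, b) (a, b + 1)) - t (c (a, b) (a + 1, b))
  fin_cases i
  · exact h1 a b
  · exact h2 a b
  · have := hdiag (a - 1) b
    simp only [sub_add_cancel] at this
    exact this
  · have := h1 (a - 1) b
    simp only [sub_add_cancel] at this
    change g (a - 1, b) = g (a, b) + c (a, b) (a - 1, b)
    rw [hc]
    linear_combination -this - t (c (a - 1, b) (a, b))
  · have := h2 a (b - 1)
    simp only [sub_add_cancel] at this
    change g (a, b - 1) = g (a, b) + c (a, b) (a, b - 1)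
    rw [hc]
    linear_combination -this - t (c (a, b - 1) (a, b))
  · have := hdiag a (b - 1)
    simp only [sub_add_cancel] at this
    change g (a + 1, b - 1) = g (a, b) + c (a, b) (a + 1, b - 1)
    rw [hc]
    linear_combination -this - t (c (a + 1, b - 1) (a, b))

/-- The rotation system of the triangular lattice. -/
def triangularMap : PlaneMap triangular where
  Fc := Vertex × Bool
  nb := triNb
  lf := triLf
  cyc := triCyc
  nb_inj := triNb_injective
  adj_iff := triNb_adj_iff
  cyc_inj := triCyc_injective
  isFace_iff := tri_isFace_iff
  lf_inj := triLf_injective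
  pos := tri_pos
  lf_surj := tri_lf_surj
  exact := tri_exact

/-! ### The rotation system of the hexagonal lattice -/

def hexNb (v : Vertex) : Fin 3 → Vertex :=
  if Even (v.1 + v.2) then ![(v.1 + 1, v.2), (v.1, v.2 + 1), (v.1 - 1, v.2)]
  else ![(v.1 - 1, v.2), (v.1, v.2 - 1), (v.1 + 1, v.2)]

/-- The hexagon `(m, b)` is the one with lower left corner `(b + 2 * m, b)`. -/
def hexCyc (F : Vertex) : Fin 6 → Vertex :=
  ![(F.2 + 2 * F.1, F.2), (F.2 + 2 * F.1 + 1, F.2), (F.2 + 2 * F.1 + 2, F.2),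
    (F.2 + 2 * F.1 + 2, F.2 + 1), (F.2 + 2 * F.1 + 1, F.2 + 1), (F.2 + 2 * F.1, F.2 + 1)]

def hexLf (v : Vertex) : Fin 3 → Vertex :=
  if Even (v.1 + v.2) then
    ![((v.1 - v.2) / 2, v.2), ((v.1 - v.2) / 2 - 1, v.2), ((v.1 - v.2) / 2, v.2 - 1)]
  else
    ![((v.1 - v.2) / 2, v.2 - 1), ((v.1 - v.2) / 2 + 1, v.2 - 1), ((v.1 - v.2) / 2, v.2)]

theorem hex_cases (v : Vertex) : ∃ m b : ℤ, v = (b + 2 * m, b) ∨ v = (b + 2 * m + 1, b) := by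
  obtain ⟨a, b⟩ := v
  refine ⟨(a - b) / 2, b, ?_⟩
  simp only [Prod.mk.injEq, and_true]
  omega

theorem even_hex (m b : ℤ) : Even (b + 2 * m + b) := ⟨b + m, by ring⟩

theorem not_even_hex (m b : ℤ) : ¬ Even (b + 2 * m + 1 + b) := by
  rw [Int.not_even_iff_odd]; exact ⟨b + m, by ring⟩

theorem hexNb_even (m b : ℤ) : hexNb (b + 2 * m, b) =
    ![(b + 2 * m + 1, b), (b + 2 * m, b + 1), (b + 2 * m - 1, b)] := if_pos (even_hex m b)

theorem hexNb_odd (m b : ℤ) : hexNb (b + 2 * m + 1, b) =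
    ![(b + 2 * m + 1 - 1, b), (b + 2 * m + 1, b - 1), (b + 2 * m + 1 + 1, b)] :=
  if_neg (not_even_hex m b)

theorem hexLf_even (m b : ℤ) : hexLf (b + 2 * m, b) = ![(m, b), (m - 1, b), (m, b - 1)] := by
  have e : (b + 2 * m - b) / 2 = m := by omega
  simp only [hexLf, even_hex, if_true, e]

theorem hexLf_odd (m b : ℤ) :
    hexLf (b + 2 * m + 1, b) = ![(m, b - 1), (m + 1, b - 1), (m, b)] := by
  have e : (b + 2 * m + 1 - b) / 2 = m := by omega
  simp only [hexLf, not_even_hex, if_false, e]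

theorem abs_eq_one {x : ℤ} (h : |x| = 1) : x = 1 ∨ x = -1 := by
  rcases abs_cases x with hx | hx <;> omega

theorem hexNb_adj_iff (u v : Vertex) : hexagonalGraph.Adj u v ↔ ∃ i, hexNb u i = v := by
  obtain ⟨m, b, rfl | rfl⟩ := hex_cases u <;> obtain ⟨a', b'⟩ := v
  · rw [hexNb_even]
    constructor
    · rintro (⟨h1, h2⟩ | ⟨h1, h2, h3⟩ | ⟨h1, h2, h3⟩)
      · rcases abs_eq_one h2 with h2 | h2
        · exact ⟨2, by simp at h1 h2 ⊢; omega⟩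
        · exact ⟨0, by simp at h1 h2 ⊢; omega⟩
      · exact ⟨1, by simp at h1 h2 ⊢; omega⟩
      · exfalso
        obtain ⟨r, hr⟩ := h3
        simp at h1 h2 hr; omega
    · rintro ⟨i, hi⟩
      fin_cases i <;> simp at hi <;> obtain ⟨rfl, rfl⟩ := hi <;>
        simp [hexagonalGraph]
      exact Or.inl (even_hex m b)
  · rw [hexNb_odd]
    constructor
    · rintro (⟨h1, h2⟩ | ⟨h1, h2, h3⟩ | ⟨h1, h2, h3⟩)
      · rcases abs_eq_one h2 with h2 | h2
        · exact ⟨0, by simp at h1 h2 ⊢; omega⟩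
        · exact ⟨2, by simp at h1 h2 ⊢; omega⟩
      · exact absurd h3 (not_even_hex m b)
      · exact ⟨1, by simp at h1 h2 ⊢; omega⟩
    · rintro ⟨i, hi⟩
      fin_cases i <;> simp at hi <;> obtain ⟨rfl, rfl⟩ := hi <;>
        simp [hexagonalGraph]
      exact Or.inr ⟨b + m, by ring⟩

theorem hexNb_injective (v : Vertex) : Function.Injective (hexNb v) := by
  intro i j h
  obtain ⟨m, b, rfl | rfl⟩ := hex_cases v <;> simp only [hexNb_even, hexNb_odd] at h <;>
    fin_cases i <;> fin_cases j <;> simp at h ⊢ <;> omega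

theorem hexCyc_injective : ∀ F, Function.Injective (hexCyc F) := by
  intro v i j h
  fin_cases i <;> fin_cases j <;> simp [hexCyc] at h ⊢

theorem hex_isFace_iff (S : Set Vertex) : hexagonal.IsFace S ↔ ∃ F, S = Set.range (hexCyc F) := by
  have : ∀ F, Set.range (hexCyc F) =
      {(F.2 + 2 * F.1, F.2), (F.2 + 2 * F.1 + 1, F.2), (F.2 + 2 * F.1 + 2, F.2),
  (F.2 + 2 * F.1 + 2, F.2 + 1), (F.2 + 2 * F.1 + 1, F.2 + 1), (F.2 + 2 * F.1, F.2 + 1)} := by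
    intro F; ext x; simp [hexCyc, Matrix.range_cons]; tauto
  constructor
  · rintro ⟨a, b, ⟨r, hr⟩, h⟩
    refine ⟨(r - b, b), ?_⟩
    have e : a = b + 2 * (r - b) := by omega
    rw [this, h, e]
  · rintro ⟨F, h⟩
    exact ⟨_, _, even_hex F.1 F.2, h.trans (this F)⟩

theorem hexLf_injective (v : Vertex) : Function.Injective (hexLf v) := by
  intro i j h
  obtain ⟨m, b, rfl | rfl⟩ := hex_cases v <;> simp only [hexLf_even, hexLf_odd] at h <;>
    fin_cases i <;> fin_cases j <;> simp at h ⊢ <;> omega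

theorem hex_pos : ∀ (v : Vertex) (i : Fin 3), ∃ k : Fin 6, hexCyc (hexLf v i) k = v ∧
    hexCyc (hexLf v i) (k + 1) = hexNb v i ∧ hexCyc (hexLf v i) (k - 1) = hexNb v (i + 1) := by
  intro v i
  obtain ⟨m, b, rfl | rfl⟩ := hex_cases v
  · refine ⟨![0, 2, 4] i, ?_⟩
    simp only [hexNb_even, hexLf_even]
    fin_cases i <;> refine ⟨?_, ?_, ?_⟩ <;>
      first | rfl | (ext <;> simp [hexCyc]; ring)
  · refine ⟨![3, 5, 1] i, ?_⟩
    simp only [hexNb_odd, hexLf_odd]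
    fin_cases i <;> refine ⟨?_, ?_, ?_⟩ <;>
      first | rfl | (ext <;> simp [hexCyc] <;> ring)

theorem hex_lf_surj : ∀ (F : Vertex) (k : Fin 6), ∃ i, hexLf (hexCyc F k) i = F := by
  rintro ⟨m, b⟩
  intro k
  refine ⟨![0, 2, 1, 0, 2, 1] k, ?_⟩
  fin_cases k
  · exact congrFun (hexLf_even m b) 0
  · exact congrFun (hexLf_odd m b) 2
  · have := congrFun (hexLf_even (m + 1) b) 1
    have e : b + 2 * (m + 1) = b + 2 * m + 2 := by ring
    rw [e] at this
    simpa [hexCyc] using this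
  · have := congrFun (hexLf_odd m (b + 1)) 0
    have e : b + 1 + 2 * m + 1 = b + 2 * m + 2 := by ring
    rw [e] at this
    simpa [hexCyc] using this
  · have := congrFun (hexLf_even m (b + 1)) 2
    have e : b + 1 + 2 * m = b + 2 * m + 1 := by ring
    rw [e] at this
    simpa [hexCyc] using this
  · have := congrFun (hexLf_odd (m - 1) (b + 1)) 1
    have e : b + 1 + 2 * (m - 1) + 1 = b + 2 * m := by ring
    rw [e] at this
    simpa [hexCyc] using this

theorem hex_exact (c : Vertex → Vertex → ZMod 2) (hc : ∀ u v, c u v = c v u)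
    (hF : ∀ F, ∑ k, c (hexCyc F k) (hexCyc F (k + 1)) = 0) :
    ∃ g : Vertex → ZMod 2, ∀ u v, hexagonalGraph.Adj u v → g v = g u + c u v := by
  have t : ∀ x : ZMod 2, x + x = 0 := CharTwo.add_self_eq_zero
  let h : ℤ → ℤ → ZMod 2 := fun a b => c (a, b) (a + 1, b)
  -- A missing vertical edge cuts a hexagon into two unit squares. The value on it is chosen so that
  -- the left square closes; the right one then closes by the relation of the hexagon.
  let w : ℤ → ℤ → ZMod 2 := fun a b => if Even (a + b) then c (a, b) (a, b + 1) else
    h (a - 1) b + c (a - 1, b) (a - 1, b + 1) + h (a - 1) (b + 1)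
  have hface : ∀ m b : ℤ, h (b + 2 * m) b + h (b + 2 * m + 1) b +
      c (b + 2 * m + 2, b) (b + 2 * m + 2, b + 1) + h (b + 2 * m + 1) (b + 1) +
      h (b + 2 * m) (b + 1) + c (b + 2 * m, b) (b + 2 * m, b + 1) = 0 := by
    intro m b
    have h' : ∑ k : Fin 6, c (hexCyc (m, b) k) (hexCyc (m, b) (k + 1)) = 0 := hF (m, b)
    rw [Fin.sum_univ_six] at h'
    have e : b + 2 * m + 1 + 1 = b + 2 * m + 2 := by ring
    simp only [h, e]
    rw [hc (b + 2 * m + 1, b + 1) (b + 2 * m + 2, b + 1), hc (b + 2 * m, b + 1),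
      hc (b + 2 * m, b) (b + 2 * m, b + 1)]
    exact h'
  obtain ⟨g, h1, h2⟩ := exists_potential h w (by
    intro a b
    obtain ⟨m, b, hv | hv⟩ := hex_cases (a, b) <;> simp only [Prod.mk.injEq] at hv <;>
      obtain ⟨rfl, rfl⟩ := hv
    · have n1 := not_even_hex m b
      simp only [w, even_hex, n1, if_true, if_false, add_sub_cancel_right]
      linear_combination t (h (b + 2 * m) b) + t (h (b + 2 * m) (b + 1)) +
        t (c (b + 2 * m, b) (b + 2 * m, b + 1))
    · have n1 : Even (b + 2 * m + 1 + 1 + b) := ⟨b + m + 1, by ring⟩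
      simp only [w, not_even_hex, n1, if_true, if_false, add_sub_cancel_right]
      have e : b + 2 * m + 1 + 1 = b + 2 * m + 2 := by ring
      rw [e]
      linear_combination hface m b)
  refine ⟨g, fun u v huv => ?_⟩
  have hx : ∀ a b : ℤ, g (a - 1, b) = g (a, b) + c (a, b) (a - 1, b) := by
    intro a b
    have := h1 (a - 1) b
    simp only [h, sub_add_cancel] at this
    rw [hc (a, b)]
    linear_combination -this - t (c (a - 1, b) (a, b))
  obtain ⟨i, rfl⟩ := (hexNb_adj_iff u v).1 huv
  obtain ⟨m, b, rfl | rfl⟩ := hex_cases u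
  · simp only [hexNb_even]
    fin_cases i
    · exact h1 _ _
    · have := h2 (b + 2 * m) b
      simp only [w, even_hex, if_true] at this
      exact this
    · exact hx _ _
  · simp only [hexNb_odd]
    fin_cases i
    · exact hx _ _
    · have := h2 (b + 2 * m + 1) (b - 1)
      have n1 : Even (b + 2 * m + 1 + (b - 1)) := ⟨b + m, by ring⟩
      simp only [w, n1, if_true, sub_add_cancel] at this
      change g (b + 2 * m + 1, b - 1) = g (b + 2 * m + 1, b) + _
      rw [hc]
      change _ = _ + c (b + 2 * m + 1, b - 1) (b + 2 * m + 1, b)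
      linear_combination -this - t (c (b + 2 * m + 1, b - 1) (b + 2 * m + 1, b))
    · exact h1 _ _

/-- The rotation system of the hexagonal lattice. -/
def hexagonalMap : PlaneMap hexagonal where
  Fc := Vertex
  nb := hexNb
  lf := hexLf
  cyc := hexCyc
  nb_inj := hexNb_injective
  adj_iff := hexNb_adj_iff
  cyc_inj := hexCyc_injective
  isFace_iff := hex_isFace_iff
  lf_inj := hexLf_injective
  pos := hex_pos
  lf_surj := hex_lf_surj
  exact := hex_exact

/-- The rotation system of the lattice. -/
def planeMap : (L : RegularLattice) → PlaneMap L
  | square => squareMap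
  | triangular => triangularMap
  | hexagonal => hexagonalMap

end RegularLattice

/-! ### Gates between interlocked sets -/

namespace RegularLattice

open Finset

open scoped Classical

/-- Removing a vertex whose neighbours are joined by a detour does not affect connectivity. -/
theorem ConnectedIn.avoid {G : SimpleGraph Vertex} {Z : Set Vertex} {x : Vertex}
    (hx : ∀ u v, G.Adj x u → G.Adj x v → u ∉ insert x Z → v ∉ insert x Z →
      ConnectedIn G (insert x Z)ᶜ u v) {v₁ v₂ : Vertex} (h₁ : v₁ ≠ x) (h₂ : v₂ ≠ x)
    (h : ConnectedIn G Zᶜ v₁ v₂) : ConnectedIn G (insert x Z)ᶜ v₁ v₂ := by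
  have mem : ∀ {z}, z ∈ Zᶜ → z ≠ x → z ∈ (insert x Z)ᶜ := fun hz hne h =>
    h.elim (fun h => hne h) fun h => hz h
  have key : (v₂ ≠ x → ConnectedIn G (insert x Z)ᶜ v₁ v₂) ∧
      (v₂ = x → ∃ u, G.Adj x u ∧ u ≠ x ∧ ConnectedIn G (insert x Z)ᶜ v₁ u) := by
    refine h.induct (p := fun z => (z ≠ x → ConnectedIn G (insert x Z)ᶜ v₁ z) ∧
      (z = x → ∃ u, G.Adj x u ∧ u ≠ x ∧ ConnectedIn G (insert x Z)ᶜ v₁ u))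
      ⟨fun _ => .refl (mem h.left_mem h₁), fun h => absurd h h₁⟩ ?_
    rintro a b ha hb hab ⟨ih1, ih2⟩
    refine ⟨fun hbx => ?_, ?_⟩
    · by_cases hax : a = x
      · obtain ⟨u, hu, -, huc⟩ := ih2 hax
        subst hax
        exact huc.trans (hx u b hu hab huc.right_mem (mem hb hbx))
      · exact (ih1 hax).trans (.of_adj (mem ha hax) (mem hb hbx) hab)
    · rintro rfl
      exact ⟨a, hab.symm, hab.ne, ih1 hab.ne⟩
  exact key.1 h₂

namespace PlaneMap

variable {L : RegularLattice} (M : PlaneMap L)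

/-- The vertices of the faces that meet `B`. -/
noncomputable def nbhd (B : Finset Vertex) : Finset Vertex :=
  (M.facesOf B).biUnion fun F => univ.image (M.cyc F)

theorem mem_nbhd {B : Finset Vertex} {v : Vertex} :
    v ∈ M.nbhd B ↔ ∃ i, M.lf v i ∈ M.facesOf B := by
  simp only [nbhd, mem_biUnion, mem_image, mem_univ, true_and]
  constructor
  · rintro ⟨F, hF, hv⟩
    obtain ⟨i, rfl⟩ := M.exists_lf_eq hv
    exact ⟨i, hF⟩
  · rintro ⟨i, hi⟩
    exact ⟨_, hi, M.mem_lf v i⟩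

theorem cyc_mem_nbhd {B : Finset Vertex} {F : M.Fc} (hF : F ∈ M.facesOf B) (k) :
    M.cyc F k ∈ M.nbhd B := by
  simp only [nbhd, mem_biUnion, mem_image, mem_univ, true_and]
  exact ⟨F, hF, k, rfl⟩

variable {M} in
theorem Dart.mem_nbhd {B : Finset Vertex} {u v : Vertex} (h : M.Dart B u v) :
    u ∈ M.nbhd B ∧ v ∈ M.nbhd B := by
  obtain ⟨-, -, i, rfl, hF⟩ := h
  refine ⟨M.mem_nbhd.2 ⟨i, hF⟩, ?_⟩
  obtain ⟨k, hk⟩ := M.nb_mem_lf u i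
  exact hk ▸ M.cyc_mem_nbhd hF k

variable {M} in
theorem Step.mem_nbhd {B : Finset Vertex} {u v : Vertex} (h : M.Step B u v) :
    u ∈ M.nbhd B ∧ v ∈ M.nbhd B :=
  h.elim (fun h => h.mem_nbhd) fun h => h.mem_nbhd.symm

variable {M} in
theorem Step.symm {B : Finset Vertex} {u v : Vertex} (h : M.Step B u v) : M.Step B v u := Or.symm h

variable {M} in
theorem Step.adj {B : Finset Vertex} {u v : Vertex} (h : M.Step B u v) : L.graph.Adj u v :=
  h.elim (fun h => h.adj) fun h => h.adj.symm

variable {M} in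
theorem Step.notMem {B : Finset Vertex} {u v : Vertex} (h : M.Step B u v) : u ∉ B ∧ v ∉ B :=
  h.elim (fun h => ⟨h.1, h.2.1⟩) fun h => ⟨h.2.1, h.1⟩

/-- If the contour passes through `x` only once then it may be cut at `x`. -/
theorem detour {B : Finset Vertex} {x u d : Vertex}
    (hx : ∀ z, M.Step B x z → z = u ∨ z = d) (hu : ¬ (M.Dart B x u ↔ M.Dart B u x)) :
    Relation.ReflTransGen (fun a b => M.Step B a b ∧ a ≠ x ∧ b ≠ x) u d := by
  have hux : M.Step B u x := by unfold Step; tauto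
  set R := Relation.ReflTransGen (fun a b => M.Step B a b ∧ a ≠ x ∧ b ≠ x) u
  by_contra hd
  set T := M.nbhd B
  set S := T.filter R
  have hRx : ∀ z, R z → z ≠ x := by
    intro z hz
    rcases hz.cases_tail with rfl | ⟨y, -, hy⟩
    exacts [hux.adj.ne, hy.2.2]
  have huS : u ∈ S := mem_filter.2 ⟨hux.mem_nbhd.1, .refl⟩
  have hxT : x ∈ T \ S := mem_sdiff.2 ⟨hux.mem_nbhd.2, fun h => hRx x (mem_filter.1 h).2 rfl⟩
  -- If `d` cannot be reached without `x`, then the only contour edge leaving the part reached from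
  -- `u` is the one between `u` and `x`. It has just one direction by `hu`, against conservation of
  -- flow.
  have hcross : ∀ a ∈ S, ∀ b ∈ T \ S, M.Step B a b → a = u ∧ b = x := by
    intro a ha b hb hab
    have hb' : b = x := by
      by_contra hbx
      exact (mem_sdiff.1 hb).2 (mem_filter.2 ⟨(mem_sdiff.1 hb).1,
        (mem_filter.1 ha).2.tail ⟨hab, hRx a (mem_filter.1 ha).2, hbx⟩⟩)
    subst hb'
    rcases hx a hab.symm with h | h
    · exact ⟨h, rfl⟩
    · exact absurd (h ▸ (mem_filter.1 ha).2) hd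
  have key : ∀ K : Vertex → Vertex → ℤ, (∀ a b, K a b ≠ 0 → M.Step B a b) →
      ∑ a ∈ S, ∑ b ∈ T \ S, K a b = K u x := by
    intro K hK
    rw [sum_eq_single_of_mem u huS, sum_eq_single_of_mem x hxT]
    · intro b hb hbx
      by_contra h
      exact hbx (hcross u huS b hb (hK _ _ h)).2
    · intro a ha hau
      refine sum_eq_zero fun b hb => ?_
      by_contra h
      exact hau (hcross a ha b hb (hK _ _ h)).1
  have hcut := cut_balanced (T := T) (S := S) (filter_subset _ _)
    (J := fun a b => if M.Dart B a b then (1 : ℤ) else 0)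
    (fun a _ => M.balanced fun v hv => hv.elim (fun h => h.mem_nbhd.2) fun h => h.mem_nbhd.1)
  have k1 := key (fun a b => if M.Dart B a b then (1 : ℤ) else 0) fun a b h =>
    Or.inl (by by_contra h'; simp [h'] at h)
  have k2 := key (fun a b => if M.Dart B b a then (1 : ℤ) else 0) fun a b h =>
    Or.inr (by by_contra h'; simp [h'] at h)
  have hcut' := k1.symm.trans (hcut.trans k2)
  apply hu
  by_cases h1 : M.Dart B x u <;> by_cases h2 : M.Dart B u x <;> simp [h1, h2] at hcut' ⊢

/-- The face `F` has a vertex in `S`. -/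
def Meets (F : M.Fc) (S : Set Vertex) : Prop := ∃ k, M.cyc F k ∈ S

theorem meets_lf_of_nb {S : Set Vertex} {x : Vertex} {i : Fin L.deg} (h : M.nb x i ∈ S) :
    M.Meets (M.lf x i) S ∧ M.Meets (M.lf x (i - 1)) S := by
  constructor
  · obtain ⟨k, hk⟩ := M.nb_mem_lf x i
    exact ⟨k, by rwa [hk]⟩
  · obtain ⟨k, hk⟩ := M.nb_mem_lf' x i
    exact ⟨k, by rwa [hk]⟩

theorem meets_lf_of_nb_succ {S : Set Vertex} {x : Vertex} {i : Fin L.deg}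
    (h : M.nb x (i + 1) ∈ S) : M.Meets (M.lf x i) S := by
  have := (M.meets_lf_of_nb h).2
  rwa [add_sub_cancel_right] at this

theorem not_meets_both {D₁ D₂ : Set Vertex} (h : ∀ u ∈ D₁, ∀ v ∈ D₂, ¬ L.starGraph.Adj u v)
    (hd : Disjoint D₁ D₂) {F : M.Fc} (h₁ : M.Meets F D₁) (h₂ : M.Meets F D₂) : False := by
  obtain ⟨k, hk⟩ := h₁
  obtain ⟨m, hm⟩ := h₂
  exact h _ hk _ hm (M.star_iff.2
    ⟨fun e => Set.disjoint_left.1 hd hk (e ▸ hm), F, ⟨k, rfl⟩, ⟨m, rfl⟩⟩)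

/-- The vertex `x` has exactly two neighbours outside `D₁ ∪ D₂`, and the path through `x`
separates `D₁` from `D₂` locally. -/
structure IsGate (D₁ D₂ : Set Vertex) (x : Vertex) : Prop where
  notMem : x ∉ D₁ ∪ D₂
  count : ∃ i j, i ≠ j ∧ ∀ k, M.nb x k ∉ D₁ ∪ D₂ ↔ k = i ∨ k = j
  faces : ∀ i, M.Meets (M.lf x i) D₁ ∨ M.Meets (M.lf x i) D₂
  sides : ∀ i, M.nb x i ∉ D₁ ∪ D₂ →
    (M.Meets (M.lf x i) D₁ ∧ M.Meets (M.lf x (i - 1)) D₂) ∨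
      (M.Meets (M.lf x i) D₂ ∧ M.Meets (M.lf x (i - 1)) D₁)

variable {M} in
theorem IsGate.symm {D₁ D₂ : Set Vertex} {x : Vertex} (h : M.IsGate D₁ D₂ x) :
    M.IsGate D₂ D₁ x where
  notMem := by rw [Set.union_comm]; exact h.notMem
  count := by rw [Set.union_comm]; exact h.count
  faces i := (h.faces i).symm
  sides i hi := (h.sides i (by rwa [Set.union_comm])).symm

theorem ncard_neighborSet_diff (x : Vertex) (S : Set Vertex) :
    (L.graph.neighborSet x \ S).ncard = (univ.filter fun i => M.nb x i ∉ S).card := by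
  have : L.graph.neighborSet x \ S =
      ((univ.filter fun i => M.nb x i ∉ S).image (M.nb x) : Finset Vertex) := by
    ext v
    simp only [Set.mem_sdiff, SimpleGraph.mem_neighborSet, M.adj_iff, coe_image, coe_filter,
      mem_univ, true_and, Set.mem_image, Set.mem_ofPred_eq]
    constructor
    · rintro ⟨⟨i, rfl⟩, h⟩; exact ⟨i, h, rfl⟩
    · rintro ⟨i, h, rfl⟩; exact ⟨⟨i, rfl⟩, h⟩
  rw [this, Set.ncard_coe_finset, card_image_of_injective _ (M.nb_inj x)]

theorem exists_two_of_ncard {x : Vertex} {S : Set Vertex}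
    (h : (L.graph.neighborSet x \ S).ncard = 2) :
    ∃ i j, i ≠ j ∧ ∀ k, M.nb x k ∉ S ↔ k = i ∨ k = j := by
  rw [M.ncard_neighborSet_diff, card_eq_two] at h
  obtain ⟨i, j, hij, h⟩ := h
  refine ⟨i, j, hij, fun k => ?_⟩
  have := Finset.ext_iff.1 h k
  simpa using this

/-- Consecutive neighbours of `x` share a face, so one in `D₁` is never next to one in `D₂`. Each
kind therefore has a free neighbour before and after it. As there are just two free ones, the cyclic
order is a run in `D₁`, a free neighbour, a run in `D₂`, a free neighbour. -/
theorem isGate_of_card_two {D₁ D₂ : Set Vertex} {x : Vertex}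
    (hsep : ∀ F, M.Meets F D₁ → M.Meets F D₂ → False)
    (h2 : (L.graph.neighborSet x \ (D₁ ∪ D₂)).ncard = 2)
    (h₁ : (L.graph.neighborSet x ∩ D₁).Nonempty) (h₂ : (L.graph.neighborSet x ∩ D₂).Nonempty) :
    M.IsGate D₁ D₂ x ∧ 4 ≤ L.deg := by
  obtain ⟨p, q, hpq, hfree⟩ := M.exists_two_of_ncard h2
  obtain ⟨i₁, hi₁⟩ : ∃ i, M.nb x i ∈ D₁ := by
    obtain ⟨v, hv, hvD⟩ := h₁
    obtain ⟨i, rfl⟩ := (M.adj_iff _ _).1 hv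
    exact ⟨i, hvD⟩
  obtain ⟨i₂, hi₂⟩ : ∃ i, M.nb x i ∈ D₂ := by
    obtain ⟨v, hv, hvD⟩ := h₂
    obtain ⟨i, rfl⟩ := (M.adj_iff _ _).1 hv
    exact ⟨i, hvD⟩
  have hno : ∀ i, M.nb x i ∈ D₁ → M.nb x i ∈ D₂ → False := fun i h h' =>
    hsep _ (M.meets_lf_of_nb h).1 (M.meets_lf_of_nb h').1
  have hno12 : ∀ i, M.nb x i ∈ D₁ → M.nb x (i + 1) ∈ D₂ → False := fun i h h' =>
    hsep _ (M.meets_lf_of_nb h).1 (M.meets_lf_of_nb_succ h')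
  have hno21 : ∀ i, M.nb x i ∈ D₂ → M.nb x (i + 1) ∈ D₁ → False := fun i h h' =>
    hsep _ (M.meets_lf_of_nb_succ h') (M.meets_lf_of_nb h).1
  obtain ⟨a, ha, ha'⟩ : ∃ a, M.nb x a ∈ D₁ ∧ M.nb x (a + 1) ∉ D₁ := by
    by_contra hcon
    push Not at hcon
    exact hno _ (Fin.cyclic_induction (p := fun i => M.nb x i ∈ D₁) hcon hi₁ i₂) hi₂
  obtain ⟨b, hb, hb'⟩ : ∃ b, M.nb x b ∈ D₂ ∧ M.nb x (b + 1) ∉ D₂ := by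
    by_contra hcon
    push Not at hcon
    exact hno _ hi₁ (Fin.cyclic_induction (p := fun i => M.nb x i ∈ D₂) hcon hi₂ i₁)
  obtain ⟨a₀, ha₀, ha₀'⟩ : ∃ a, M.nb x (a + 1) ∈ D₁ ∧ M.nb x a ∉ D₁ := by
    by_contra hcon
    push Not at hcon
    exact hno _ (Fin.cyclic_induction_sub (p := fun i => M.nb x i ∈ D₁) hcon hi₁ i₂) hi₂
  obtain ⟨b₀, hb₀, hb₀'⟩ : ∃ b, M.nb x (b + 1) ∈ D₂ ∧ M.nb x b ∉ D₂ := by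
    by_contra hcon
    push Not at hcon
    exact hno _ hi₁ (Fin.cyclic_induction_sub (p := fun i => M.nb x i ∈ D₂) hcon hi₂ i₁)
  have fa : M.nb x (a + 1) ∉ D₁ ∪ D₂ := fun h => h.elim ha' fun h => hno12 a ha h
  have fb : M.nb x (b + 1) ∉ D₁ ∪ D₂ := fun h => h.elim (fun h => hno21 b hb h) hb'
  have fa₀ : M.nb x a₀ ∉ D₁ ∪ D₂ := fun h => h.elim ha₀' fun h => hno21 _ h ha₀
  have fb₀ : M.nb x b₀ ∉ D₁ ∪ D₂ := fun h => h.elim (fun h => hno12 _ h hb₀) hb₀'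
  have hab : a ≠ b := fun h => hno a ha (h ▸ hb)
  have hfree' : ∀ k, M.nb x k ∉ D₁ ∪ D₂ → k = a + 1 ∨ k = b + 1 := by
    have hab' : a + 1 ≠ b + 1 := fun h => hab (add_right_cancel h)
    intro k hk
    have e1 := (hfree _).1 fa
    have e2 := (hfree _).1 fb
    have e3 := (hfree _).1 hk
    rcases e1 with e1 | e1 <;> rcases e2 with e2 | e2 <;> rcases e3 with e3 | e3 <;> simp_all
  have ea : a₀ = b + 1 := by
    refine (hfree' _ fa₀).resolve_left fun h => ?_
    have := Fin.cyclic_induction (p := fun i => M.nb x i ∈ D₁ ∨ i = a + 1) (by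
      rintro i (hi | rfl)
      · by_cases h1 : M.nb x (i + 1) ∈ D₁
        · exact Or.inl h1
        · rcases hfree' (i + 1) (fun h' => h'.elim h1 fun h' => hno12 i hi h') with e | e
          · exact Or.inr e
          · exact absurd hb fun hb => hno i hi (add_right_cancel e ▸ hb)
      · exact Or.inl (h ▸ ha₀)) (Or.inr rfl : M.nb x (a + 1) ∈ D₁ ∨ a + 1 = a + 1) b
    rcases this with h' | h'
    · exact hno b h' hb
    · exact fa (h' ▸ Or.inr hb)
  have eb : b₀ = a + 1 := by
    refine (hfree' _ fb₀).resolve_right fun h => ?_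
    have := Fin.cyclic_induction (p := fun i => M.nb x i ∈ D₂ ∨ i = b + 1) (by
      rintro i (hi | rfl)
      · by_cases h1 : M.nb x (i + 1) ∈ D₂
        · exact Or.inl h1
        · rcases hfree' (i + 1) (fun h' => h'.elim (fun h' => hno21 i hi h') h1) with e | e
          · exact absurd ha fun ha => hno i (add_right_cancel e ▸ ha) hi
          · exact Or.inr e
      · exact Or.inl (h ▸ hb₀)) (Or.inr rfl : M.nb x (b + 1) ∈ D₂ ∨ b + 1 = b + 1) a
    rcases this with h' | h'
    · exact hno a ha h'
    · exact fb (h' ▸ Or.inl ha)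
  subst ea eb
  have faces : ∀ i, M.Meets (M.lf x i) D₁ ∨ M.Meets (M.lf x i) D₂ := by
    intro i
    by_cases hi : M.nb x i ∈ D₁ ∪ D₂
    · exact hi.imp (fun h => (M.meets_lf_of_nb h).1) fun h => (M.meets_lf_of_nb h).1
    · by_cases hi' : M.nb x (i + 1) ∈ D₁ ∪ D₂
      · exact hi'.imp (fun h => M.meets_lf_of_nb_succ h) fun h => M.meets_lf_of_nb_succ h
      · rcases hfree' _ hi' with e | e
        · exact absurd (Or.inl (add_right_cancel e ▸ ha)) hi
        · exact absurd (Or.inr (add_right_cancel e ▸ hb)) hi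
  refine ⟨⟨fun h => ?_, ⟨p, q, hpq, hfree⟩, faces, fun i hi => ?_⟩, ?_⟩
  · have m1 : M.Meets (M.lf x a) D₁ := (M.meets_lf_of_nb ha).1
    have m2 : M.Meets (M.lf x b) D₂ := (M.meets_lf_of_nb hb).1
    rcases h with h | h
    · exact hsep _ ((M.mem_lf x b).imp fun k hk => by rwa [hk]) m2
    · exact hsep _ m1 ((M.mem_lf x a).imp fun k hk => by rwa [hk])
  · rcases hfree' i hi with rfl | rfl
    · rw [add_sub_cancel_right]
      exact Or.inr ⟨M.meets_lf_of_nb_succ hb₀, (M.meets_lf_of_nb ha).1⟩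
    · rw [add_sub_cancel_right]
      exact Or.inl ⟨M.meets_lf_of_nb_succ ha₀, (M.meets_lf_of_nb hb).1⟩
  -- The last members `a`, `b` of the two runs and the two free neighbours are four different
  -- directions.
  · have hd := deg_ge (L := L)
    have n1 : a + 1 ≠ b + 1 := fun h => hab (add_right_cancel h)
    have n2 : a ≠ a + 1 := Fin.ne_add_one (by omega) a
    have n3 : b ≠ b + 1 := Fin.ne_add_one (by omega) b
    have n4 : a ≠ b + 1 := fun h => fb (h ▸ Or.inl ha)
    have n5 : b ≠ a + 1 := fun h => fa (h ▸ Or.inr hb)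
    have : ({a, b, a + 1, b + 1} : Finset (Fin L.deg)).card = 4 := by
      rw [card_insert_of_notMem, card_insert_of_notMem, card_insert_of_notMem, card_singleton] <;>
        simp [n1, n2, n3, n4, n5, hab]
    have h4 := card_le_univ ({a, b, a + 1, b + 1} : Finset (Fin L.deg))
    rw [this, Fintype.card_fin] at h4
    exact h4

theorem add_one_add_one_ne : ∀ i : Fin L.deg, i + 1 + 1 ≠ i := by
  cases L
  · change ∀ i : Fin 4, i + 1 + 1 ≠ i; decide
  · change ∀ i : Fin 6, i + 1 + 1 ≠ i; decide
  · change ∀ i : Fin 3, i + 1 + 1 ≠ i; decide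

/-- Neither face beside the edge from `x` to `x₁` may meet both sets, so the free path through `x`
and `x₁` turns in opposite directions at these two vertices. One face beside the edge then meets
`D₁` through a neighbour of `x₁`, and all other faces at `x` meet `D₂`. -/
theorem isGate_of_adj {D₁ D₂ : Set Vertex} {x₁ x : Vertex}
    (hsep : ∀ F, M.Meets F D₁ → M.Meets F D₂ → False) (hadj : L.graph.Adj x x₁)
    (hx : x ∉ D₁ ∪ D₂) (hx₁ : x₁ ∉ D₁ ∪ D₂)
    (h₁ : (L.graph.neighborSet x₁ \ D₁).ncard = 2) (h₁' : L.graph.neighborSet x₁ ∩ D₂ = ∅)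
    (h₂ : (L.graph.neighborSet x \ D₂).ncard = 2) (h₂' : L.graph.neighborSet x ∩ D₁ = ∅) :
    M.IsGate D₁ D₂ x := by
  obtain ⟨i₀, rfl⟩ := (M.adj_iff _ _).1 hadj
  obtain ⟨r, hr, hr1, hr2⟩ := M.exists_rev x i₀
  have hn₁ : ∀ i, M.nb (M.nb x i₀) i ∉ D₂ := fun i h =>
    (Set.eq_empty_iff_forall_notMem.1 h₁' _) ⟨M.adj_nb _ i, h⟩
  have hn₂ : ∀ i, M.nb x i ∉ D₁ := fun i h =>
    (Set.eq_empty_iff_forall_notMem.1 h₂' _) ⟨M.adj_nb _ i, h⟩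
  have hd := deg_ge (L := L)
  have ne1 : ∀ i : Fin L.deg, i + 1 ≠ i := fun i => (Fin.ne_add_one (by omega) i).symm
  have ne2 : ∀ i : Fin L.deg, i - 1 ≠ i := fun i h => by
    have := ne1 (i - 1); rw [sub_add_cancel] at this; exact this h.symm
  have ne3 : ∀ i : Fin L.deg, i + 1 ≠ i - 1 := fun i h =>
    add_one_add_one_ne i (by rw [h, sub_add_cancel])
  obtain ⟨j, hj, hfree⟩ : ∃ j, j ≠ i₀ ∧ ∀ k, M.nb x k ∉ D₂ ↔ k = i₀ ∨ k = j := by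
    obtain ⟨p, q, hpq, h⟩ := M.exists_two_of_ncard h₂
    rcases (h i₀).1 (fun h => hx₁ (Or.inr h)) with rfl | rfl
    · exact ⟨q, hpq.symm, h⟩
    · exact ⟨p, hpq, fun k => (h k).trans or_comm⟩
  obtain ⟨s, hs, hfree₁⟩ : ∃ s, s ≠ r ∧ ∀ k, M.nb (M.nb x i₀) k ∉ D₁ ↔ k = r ∨ k = s := by
    obtain ⟨p, q, hpq, h⟩ := M.exists_two_of_ncard h₁
    rcases (h r).1 (by rw [hr]; exact fun h => hx (Or.inl h)) with rfl | rfl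
    · exact ⟨q, hpq.symm, h⟩
    · exact ⟨p, hpq, fun k => (h k).trans or_comm⟩
  have P : ∀ k, k ≠ i₀ → k ≠ j → M.nb x k ∈ D₂ := fun k h h' => by
    by_contra hc; exact ((hfree k).1 hc).elim h h'
  have Q : ∀ k, k ≠ r → k ≠ s → M.nb (M.nb x i₀) k ∈ D₁ := fun k h h' => by
    by_contra hc; exact ((hfree₁ k).1 hc).elim h h'
  -- Otherwise the face on the left of the edge contains a neighbour of `x` in `D₂` and a neighbour
  -- of `x₁` in `D₁`.
  have c1 : j = i₀ + 1 ∨ s = r - 1 := by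
    by_contra hcon
    push Not at hcon
    refine hsep (M.lf x i₀) ?_ (M.meets_lf_of_nb_succ (P _ (ne1 _) hcon.1.symm))
    rw [← hr2]
    exact (M.meets_lf_of_nb (Q _ (ne2 _) hcon.2.symm)).1
  have c2 : j = i₀ - 1 ∨ s = r + 1 := by
    by_contra hcon
    push Not at hcon
    refine hsep (M.lf x (i₀ - 1)) ?_ ((M.meets_lf_of_nb (P _ (ne2 _) hcon.1.symm)).1)
    rw [← hr1]
    exact M.meets_lf_of_nb_succ (Q _ (ne1 _) hcon.2.symm)
  have hcount : ∃ i j, i ≠ j ∧ ∀ k, M.nb x k ∉ D₁ ∪ D₂ ↔ k = i ∨ k = j :=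
    ⟨i₀, j, hj.symm, fun k => by rw [← hfree k]; simp [hn₂ k]⟩
  have hfree' : ∀ k, M.nb x k ∉ D₁ ∪ D₂ → k = i₀ ∨ k = j := fun k hk =>
    (hfree k).1 fun h => hk (Or.inr h)
  rcases c1 with c1 | c1
  · have c3 : s = r + 1 := c2.resolve_left fun h => ne3 i₀ (c1.symm.trans h)
    subst c1 c3
    have F1 : M.Meets (M.lf x i₀) D₁ := by
      rw [← hr2]
      exact (M.meets_lf_of_nb (Q _ (ne2 _) (ne3 r).symm)).1
    have F2 : M.Meets (M.lf x (i₀ - 1)) D₂ :=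
      (M.meets_lf_of_nb (P _ (ne2 _) (ne3 _).symm)).1
    have F3 : M.Meets (M.lf x (i₀ + 1)) D₂ := by
      exact M.meets_lf_of_nb_succ (P _ (add_one_add_one_ne i₀) (ne1 _))
    refine ⟨hx, hcount, fun i => ?_, fun i hi => ?_⟩
    · by_cases e : i = i₀
      · subst e; exact Or.inl F1
      by_cases e' : i = i₀ + 1
      · subst e'; exact Or.inr F3
      exact Or.inr (M.meets_lf_of_nb (P i e e')).1
    · rcases hfree' i hi with rfl | rfl
      · exact Or.inl ⟨F1, F2⟩
      · rw [add_sub_cancel_right]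
        exact Or.inr ⟨F3, F1⟩
  · have c3 : j = i₀ - 1 := c2.resolve_right fun h => ne3 r (h.symm.trans c1)
    subst c1 c3
    have F1 : M.Meets (M.lf x i₀) D₂ := M.meets_lf_of_nb_succ (P _ (ne1 _) (ne3 _))
    have F2 : M.Meets (M.lf x (i₀ - 1)) D₁ := by
      rw [← hr1]
      exact M.meets_lf_of_nb_succ (Q _ (ne1 _) (ne3 _))
    have F3 : M.Meets (M.lf x (i₀ - 1 - 1)) D₂ := by
      refine (M.meets_lf_of_nb (P _ (fun h => add_one_add_one_ne i₀ ?_) (ne2 _))).1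
      nth_rw 1 [← h]
      rw [sub_add_cancel, sub_add_cancel]
    refine ⟨hx, hcount, fun i => ?_, fun i hi => ?_⟩
    · by_cases e : i = i₀
      · subst e; exact Or.inr F1
      by_cases e' : i = i₀ - 1
      · subst e'; exact Or.inl F2
      exact Or.inr (M.meets_lf_of_nb (P i e e')).1
    · rcases hfree' i hi with rfl | rfl
      · exact Or.inr ⟨F1, F2⟩
      · exact Or.inl ⟨F2, F3⟩

theorem exterior_notMem {A : Set Vertex} {v : Vertex} (h : v ∈ L.exterior A) : v ∉ A := by
  obtain ⟨C, hC, -, hv⟩ := h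
  exact hC.2.1 hv

/-- The first alternative comes from clause (1) of interlocking, the second from clause (2). The
bound on the degree matters because a single gate does not pay for a merger on the hexagonal
lattice. -/
theorem exists_gate {D₁ D₂ : Set Vertex} (hd : Disjoint D₁ D₂) (h : L.Interlocked D₁ D₂) :
    (4 ≤ L.deg ∧ ∃ x, M.IsGate D₁ D₂ x) ∨
      ∃ x y, L.graph.Adj x y ∧ M.IsGate D₁ D₂ x ∧ M.IsGate D₁ D₂ y := by
  obtain ⟨hs, ⟨x, -, h2, h₁, h₂⟩ | ⟨x₁, hx₁, x₂, hx₂, hadj, h1, h1', h2, h2'⟩⟩ := h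
  · have := M.isGate_of_card_two (fun F => M.not_meets_both hs hd) h2 h₁ h₂
    exact Or.inl ⟨this.2, x, this.1⟩
  · refine Or.inr ⟨x₁, x₂, hadj, IsGate.symm ?_, ?_⟩
    · refine M.isGate_of_adj (fun F h h' => M.not_meets_both hs hd h' h) hadj ?_ ?_ h2 h2' h1 h1'
      · rw [Set.union_comm]; exact exterior_notMem hx₁
      · rw [Set.union_comm]; exact exterior_notMem hx₂
    · exact M.isGate_of_adj (fun F => M.not_meets_both hs hd) hadj.symm (exterior_notMem hx₂)
        (exterior_notMem hx₁) h1 h1' h2 h2'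

end PlaneMap

end RegularLattice

/-! ### Filling gates -/

namespace RegularLattice

open Finset

open scoped Classical

namespace PlaneMap

variable {L : RegularLattice} (M : PlaneMap L)

/-- The `*`-connected set `B` arises from the union `E` of some `*`-clusters of `A` by filling
gates, which costs nothing in the length of the contour and does not block the exterior. -/
structure Filling (A : Set Vertex) (E B : Finset Vertex) : Prop where
  sub : E ⊆ B
  inter : ∀ v ∈ B, v ∈ A → v ∈ E
  faces : M.facesOf B = M.facesOf E
  conn : L.StarConnected B
  len_le : M.len B ≤ 2 * L.tunnelRate * E.card + L.mergeGain
  route : ∀ W : Set Vertex, (∀ F ∈ M.facesOf B, ∀ k, M.cyc F k ∉ W) → ∀ v₁ v₂, v₁ ∉ B → v₂ ∉ B →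
    ConnectedIn L.graph ((E : Set Vertex) ∪ W)ᶜ v₁ v₂ →
    ConnectedIn L.graph ((B : Set Vertex) ∪ W)ᶜ v₁ v₂
  exit : ∀ g ∈ B, g ∉ E → ∃ i, M.nb g i ∉ B

variable {M} in
theorem IsGate.exists_free {D₁ D₂ : Set Vertex} {x : Vertex} (h : M.IsGate D₁ D₂ x) :
    ∃ i, M.Meets (M.lf x i) D₁ ∧ ∃ j, M.Meets (M.lf x j) D₂ := by
  obtain ⟨i, j, -, hij⟩ := h.count
  rcases h.sides i ((hij i).2 (Or.inl rfl)) with h | h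
  · exact ⟨_, h.1, _, h.2⟩
  · exact ⟨_, h.2, _, h.1⟩

section

variable {M} {A : Set Vertex} {E B C : Finset Vertex} {D₁ : Set Vertex} {x y : Vertex}

theorem meets_iff {F : M.Fc} : M.Meets F (B : Set Vertex) ↔ F ∈ M.facesOf B :=
  M.mem_facesOf.symm

theorem Meets.mono {F : M.Fc} {S S' : Set Vertex} (hS : S ⊆ S') (h : M.Meets F S) :
    M.Meets F S' := h.imp fun _ h => hS h

theorem star_of_meets {S : Set Vertex} (hx : x ∉ S) {i : Fin L.deg} (h : M.Meets (M.lf x i) S) :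
    ∃ u ∈ S, L.starGraph.Adj u x := by
  obtain ⟨k, hk⟩ := h
  exact ⟨_, hk, M.star_iff.2 ⟨fun e => hx (e ▸ hk), _, ⟨k, rfl⟩, M.mem_lf x i⟩⟩

theorem notMem_of_mem_nbhd (hd : Disjoint (M.facesOf B) (M.facesOf C)) {v : Vertex}
    (hv : v ∈ M.nbhd B) : v ∉ C := by
  obtain ⟨i, hi⟩ := M.mem_nbhd.1 hv
  exact fun h => disjoint_left.1 hd hi (M.lf_mem_facesOf h i)

theorem IsGate.notMem_union (hg : M.IsGate D₁ C x)
    (hd : Disjoint (M.facesOf B) (M.facesOf C)) : x ∉ B ∪ C := by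
  rw [mem_union]
  rintro (h | h)
  · obtain ⟨-, -, j, hj⟩ := hg.exists_free
    exact disjoint_left.1 hd (M.lf_mem_facesOf h j) (meets_iff.1 hj)
  · exact hg.notMem (Or.inr h)

/-- One of the two faces beside the edge to a free neighbour meets `C`; if this neighbour were in
`B`, the face would meet `B` as well. -/
theorem IsGate.nb_notMem (hg : M.IsGate D₁ C x) (hd : Disjoint (M.facesOf B) (M.facesOf C))
    {k : Fin L.deg} (hk : M.nb x k ∉ D₁ ∪ (C : Set Vertex)) : M.nb x k ∉ B ∪ C := by
  rw [mem_union]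
  rintro (h | h)
  · have hB := M.lf_mem_of_nb h
    rcases hg.sides k hk with h | h
    · exact disjoint_left.1 hd hB.2 (meets_iff.1 h.2)
    · exact disjoint_left.1 hd hB.1 (meets_iff.1 h.1)
  · exact hk (Or.inr h)

theorem IsGate.count_union (hg : M.IsGate D₁ C x) (hD : D₁ ⊆ B)
    (hd : Disjoint (M.facesOf B) (M.facesOf C)) :
    ∃ i j, i ≠ j ∧ ∀ k, M.nb x k ∉ B ∪ C ↔ k = i ∨ k = j := by
  obtain ⟨i, j, hij, h⟩ := hg.count
  refine ⟨i, j, hij, fun k => ⟨fun hk => (h k).1 fun h' => hk ?_, fun hk =>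
    hg.nb_notMem hd ((h k).2 hk)⟩⟩
  exact mem_union.2 (h'.imp (fun h => hD h) id)

theorem IsGate.faces_union (hg : M.IsGate D₁ C x) (hD : D₁ ⊆ B) (i : Fin L.deg) :
    M.lf x i ∈ M.facesOf (B ∪ C) := by
  rw [facesOf_union, mem_union]
  exact (hg.faces i).imp (fun h => meets_iff.1 (h.mono hD)) meets_iff.1

/-- This says `(deg - 2) * (faceSize - 2) = 4`: filling a vertex with two free neighbours, all of
whose faces are already counted, shortens the contour by 4 on every lattice. -/
theorem deg_faceSize : (2 - (L.deg : ℤ)) * L.faceSize + 2 * (L.deg - 2) = -4 := by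
  cases L <;> simp [deg, faceSize]

theorem len_insert_of_faces {Z : Finset Vertex} (hx : x ∉ Z) (hf : ∀ i, M.lf x i ∈ M.facesOf Z)
    (s : Finset (Fin L.deg)) (hs : ∀ k, M.nb x k ∉ Z ↔ k ∈ s) :
    M.len (insert x Z) = M.len Z - 2 * s.card := by
  rw [M.len_insert hx]
  have h1 : (∑ i, if M.lf x i ∈ M.facesOf Z then (1 : ℤ) else 0) = L.deg := by simp [hf]
  have h2 : (∑ i, if M.nb x i ∈ Z then (1 : ℤ) else 0) = L.deg - s.card := by
    have : ∀ i, (if M.nb x i ∈ Z then (1 : ℤ) else 0) = 1 - if i ∈ s then 1 else 0 := by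
      intro i
      by_cases h : i ∈ s
      · simp [h, (hs i).2 h]
      · have : M.nb x i ∈ Z := by by_contra h'; exact h ((hs i).1 h')
        simp [h, this]
    simp [this]
  rw [h1, h2]
  linarith [deg_faceSize (L := L)]

theorem facesOf_insert_of_faces {Z : Finset Vertex} (hf : ∀ i, M.lf x i ∈ M.facesOf Z) :
    M.facesOf (insert x Z) = M.facesOf Z := by
  rw [facesOf_insert, union_eq_right]
  exact image_subset_iff.2 fun i _ => hf i

theorem StarConnected.insert {S : Set Vertex} (h : L.StarConnected S) {u : Vertex} (hu : u ∈ S)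
    (hux : L.starGraph.Adj u x) : L.StarConnected (insert x S) := by
  have hx : L.StarConnected {x} := by
    rintro a rfl b rfl
    exact .refl rfl
  have := h.union hx hu rfl (Or.inr hux)
  rwa [Set.union_singleton] at this

/-- The contour of `B` passes through the gate exactly once, so the rest of it leads from one free
neighbour to the other. It avoids `C` and `W`, because neither has a vertex on a face meeting `B`.
-/
theorem IsGate.detour_connected (hg : M.IsGate D₁ C x) (hD : D₁ ⊆ B)
    (hd : Disjoint (M.facesOf B) (M.facesOf C)) {W : Set Vertex}
    (hW : ∀ F ∈ M.facesOf B, ∀ k, M.cyc F k ∉ W) {u v : Vertex}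
    (hu : L.graph.Adj x u) (hv : L.graph.Adj x v) (huZ : u ∉ B ∪ C) (hvZ : v ∉ B ∪ C) (huW : u ∉ W) :
    ConnectedIn L.graph (insert x (((B ∪ C : Finset Vertex) : Set Vertex) ∪ W))ᶜ u v := by
  have hmem : ∀ a, a ≠ x → a ∉ B → a ∈ M.nbhd B →
      a ∈ (insert x (((B ∪ C : Finset Vertex) : Set Vertex) ∪ W))ᶜ := by
    rintro a hax haB ha (h | h | h)
    · exact hax h
    · exact (mem_union.1 (mem_coe.1 h)).elim haB (notMem_of_mem_nbhd hd ha)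
    · obtain ⟨i, hi⟩ := M.mem_nbhd.1 ha
      obtain ⟨k, hk⟩ := M.mem_lf a i
      exact hW _ hi k (by rwa [hk])
  obtain ⟨i, j, hij, hcount⟩ := hg.count_union hD hd
  have hstep : ∀ z, M.Step B x z → z = M.nb x i ∨ z = M.nb x j := by
    intro z hz
    obtain ⟨k, rfl⟩ := (M.adj_iff _ _).1 hz.adj
    have : M.nb x k ∉ B ∪ C := fun h => (mem_union.1 h).elim hz.notMem.2
      (notMem_of_mem_nbhd hd hz.mem_nbhd.2)
    exact ((hcount k).1 this).imp (fun h => by rw [h]) fun h => by rw [h]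
  have hxB : x ∉ B := fun h => hg.notMem_union hd (mem_union_left _ h)
  have hfree : M.nb x i ∉ D₁ ∪ (C : Set Vertex) := fun h =>
    (hcount i).2 (Or.inl rfl) (mem_union.2 (h.imp (fun h => hD h) id))
  have hiB : M.nb x i ∉ B := fun h => (hcount i).2 (Or.inl rfl) (mem_union_left _ h)
  -- Of the two faces beside this edge one meets `B`, while the other meets `C` and so not `B`; the
  -- edge belongs to the contour in one direction only.
  have hxor : ¬ (M.Dart B x (M.nb x i) ↔ M.Dart B (M.nb x i) x) := by
    rw [M.dart_nb_iff hxB, M.nb_dart_iff hxB]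
    simp only [hiB, not_false_eq_true, true_and]
    rcases hg.sides i hfree with h | h
    · have h1 := meets_iff.1 (h.1.mono hD)
      have h2 := disjoint_right.1 hd (meets_iff.1 h.2)
      tauto
    · have h1 := meets_iff.1 (h.2.mono hD)
      have h2 := disjoint_right.1 hd (meets_iff.1 h.1)
      tauto
  have hpath := M.detour hstep hxor
  have hi : M.Step B x (M.nb x i) := by unfold Step; tauto
  have hconn : ConnectedIn L.graph (Insert.insert x (((B ∪ C : Finset Vertex) : Set Vertex) ∪ W))ᶜ
      (M.nb x i) (M.nb x j) := by
    refine connectedIn_iff.2 ⟨hmem _ (M.adj_nb x i).ne' hiB hi.mem_nbhd.2, ?_⟩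
    exact hpath.lift id fun a b ⟨hab, ha, hb⟩ =>
      ⟨hmem a ha hab.notMem.1 hab.mem_nbhd.1, hmem b hb hab.notMem.2 hab.mem_nbhd.2, hab.adj⟩
  obtain ⟨k, rfl⟩ := (M.adj_iff _ _).1 hu
  obtain ⟨m, rfl⟩ := (M.adj_iff _ _).1 hv
  rcases (hcount k).1 huZ with rfl | rfl <;> rcases (hcount m).1 hvZ with rfl | rfl
  · exact .refl hconn.left_mem
  · exact hconn
  · exact hconn.symm
  · exact .refl hconn.right_mem

theorem coe_insert_union {Z : Finset Vertex} {W : Set Vertex} :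
    ((insert x Z : Finset Vertex) : Set Vertex) ∪ W = insert x ((Z : Set Vertex) ∪ W) := by
  rw [coe_insert, Set.insert_union]

/-- A filling can be extended by a further cluster that is attached by a gate. -/
theorem Filling.extend (h : M.Filling A E B) (hD : D₁ ⊆ E) (hC : C.Nonempty)
    (hCc : L.StarConnected C) (hd : Disjoint (M.facesOf E) (M.facesOf C))
    (hsep : ∀ u ∈ E ∪ C, ∀ v ∈ A, L.starGraph.Adj u v → v ∈ E ∪ C)
    (hg : (4 ≤ L.deg ∧ ∃ x, M.IsGate D₁ C x) ∨
      ∃ x y, L.graph.Adj x y ∧ M.IsGate D₁ C x ∧ M.IsGate D₁ C y) :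
    ∃ B', M.Filling A (E ∪ C) B' := by
  have hDB : D₁ ⊆ B := hD.trans (coe_subset.2 h.sub)
  have hdB : Disjoint (M.facesOf B) (M.facesOf C) := by rwa [h.faces]
  have hfZ : M.facesOf (B ∪ C) = M.facesOf (E ∪ C) := by
    rw [facesOf_union, facesOf_union, h.faces]
  have hBC : Disjoint E C := disjoint_left.2 fun v hv hv' =>
    disjoint_left.1 hd (M.lf_mem_facesOf hv 0) (M.lf_mem_facesOf hv' 0)
  have hBC' : ∀ v ∈ B, v ∉ C := fun v hv hv' =>
    disjoint_left.1 hdB (M.lf_mem_facesOf hv 0) (M.lf_mem_facesOf hv' 0)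
  -- Side by side, the two contours cost `mergeGain` twice; the gates have to earn one of them back.
  have hlenZ : M.len (B ∪ C) ≤
      2 * L.tunnelRate * (E ∪ C).card + L.mergeGain + L.mergeGain := by
    rw [M.len_union hdB, card_union_of_disjoint hBC]
    have h1 := h.len_le
    have h2 := M.len_le hC hCc
    push_cast
    linarith
  have hA : ∀ x, M.IsGate D₁ C x → x ∉ A := by
    intro x hg hxA
    obtain ⟨i, hi, -⟩ := hg.exists_free
    obtain ⟨u, hu, hux⟩ := star_of_meets (fun h => hg.notMem (Or.inl h)) hi
    have := hsep u (mem_union_left _ (hD hu)) x hxA hux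
    exact hg.notMem_union hdB (union_subset_union_left h.sub this)
  have hinter : ∀ v ∈ B ∪ C, v ∈ A → v ∈ E ∪ C := fun v hv hvA =>
    mem_union.2 ((mem_union.1 hv).imp_left fun hv => h.inter v hv hvA)
  have hconn : ∀ x, M.IsGate D₁ C x →
      L.StarConnected (insert x (B ∪ C) : Finset Vertex) := by
    intro x hg
    obtain ⟨i, hi, j, hj⟩ := hg.exists_free
    obtain ⟨u, hu, hux⟩ := star_of_meets (fun h => hg.notMem (Or.inl h)) hi
    obtain ⟨u', hu', hux'⟩ := star_of_meets (fun h => hg.notMem (Or.inr h)) hj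
    have h1 := StarConnected.insert h.conn (hDB hu) hux
    have h2 := h1.union hCc (Set.mem_insert x _) hu' (Or.inr hux'.symm)
    rwa [coe_insert, coe_union, ← Set.insert_union]
  -- The new cluster is treated as an obstacle for the old filling: `route` is applied to `C ∪ W`.
  -- This is why it is stated for arbitrary sets off the faces of `B`.
  have hroute : ∀ W : Set Vertex, (∀ F ∈ M.facesOf (B ∪ C), ∀ k, M.cyc F k ∉ W) →
      ∀ v₁ v₂, v₁ ∉ B ∪ C → v₂ ∉ B ∪ C →
      ConnectedIn L.graph (((E ∪ C : Finset Vertex) : Set Vertex) ∪ W)ᶜ v₁ v₂ →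
      ConnectedIn L.graph (((B ∪ C : Finset Vertex) : Set Vertex) ∪ W)ᶜ v₁ v₂ := by
    intro W hW v₁ v₂ h₁ h₂ hc
    rw [coe_union, Set.union_assoc] at hc ⊢
    refine h.route _ ?_ v₁ v₂ (fun h => h₁ (mem_union_left _ h))
      (fun h => h₂ (mem_union_left _ h)) hc
    rintro F hF k (hk | hk)
    · exact disjoint_left.1 hdB hF (M.mem_facesOf.2 ⟨k, hk⟩)
    · exact hW F (M.facesOf_mono subset_union_left hF) k hk
  -- The exit of an old gate `g` survives. It is not in `C`, whose faces are disjoint from those of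
  -- `B`. It is not a new gate either, since `g` would then be a neighbour of that gate lying
  -- outside `D₁` and `C` but in `B`.
  have hold : ∀ g ∈ B, g ∉ E → ∃ i, M.nb g i ∉ B ∪ C ∧ ∀ y, M.IsGate D₁ C y → M.nb g i ≠ y := by
    intro g hgB hgE
    obtain ⟨i, hi⟩ := h.exit g hgB hgE
    refine ⟨i, fun hmem => ?_, ?_⟩
    · have := (mem_union.1 hmem).resolve_left hi
      exact disjoint_left.1 hdB (M.lf_mem_facesOf hgB i) (M.lf_mem_of_nb this).1
    · rintro y hy rfl
      obtain ⟨k, hk⟩ := (M.adj_iff _ _).1 (M.adj_nb g i).symm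
      refine hy.nb_notMem (B := B) (k := k) hdB (fun hmem => ?_) (by
        rw [hk]; exact mem_union_left _ hgB)
      rw [hk] at hmem
      exact hmem.elim (fun h => hgE (hD h)) fun h => hBC' g hgB h
  rcases hg with ⟨hdeg, x, hg⟩ | ⟨x, y, hxy, hgx, hgy⟩
  · have hxZ := hg.notMem_union hdB
    obtain ⟨i, j, hij, hcount⟩ := hg.count_union hDB hdB
    have hfx := hg.faces_union hDB
    refine ⟨insert x (B ∪ C), ?_, ?_, ?_, hconn x hg, ?_, ?_, ?_⟩
    · exact (union_subset_union_left h.sub).trans (subset_insert _ _)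
    · intro v hv hvA
      rcases mem_insert.1 hv with rfl | hv
      · exact absurd hvA (hA _ hg)
      · exact hinter v hv hvA
    · rw [facesOf_insert_of_faces hfx, hfZ]
    · rw [len_insert_of_faces hxZ hfx {i, j} (by simpa using hcount), card_pair hij]
      -- One gate has two free neighbours and gains 4; the hexagonal lattice, where 6 is needed, is
      -- excluded by `hdeg`.
      have : (L.mergeGain : ℤ) = 4 := by cases L <;> simp [mergeGain, deg] at hdeg ⊢
      push_cast
      linarith
    · intro W hW v₁ v₂ h₁ h₂ hc
      rw [facesOf_insert_of_faces hfx] at hW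
      rw [coe_insert_union]
      have h₁' := not_or.1 (mt mem_insert.2 h₁)
      have h₂' := not_or.1 (mt mem_insert.2 h₂)
      refine (hroute W hW v₁ v₂ h₁'.2 h₂'.2 hc).avoid (fun u v hu hv huZ hvZ => ?_) h₁'.1 h₂'.1
      exact hg.detour_connected hDB hdB (fun F hF => hW F (M.facesOf_mono subset_union_left hF))
        hu hv (fun h => huZ (Or.inr (Or.inl h))) (fun h => hvZ (Or.inr (Or.inl h)))
        (fun h => huZ (Or.inr (Or.inr h)))
    · intro g hgm hgE
      rcases mem_insert.1 hgm with rfl | hgm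
      · refine ⟨i, fun hmem => ?_⟩
        rcases mem_insert.1 hmem with h | h
        · exact (M.adj_nb g i).ne h.symm
        · exact (hcount i).2 (Or.inl rfl) h
      · obtain ⟨k, hk, hk'⟩ := hold g ((mem_union.1 hgm).resolve_right fun h =>
          hgE (mem_union_right _ h)) fun h => hgE (mem_union_left _ h)
        exact ⟨k, fun hmem => (mem_insert.1 hmem).elim (hk' _ hg) hk⟩
  · have hxZ := hgx.notMem_union hdB
    have hyZ := hgy.notMem_union hdB
    have hfx := hgx.faces_union hDB
    have hfy := hgy.faces_union hDB
    obtain ⟨i, j, hij, hcount⟩ := hgx.count_union hDB hdB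
    obtain ⟨m, hm⟩ : ∃ m, ∀ k, M.nb y k ∉ insert x (B ∪ C) ↔ k ∈ ({m} : Finset (Fin L.deg)) := by
      obtain ⟨p, q, hpq, hc⟩ := hgy.count_union hDB hdB
      obtain ⟨r, hr⟩ := (M.adj_iff _ _).1 hxy.symm
      have key : ∀ k, M.nb y k ∉ insert x (B ∪ C) ↔ k ≠ r ∧ (k = p ∨ k = q) := by
        intro k
        rw [mem_insert, not_or, hc k, ← hr, (M.nb_inj y).eq_iff]
      rcases (hc r).1 (by rwa [hr]) with rfl | rfl
      · refine ⟨q, fun k => (key k).trans ?_⟩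
        rw [mem_singleton]
        constructor
        · rintro ⟨h1, h2⟩; exact h2.resolve_left h1
        · rintro rfl; exact ⟨hpq.symm, Or.inr rfl⟩
      · refine ⟨p, fun k => (key k).trans ?_⟩
        rw [mem_singleton]
        constructor
        · rintro ⟨h1, h2⟩; exact h2.resolve_right h1
        · rintro rfl; exact ⟨hpq, Or.inl rfl⟩
    have hyB₁ : y ∉ insert x (B ∪ C) := fun h => (mem_insert.1 h).elim hxy.ne' hyZ
    have hfB₁ := facesOf_insert_of_faces hfx
    have hfy' : ∀ i, M.lf y i ∈ M.facesOf (insert x (B ∪ C)) := fun i => by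
      rw [hfB₁]; exact hfy i
    refine ⟨insert y (insert x (B ∪ C)), ?_, ?_, ?_, ?_, ?_, ?_, ?_⟩
    · exact ((union_subset_union_left h.sub).trans (subset_insert _ _)).trans (subset_insert _ _)
    · intro v hv hvA
      rcases mem_insert.1 hv with rfl | hv
      · exact absurd hvA (hA _ hgy)
      rcases mem_insert.1 hv with rfl | hv
      · exact absurd hvA (hA _ hgx)
      · exact hinter v hv hvA
    · rw [facesOf_insert_of_faces hfy', hfB₁, hfZ]
    · rw [coe_insert]
      exact StarConnected.insert (hconn x hgx) (mem_insert_self _ _) (M.star_of_adj hxy)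
    · rw [len_insert_of_faces hyB₁ hfy' {m} hm,
        len_insert_of_faces hxZ hfx {i, j} (by simpa using hcount), card_pair hij, card_singleton]
      -- Filling `x` gains 4, and filling `y`, which has one free neighbour left, gains 2 more.
      have : (L.mergeGain : ℤ) ≤ 6 := by cases L <;> simp [mergeGain]
      push_cast
      linarith
    · intro W hW v₁ v₂ h₁ h₂ hc
      rw [facesOf_insert_of_faces hfy', hfB₁] at hW
      rw [coe_insert_union]
      have h₁' := not_or.1 (mt mem_insert.2 h₁)
      have h₂' := not_or.1 (mt mem_insert.2 h₂)
      have h₁'' := not_or.1 (mt mem_insert.2 h₁'.2)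
      have h₂'' := not_or.1 (mt mem_insert.2 h₂'.2)
      have hc' : ConnectedIn L.graph
          (((insert x (B ∪ C) : Finset Vertex) : Set Vertex) ∪ W)ᶜ v₁ v₂ := by
        rw [coe_insert_union]
        refine (hroute W hW v₁ v₂ h₁''.2 h₂''.2 hc).avoid (fun u v hu hv huZ hvZ => ?_)
          h₁''.1 h₂''.1
        exact hgx.detour_connected hDB hdB
          (fun F hF => hW F (M.facesOf_mono subset_union_left hF))
          hu hv (fun h => huZ (Or.inr (Or.inl h))) (fun h => hvZ (Or.inr (Or.inl h)))
          (fun h => huZ (Or.inr (Or.inr h)))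
      refine hc'.avoid (fun u v hu hv huZ hvZ => ?_) h₁'.1 h₂'.1
      -- Once `x` is filled, `y` is a dead end and no path needs it.
      have huv : u = v := by
        obtain ⟨k, rfl⟩ := (M.adj_iff _ _).1 hu
        obtain ⟨l, rfl⟩ := (M.adj_iff _ _).1 hv
        rw [mem_singleton.1 ((hm k).1 fun h => huZ (Or.inr (Or.inl h))),
          mem_singleton.1 ((hm l).1 fun h => hvZ (Or.inr (Or.inl h)))]
      rw [← huv]
      exact .refl huZ
    · intro g hgm hgE
      rcases mem_insert.1 hgm with rfl | hgm
      · refine ⟨m, fun hmem => ?_⟩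
        rcases mem_insert.1 hmem with h | h
        · exact (M.adj_nb g m).ne h.symm
        · exact (hm m).2 (mem_singleton_self _) h
      rcases mem_insert.1 hgm with rfl | hgm
      · obtain ⟨k, hk, hky⟩ : ∃ k, M.nb g k ∉ B ∪ C ∧ M.nb g k ≠ y := by
          by_cases hiy : M.nb g i = y
          · refine ⟨j, (hcount j).2 (Or.inr rfl), fun h => hij ?_⟩
            exact M.nb_inj g (hiy.trans h.symm)
          · exact ⟨i, (hcount i).2 (Or.inl rfl), hiy⟩
        refine ⟨k, fun hmem => ?_⟩
        rcases mem_insert.1 hmem with h | h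
        · exact hky h
        rcases mem_insert.1 h with h | h
        · exact (M.adj_nb g k).ne h.symm
        · exact hk h
      · obtain ⟨k, hk, hk'⟩ := hold g ((mem_union.1 hgm).resolve_right fun h =>
          hgE (mem_union_right _ h)) fun h => hgE (mem_union_left _ h)
        exact ⟨k, fun hmem => (mem_insert.1 hmem).elim (hk' _ hgy) fun h =>
          (mem_insert.1 h).elim (hk' _ hgx) hk⟩

end

end PlaneMap

end RegularLattice

/-! ### Clusters and fillings -/

namespace RegularLattice

open Finset

open scoped Classical

/-! ### Clusters as connected components -/

section IsCluster

variable {H : SimpleGraph Vertex} {A C C' : Set Vertex} {u v : Vertex}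

theorem IsCluster.mem_of_connectedIn (h : IsCluster H A C) (hu : u ∈ C)
    (huv : ConnectedIn H A u v) : v ∈ C := by
  by_contra hv
  exact h.2.2.2 v ⟨huv.right_mem, hv⟩ u hu huv.symm

theorem IsCluster.mem_of_adj (h : IsCluster H A C) (hu : u ∈ C) (hv : v ∈ A) (huv : H.Adj u v) :
    v ∈ C :=
  h.mem_of_connectedIn hu (.of_adj (h.2.1 hu) hv huv)

theorem IsCluster.eq_of_mem (h : IsCluster H A C) (h' : IsCluster H A C') (hv : v ∈ C)
    (hv' : v ∈ C') : C = C' :=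
  Set.Subset.antisymm
    (fun _ hu => h'.mem_of_connectedIn hv' ((h.2.2.1 v hv _ hu).mono h.2.1))
    (fun _ hu => h.mem_of_connectedIn hv ((h'.2.2.1 v hv' _ hu).mono h'.2.1))

theorem isCluster_setOf_connectedIn (hv : v ∈ A) : IsCluster H A {z | ConnectedIn H A v z} := by
  have key : ∀ z, ConnectedIn H A v z → ConnectedIn H {z | ConnectedIn H A v z} v z := by
    intro z hz
    refine hz.induct (.refl (ConnectedIn.refl hv)) fun a b ha hb hab h => ?_
    have ha' : ConnectedIn H A v a := h.right_mem
    exact h.trans (.of_adj ha' (ha'.trans (.of_adj ha hb hab)) hab)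
  refine ⟨⟨v, .refl hv⟩, fun z hz => ConnectedIn.right_mem hz, fun u hu w hw =>
    (key u hu).symm.trans (key w hw), fun x hx u hu hxu => hx.2 ?_⟩
  exact ConnectedIn.trans hu hxu.symm

theorem IsCluster.eq_setOf_connectedIn (h : IsCluster H A C) (hv : v ∈ C) :
    C = {z | ConnectedIn H A v z} :=
  h.eq_of_mem (isCluster_setOf_connectedIn (h.2.1 hv)) hv (.refl (h.2.1 hv))

theorem IsCluster.subset_of_closed {E : Set Vertex} (h : IsCluster H A C)
    (hE : ∀ u ∈ E, ∀ v ∈ A, H.Adj u v → v ∈ E) (hv : v ∈ C) (hvE : v ∈ E) : C ⊆ E := fun u hu =>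
  ConnectedIn.induct (h.2.2.1 v hv u hu) hvE fun a b _ hb hab ha => hE a ha b (h.2.1 hb) hab

end IsCluster

theorem mem_exterior_iff {L : RegularLattice} {A : Set Vertex} {v : Vertex} :
    v ∈ L.exterior A ↔ v ∉ A ∧ {z | ConnectedIn L.graph Aᶜ v z}.Infinite := by
  constructor
  · rintro ⟨C, hC, hinf, hv⟩
    exact ⟨hC.2.1 hv, by rwa [← hC.eq_setOf_connectedIn hv]⟩
  · rintro ⟨hv, hinf⟩
    exact ⟨_, isCluster_setOf_connectedIn hv, hinf, .refl hv⟩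

section

variable {L : RegularLattice} {A D : Set Vertex}

theorem IsInterlockedCluster.exists_cluster (h : L.IsInterlockedCluster A D) {v : Vertex}
    (hv : v ∈ D) : ∃ C, L.IsStarCluster A C ∧ v ∈ C ∧ C ⊆ D := by
  obtain ⟨C₀, -, rfl⟩ := h
  obtain ⟨C, hC, hvC⟩ := hv
  exact ⟨C, hC.1, hvC, fun u hu => ⟨C, hC, hu⟩⟩

theorem IsInterlockedCluster.mem_of_adj (h : L.IsInterlockedCluster A D) {u v : Vertex}
    (hu : u ∈ D) (hv : v ∈ A) (huv : L.starGraph.Adj u v) : v ∈ D := by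
  obtain ⟨C, hC, huC, hCD⟩ := h.exists_cluster hu
  exact hCD (hC.mem_of_adj huC hv huv)

/-- Distinct interlocked clusters have no interlocked members. -/
theorem IsInterlockedCluster.subset_of_interlocked (h : L.IsInterlockedCluster A D)
    {C C' : Set Vertex} (hC : L.IsStarCluster A C) (hC' : L.IsStarCluster A C') (hCD : C ⊆ D)
    (hint : L.Interlocked C C') : C' ⊆ D := by
  obtain ⟨v, hv⟩ := hC.1
  obtain ⟨C₀, -, rfl⟩ := h
  obtain ⟨C₁, hC₁, hvC₁⟩ := hCD hv
  obtain rfl := hC.eq_of_mem hC₁.1 hv hvC₁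
  exact fun u hu => ⟨C', ⟨hC', hC₁.2.tail ⟨hC, hC', hint⟩⟩, hu⟩

namespace PlaneMap

variable (M : PlaneMap L)

theorem Filling.of_cluster {C : Finset Vertex} (hC : L.IsStarCluster A C) : M.Filling A C C where
  sub := subset_rfl
  inter _ hv _ := hv
  faces := rfl
  conn := hC.2.2.1
  len_le := M.len_le hC.1 hC.2.2.1
  route _ _ _ _ _ _ h := h
  exit _ h h' := absurd h h'

/-- Every finite interlocked cluster has a filling. -/
theorem exists_filling {D : Finset Vertex} (h : L.IsInterlockedCluster A D) :
    ∃ B, M.Filling A D B := by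
  obtain ⟨C₀, hC₀, hD⟩ := id h
  have hC₀D : C₀ ⊆ D := by
    rw [hD]
    exact fun v hv => ⟨C₀, ⟨hC₀, .refl⟩, hv⟩
  -- Closure under `*`-adjacency within `A` makes `E` a union of `*`-clusters, so the next cluster
  -- of a chain lies either inside `E` or apart from it. A largest good `E` is sought; where a chain
  -- first leaves `E`, `Filling.extend` would enlarge it.
  let good : Finset Vertex → Prop := fun E => C₀ ⊆ E ∧
    (∀ u ∈ E, ∀ v ∈ A, L.starGraph.Adj u v → v ∈ E) ∧ ∃ B, M.Filling A E B
  obtain ⟨E, hE, hmax⟩ := exists_max_image (D.powerset.filter good) card (by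
    lift C₀ to Finset Vertex using D.finite_toSet.subset hC₀D
    exact ⟨C₀, mem_filter.2 ⟨mem_powerset.2 (coe_subset.1 hC₀D), subset_rfl,
      fun u hu v hv huv => hC₀.mem_of_adj hu hv huv, C₀, .of_cluster M hC₀⟩⟩)
  simp only [mem_filter, mem_powerset] at hE
  obtain ⟨hED, hC₀E, hclosed, B, hB⟩ := hE
  suffices hDE : D ⊆ E by
    obtain rfl := hED.antisymm hDE
    exact ⟨B, hB⟩
  by_contra hDE
  obtain ⟨w, hwD, hwE⟩ := not_subset.1 hDE
  obtain ⟨C, ⟨hC, hchain⟩, hwC⟩ : w ∈ ⋃₀ {C | L.IsStarCluster A C ∧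
    L.SameInterlockedClass A C₀ C} := by rw [← hD]; exact hwD
  obtain ⟨C₁, C₂, h12, hint, hC₁E, hC₂E⟩ : ∃ C₁ C₂, L.SameInterlockedClass A C₀ C₂ ∧
      (L.IsStarCluster A C₁ ∧ L.IsStarCluster A C₂ ∧ L.Interlocked C₁ C₂) ∧
      C₁ ⊆ (E : Set Vertex) ∧ ¬ C₂ ⊆ (E : Set Vertex) := by
    have hCE : ¬ C ⊆ (E : Set Vertex) := fun h => hwE (h hwC)
    unfold SameInterlockedClass at hchain
    clear hwC hC
    induction hchain with
    | refl => exact absurd hC₀E hCE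
    | @tail C₁ C₂ h1 h2 ih =>
      by_cases hsub : C₁ ⊆ (E : Set Vertex)
      · exact ⟨C₁, C₂, h1.tail h2, h2, hsub, hCE⟩
      · exact ih hsub
  have hC₂D : C₂ ⊆ (D : Set Vertex) := by
    rw [hD]
    exact fun v hv => ⟨C₂, ⟨hint.2.1, h12⟩, hv⟩
  lift C₂ to Finset Vertex using D.finite_toSet.subset hC₂D
  have hdisj : ∀ v ∈ E, v ∉ C₂ := fun v hv hv' =>
    hC₂E (hint.2.1.subset_of_closed hclosed hv' hv)
  have hd12 : Disjoint C₁ (C₂ : Set Vertex) :=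
    Set.disjoint_left.2 fun v hv hv' => hdisj v (hC₁E hv) hv'
  obtain ⟨B', hB'⟩ := hB.extend (D₁ := C₁) (C := C₂) hC₁E hint.2.1.1 hint.2.1.2.2.1
    (disjoint_left.2 fun F hF hF' => by
      obtain ⟨k, hk⟩ := M.mem_facesOf.1 hF
      obtain ⟨m, hm⟩ := M.mem_facesOf.1 hF'
      refine hdisj _ (hclosed _ hk _ (hint.2.1.2.1 hm) (M.star_iff.2 ⟨fun e => ?_, F,
        ⟨k, rfl⟩, m, rfl⟩)) hm
      exact hdisj _ hk (e ▸ hm))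
    (fun u hu v hv huv => mem_union.2 ((mem_union.1 hu).imp (fun hu => hclosed u hu v hv huv)
      fun hu => hint.2.1.mem_of_adj hu hv huv))
    (M.exists_gate hd12 hint.2.2)
  have hlt := hmax (E ∪ C₂) (mem_filter.2 ⟨mem_powerset.2 (union_subset hED (coe_subset.1 hC₂D)),
    hC₀E.trans (coe_subset.2 subset_union_left),
    fun u hu v hv huv => mem_union.2 ((mem_union.1 hu).imp (fun hu => hclosed u hu v hv huv)
      fun hu => hint.2.1.mem_of_adj hu hv huv), B', hB'⟩)
  obtain ⟨z, hz⟩ := hint.2.1.1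
  exact absurd hlt (not_le.2 (card_lt_card (ssubset_iff_of_subset subset_union_left |>.2
    ⟨z, mem_union_right _ hz, fun h => hdisj z h hz⟩)))

end PlaneMap

end

end RegularLattice

/-! ### The exterior -/

namespace RegularLattice

open Finset

open scoped Classical

section Exterior

variable {L : RegularLattice} {A S : Set Vertex} {u v : Vertex}

theorem adj_right (L : RegularLattice) (a b : ℤ) : L.graph.Adj (a, b) (a + 1, b) := by
  cases L
  · simp [graph, squareGraph]
  · simp [graph, triangularGraph]
  · simp [graph, hexagonalGraph]

theorem adj_left (L : RegularLattice) (a b : ℤ) : L.graph.Adj (a, b) (a - 1, b) := by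
  have := (L.adj_right (a - 1) b).symm
  rwa [sub_add_cancel] at this

/-- In the brick wall every other vertical edge is missing, but then those on both sides of it are
present. Vertical moves therefore need two adjacent columns in what follows. -/
theorem adj_up_or (L : RegularLattice) (a b : ℤ) :
    L.graph.Adj (a, b) (a, b + 1) ∨
      L.graph.Adj (a + 1, b) (a + 1, b + 1) ∧ L.graph.Adj (a - 1, b) (a - 1, b + 1) := by
  cases L
  · simp [graph, squareGraph]
  · simp [graph, triangularGraph]
  · rcases Int.even_or_odd (a + b) with h | h
    · simp [graph, hexagonalGraph, h]
    · right
      have h1 : Even (a + 1 + b) := by rw [add_right_comm]; exact h.add_one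
      have h2 : Even (a - 1 + b) := by rw [sub_add_eq_add_sub]; exact h.sub_odd odd_one
      simp [graph, hexagonalGraph, h1, h2]

theorem connectedIn_row {a a' b : ℤ} (h : a ≤ a') (hS : ∀ t, a ≤ t → t ≤ a' → (t, b) ∈ S) :
    ConnectedIn L.graph S (a, b) (a', b) := by
  induction a', h using Int.leInduction with
  | base => exact .refl (hS a le_rfl le_rfl)
  | succ n hn ih =>
    exact (ih fun t h1 h2 => hS t h1 (by omega)).trans
      (.of_adj (hS n hn (by omega)) (hS _ (by omega) le_rfl) (L.adj_right n b))

theorem connectedIn_up {a b : ℤ} (hS : (∀ s, (a, s) ∈ S ∧ (a + 1, s) ∈ S) ∨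
    ∀ s, (a, s) ∈ S ∧ (a - 1, s) ∈ S) : ConnectedIn L.graph S (a, b) (a, b + 1) := by
  have h0 : ∀ s, (a, s) ∈ S := fun s => hS.elim (fun h => (h s).1) fun h => (h s).1
  rcases L.adj_up_or a b with h | ⟨h1, h2⟩
  · exact .of_adj (h0 _) (h0 _) h
  rcases hS with hS | hS
  · exact ((ConnectedIn.of_adj (h0 _) (hS _).2 (L.adj_right _ _)).trans
      (.of_adj (hS _).2 (hS _).2 h1)).trans (.of_adj (hS _).2 (h0 _) (L.adj_right _ _).symm)
  · exact ((ConnectedIn.of_adj (h0 _) (hS _).2 (L.adj_left _ _)).trans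
      (.of_adj (hS _).2 (hS _).2 h2)).trans (.of_adj (hS _).2 (h0 _) (L.adj_left _ _).symm)

theorem connectedIn_column {a : ℤ} (hS : (∀ s, (a, s) ∈ S ∧ (a + 1, s) ∈ S) ∨
    ∀ s, (a, s) ∈ S ∧ (a - 1, s) ∈ S) (b b' : ℤ) : ConnectedIn L.graph S (a, b) (a, b') := by
  have h0 : ∀ s, (a, s) ∈ S := fun s => hS.elim (fun h => (h s).1) fun h => (h s).1
  have key : ∀ b b' : ℤ, b ≤ b' → ConnectedIn L.graph S (a, b) (a, b') := by
    intro b b' h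
    induction b', h using Int.leInduction with
    | base => exact .refl (h0 _)
    | succ n _ ih => exact ih.trans (connectedIn_up hS)
  rcases le_total b b' with h | h
  · exact key _ _ h
  · exact (key _ _ h).symm

/-- The complement of a large box is connected. -/
theorem exists_far (B : Finset Vertex) : ∃ p : Vertex, ∃ Q : Set Vertex, Q.Finite ∧
    ∀ v ∉ Q, ConnectedIn L.graph (B : Set Vertex)ᶜ v p := by
  obtain ⟨n, hn0, hn⟩ : ∃ n : ℤ, 0 ≤ n ∧ ∀ v ∈ B, |v.1| ≤ n ∧ |v.2| ≤ n := by
    refine ⟨∑ v ∈ B, (|v.1| + |v.2|), sum_nonneg fun _ _ => by positivity, fun v hv => ?_⟩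
    have h := single_le_sum (f := fun v : Vertex => |v.1| + |v.2|)
      (fun v _ => by positivity) hv
    have h1 := abs_nonneg v.1
    have h2 := abs_nonneg v.2
    constructor <;> linarith
  have hB : ∀ a b : ℤ, n < |a| ∨ n < |b| → (a, b) ∈ (B : Set Vertex)ᶜ := by
    intro a b h hmem
    have := hn _ hmem
    simp only at this
    omega
  refine ⟨(n + 1, 0), Set.Icc (-n) n ×ˢ Set.Icc (-n) n,
    (Set.finite_Icc _ _).prod (Set.finite_Icc _ _), ?_⟩
  have right : ∀ a b, n < a → ConnectedIn L.graph (B : Set Vertex)ᶜ (a, b) (n + 1, 0) := by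
    intro a b h
    refine (connectedIn_column (Or.inl fun s => ⟨hB _ _ (Or.inl ?_), hB _ _ (Or.inl ?_)⟩)
      b 0).trans (connectedIn_row (by omega) fun t h1 h2 => hB _ _ (Or.inl ?_)).symm
    · exact h.trans_le (le_abs_self a)
    · exact lt_of_lt_of_le (by omega) (le_abs_self (a + 1))
    · exact lt_of_lt_of_le (by omega) (le_abs_self t)
  have row : ∀ a b, n < |b| → ConnectedIn L.graph (B : Set Vertex)ᶜ (a, b) (n + 1, 0) := by
    intro a b h
    by_cases ha : n < a
    · exact right a b ha
    · exact (connectedIn_row (by omega) fun t _ _ => hB _ _ (Or.inr h)).trans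
        (right (n + 1) b (by omega))
  rintro ⟨a, b⟩ hv
  by_cases hb : n < |b|
  · exact row a b hb
  by_cases ha : n < a
  · exact right a b ha
  have ha' : a < -n := by
    by_contra h
    have := abs_le.1 (not_lt.1 hb)
    exact hv ⟨⟨by simp only; omega, by simp only; omega⟩, this⟩
  refine (connectedIn_column (Or.inr fun s => ⟨hB _ _ (Or.inl ?_), hB _ _ (Or.inl ?_)⟩)
      b (n + 1)).trans (row a (n + 1) ?_)
  · exact lt_of_lt_of_le (by omega) (neg_le_abs a)
  · exact lt_of_lt_of_le (by omega) (neg_le_abs (a - 1))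
  · exact lt_of_lt_of_le (by omega) (le_abs_self (n + 1))

theorem mem_exterior_of_connectedIn (h : v ∈ L.exterior A) (huv : ConnectedIn L.graph Aᶜ v u) :
    u ∈ L.exterior A := by
  rw [mem_exterior_iff] at h ⊢
  exact ⟨huv.right_mem, h.2.mono fun z hz => huv.symm.trans hz⟩

theorem exterior_anti {A' : Set Vertex} (hA : A' ⊆ A) (h : v ∈ L.exterior A) :
    v ∈ L.exterior A' := by
  rw [mem_exterior_iff] at h ⊢
  exact ⟨fun hv => h.1 (hA hv), h.2.mono fun z hz =>
    ConnectedIn.mono (Set.compl_subset_compl.2 hA) hz⟩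

theorem exists_mem_exterior (B : Finset Vertex) :
    ∃ Q : Set Vertex, Q.Finite ∧ ∀ v ∉ Q, v ∈ L.exterior B := by
  obtain ⟨p, Q, hQ, h⟩ := exists_far (L := L) B
  exact ⟨Q, hQ, fun v hv => mem_exterior_iff.2 ⟨(h v hv).left_mem,
    hQ.infinite_compl.mono fun z hz => (h v hv).trans (h z hz).symm⟩⟩

theorem connectedIn_of_mem_exterior {B : Finset Vertex} (hu : u ∈ L.exterior B)
    (hv : v ∈ L.exterior B) : ConnectedIn L.graph (B : Set Vertex)ᶜ u v := by
  obtain ⟨p, Q, hQ, h⟩ := exists_far (L := L) B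
  have key : ∀ u ∈ L.exterior B, ConnectedIn L.graph (B : Set Vertex)ᶜ u p := by
    intro u hu
    obtain ⟨z, hz, hzQ⟩ := ((mem_exterior_iff.1 hu).2.sdiff hQ).nonempty
    exact ConnectedIn.trans hz (h z hzQ)
  exact (key u hu).trans (key v hv).symm

theorem mem_exterior_of_row {B : Set Vertex} {a b : ℤ} (h : ∀ t ≤ a, (t, b) ∉ B) :
    (a, b) ∈ L.exterior B := by
  refine mem_exterior_iff.2 ⟨h a le_rfl, ?_⟩
  refine (Set.infinite_of_injective_forall_mem (f := fun n : ℕ => ((a - n, b) : Vertex))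
    (fun m n h => ?_) fun n => ?_)
  · simpa using h
  · exact (connectedIn_row (by omega) fun t _ h2 => h t h2).symm

end Exterior

namespace PlaneMap

variable {L : RegularLattice} {M : PlaneMap L} {A : Set Vertex} {D B : Finset Vertex}

theorem mem_exteriorStarBoundary {v : Vertex} :
    v ∈ L.exteriorStarBoundary (B : Set Vertex) ↔ v ∈ L.exterior B ∧ v ∈ M.nbhd B := by
  refine and_congr_right fun hv => ?_
  rw [M.mem_nbhd, M.exists_lf_mem_iff (exterior_notMem hv)]
  simp only [mem_coe, SimpleGraph.adj_comm]

theorem Filling.exists_star (h : M.Filling A D B) {v : Vertex}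
    (hv : v ∈ L.exteriorStarBoundary (B : Set Vertex)) : ∃ u ∈ D, L.starGraph.Adj u v := by
  have h1 := (mem_exteriorStarBoundary (M := M)).1 hv
  rw [mem_nbhd, h.faces, M.exists_lf_mem_iff] at h1
  · exact h1.2
  · exact fun hD => exterior_notMem h1.1 (h.sub hD)

/-- Filling adds no faces, so a contour vertex shares a face with `D` itself; in `A` it would belong
to a `*`-cluster inside `D`. -/
theorem Filling.notMem (h : M.Filling A D B) (hD : L.IsInterlockedCluster A D) {v : Vertex}
    (hv : v ∈ L.exteriorStarBoundary (B : Set Vertex)) : v ∉ A := by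
  obtain ⟨u, hu, huv⟩ := h.exists_star hv
  exact fun hvA => exterior_notMem hv.1 (h.sub (hD.mem_of_adj hu hvA huv))

/-- A path off `D` from a far point is rerouted off `B` by `route`, with no further obstacle. -/
theorem Filling.mem_exterior (h : M.Filling A D B) {v : Vertex} (hv : v ∈ L.exterior D)
    (hvB : v ∉ B) : v ∈ L.exterior B := by
  obtain ⟨Q, hQ, hQ'⟩ := exists_mem_exterior (L := L) B
  obtain ⟨z, hz⟩ := hQ.infinite_compl.nonempty
  have hz' := hQ' z hz
  have := h.route ∅ (fun _ _ _ h => h) z v (exterior_notMem hz') hvB (by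
    rw [Set.union_empty]
    exact connectedIn_of_mem_exterior (exterior_anti (coe_subset.2 h.sub) hz') hv)
  rw [Set.union_empty] at this
  exact mem_exterior_of_connectedIn hz' this

/-- Contour edges run off `B`, so a chain of them that starts in the exterior never leaves it. -/
theorem contour_steps (hB : L.StarConnected (B : Set Vertex)) {x y : Vertex}
    (hx : x ∈ L.exteriorStarBoundary (B : Set Vertex))
    (hy : y ∈ L.exteriorStarBoundary (B : Set Vertex)) :
    Relation.ReflTransGen (fun a b => M.Step B a b ∧
      a ∈ L.exteriorStarBoundary (B : Set Vertex) ∧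
      b ∈ L.exteriorStarBoundary (B : Set Vertex)) x y := by
  have hx' := (mem_exteriorStarBoundary (M := M)).1 hx
  have hy' := (mem_exteriorStarBoundary (M := M)).1 hy
  have h := M.contour_connected hB (M.mem_nbhd.1 hx'.2) (M.mem_nbhd.1 hy'.2)
    (connectedIn_of_mem_exterior hx.1 hy.1)
  clear hy hy'
  suffices x ∈ L.exteriorStarBoundary (B : Set Vertex) ∧ y ∈ L.exteriorStarBoundary (B : Set Vertex)
    ∧ Relation.ReflTransGen (fun a b => M.Step B a b ∧
      a ∈ L.exteriorStarBoundary (B : Set Vertex) ∧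
      b ∈ L.exteriorStarBoundary (B : Set Vertex)) x y from this.2.2
  induction h with
  | refl => exact ⟨hx, hx, .refl⟩
  | @tail b c _ hbc ih =>
    have hc : c ∈ L.exteriorStarBoundary (B : Set Vertex) :=
      (mem_exteriorStarBoundary (M := M)).2 ⟨mem_exterior_of_connectedIn ih.2.1.1
        (.of_adj hbc.notMem.1 hbc.notMem.2 hbc.adj), hbc.mem_nbhd.2⟩
    exact ⟨hx, hc, ih.2.2.tail ⟨hbc, ih.2.1, hc⟩⟩

theorem Filling.connectedIn (h : M.Filling A D B) (hD : L.IsInterlockedCluster A D) {x y : Vertex}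
    (hx : x ∈ L.exteriorStarBoundary (B : Set Vertex))
    (hy : y ∈ L.exteriorStarBoundary (B : Set Vertex)) : ConnectedIn L.graph Aᶜ x y :=
  connectedIn_iff.2 ⟨h.notMem hD hx, (contour_steps (M := M) h.conn hx hy).lift id
    fun _ _ h' => ⟨h.notMem hD h'.2.1, h.notMem hD h'.2.2, h'.1.adj⟩⟩

/-- If the interlocked cluster is not separated from infinity then neither is the contour of the
filling. -/
theorem Filling.boundary_subset (h : M.Filling A D B) (hD : L.IsInterlockedCluster A D)
    (hne : ((D : Set Vertex) ∩ L.exterior (A \ D)).Nonempty) {x : Vertex}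
    (hx : x ∈ L.exteriorStarBoundary (B : Set Vertex)) : x ∈ L.exterior A := by
  obtain ⟨d, hdD, hd⟩ := hne
  obtain ⟨Q, hQ, hQ'⟩ := exists_mem_exterior (L := L) B
  refine mem_exterior_iff.2 ⟨h.notMem hD hx,
    ((mem_exterior_iff.1 hd).2.sdiff hQ).mono ?_⟩
  rintro z ⟨hz, hzQ⟩
  have hzB := hQ' z hzQ
  have hA : ∀ v, v ∈ (A \ (D : Set Vertex))ᶜ → v ∉ B → v ∈ Aᶜ := fun v hv hvB hvA =>
    hv ⟨hvA, fun hvD => hvB (h.sub hvD)⟩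
  -- Follow the path from the far point `z` back to `d`. As `d` is in `B`, the path enters `B`; the
  -- vertex just before the first entry is on the contour, and up to there the path avoids `A`.
  have key : (d ∈ L.exterior B ∧ ConnectedIn L.graph Aᶜ d z) ∨
      ∃ b ∈ L.exteriorStarBoundary (B : Set Vertex), ConnectedIn L.graph Aᶜ b z := by
    refine ConnectedIn.induct (p := fun d => (d ∈ L.exterior B ∧ ConnectedIn L.graph Aᶜ d z) ∨
      ∃ b ∈ L.exteriorStarBoundary (B : Set Vertex), ConnectedIn L.graph Aᶜ b z)
      (ConnectedIn.symm hz) (Or.inl ⟨hzB, .refl (hA z (ConnectedIn.right_mem hz)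
        (exterior_notMem hzB))⟩) ?_
    rintro a b ha hb hab (⟨ha', haz⟩ | h')
    · have haB := exterior_notMem ha'
      by_cases hbB : b ∈ B
      · exact Or.inr ⟨a, ⟨ha', b, hbB, M.star_of_adj hab.symm⟩, haz⟩
      · exact Or.inl ⟨mem_exterior_of_connectedIn ha' (.of_adj haB hbB hab),
          (ConnectedIn.of_adj (hA b hb hbB) (hA a ha haB) hab.symm).trans haz⟩
    · exact Or.inr h'
  replace key := key.resolve_left fun h' => exterior_notMem h'.1 (h.sub hdD)
  obtain ⟨b, hb, hbz⟩ := key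
  exact (h.connectedIn hD hx hb).trans hbz

/-- A boundary vertex of `D` may itself be a filled gate; its exit leads to the contour in one step.
-/
theorem Filling.exists_boundary (h : M.Filling A D B) (hD : L.IsInterlockedCluster A D) {x : Vertex}
    (hx : x ∈ L.exteriorStarBoundary (D : Set Vertex)) :
    x ∉ A ∧ ∃ x' ∈ L.exteriorStarBoundary (B : Set Vertex), x' = x ∨ L.graph.Adj x x' := by
  obtain ⟨hxe, u, hu, hux⟩ := hx
  have hxD := exterior_notMem hxe
  refine ⟨fun hxA => hxD (hD.mem_of_adj hu hxA hux), ?_⟩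
  by_cases hxB : x ∈ B
  · obtain ⟨i, hi⟩ := h.exit x hxB hxD
    refine ⟨M.nb x i, ⟨h.mem_exterior (mem_exterior_of_connectedIn hxe (.of_adj hxD
      (fun hD => hi (h.sub hD)) (M.adj_nb x i))) hi, x, hxB, M.star_of_adj (M.adj_nb x i)⟩,
      Or.inr (M.adj_nb x i)⟩
  · exact ⟨x, ⟨h.mem_exterior hxe hxB, u, h.sub hu, hux⟩, Or.inl rfl⟩

end PlaneMap

end RegularLattice

/-! ### Local structure of the contour -/

namespace RegularLattice

open Finset

open scoped Classical

variable {L : RegularLattice}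

/-- The number of free neighbours of `x`. -/
noncomputable def freeDeg (L : RegularLattice) (A : Set Vertex) (x : Vertex) : ℕ :=
  (L.graph.neighborSet x \ A).ncard

/-- The neighbours of `x` in `A` lie in one `*`-cluster because they are pairwise `*`-adjacent. -/
def Clumped (L : RegularLattice) (A : Set Vertex) (x : Vertex) : Prop :=
  ∀ u ∈ A, L.graph.Adj x u → ∀ v ∈ A, L.graph.Adj x v → u = v ∨ L.starGraph.Adj u v

/-- The local properties of the contour `G` of a filling `B` of an interlocked cluster of `A`:
no further `*`-cluster of `A` is interlocked with it. -/
structure Unlocked (L : RegularLattice) (A : Set Vertex) (B : Finset Vertex) (G : Set Vertex) :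
    Prop where
  mem_of_star : ∀ u ∈ B, ∀ v ∈ A, L.starGraph.Adj u v → v ∈ B
  notMem : ∀ v ∈ G, v ∉ A
  mem_of_row : ∀ a b : ℤ, (∀ t ≤ a, (t, b) ∉ B) → (∃ u ∈ B, L.starGraph.Adj u (a, b)) → (a, b) ∈ G
  no_lock : ∀ x ∈ G, L.freeDeg A x = 2 → ∀ u ∈ A, L.graph.Adj x u → u ∈ B →
    ∀ v ∈ A, L.graph.Adj x v → v ∈ B
  no_double_lock : ∀ x ∈ G, ∀ y ∈ G, L.graph.Adj x y → L.freeDeg A x = 2 → L.freeDeg A y = 2 →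
    (∀ u ∈ A, L.graph.Adj x u → u ∈ B) → L.Clumped A x →
    (∀ u ∈ A, L.graph.Adj y u → u ∉ B) → ¬ L.Clumped A y

namespace PlaneMap

variable {M : PlaneMap L} {A : Set Vertex} {D B : Finset Vertex}

theorem star_nb_succ (x : Vertex) (i : Fin L.deg) :
    L.starGraph.Adj (M.nb x i) (M.nb x (i + 1)) := by
  refine M.star_iff.2 ⟨fun h => ?_, M.lf x i, M.nb_mem_lf x i, ?_⟩
  · exact Fin.ne_add_one (by have := deg_ge (L := L); omega) i (M.nb_inj x h)
  · have := M.nb_mem_lf' x (i + 1)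
    rwa [add_sub_cancel_right] at this

/-- If a proper non-empty part of the occupied neighbours of `x` is closed under `*`-adjacency
then it is followed by a free neighbour. -/
theorem exists_free_after {S : Set Vertex} {x : Vertex} {i j : Fin L.deg} (hi : M.nb x i ∈ S)
    (hj : M.nb x j ∉ S) (hS : ∀ k, M.nb x k ∈ S → M.nb x (k + 1) ∈ A → M.nb x (k + 1) ∈ S) :
    ∃ k, M.nb x k ∈ S ∧ M.nb x (k + 1) ∉ A := by
  by_contra hcon
  push Not at hcon
  exact hj (Fin.cyclic_induction (p := fun k => M.nb x k ∈ S) (fun k hk => hS k hk (hcon k hk)) hi j)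

/-- If just two neighbours of `x` are free then the others belong to at most two `*`-clusters. -/
theorem mem_or_mem_of_freeDeg (M : PlaneMap L) {C₁ C₂ : Set Vertex} (h₁ : L.IsStarCluster A C₁)
    (h₂ : L.IsStarCluster A C₂) (hne : C₁ ≠ C₂) {x : Vertex} (hx : L.freeDeg A x = 2)
    {u v w : Vertex} (hu : u ∈ C₁) (hxu : L.graph.Adj x u) (hv : v ∈ C₂) (hxv : L.graph.Adj x v)
    (hw : w ∈ A) (hxw : L.graph.Adj x w) : w ∈ C₁ ∨ w ∈ C₂ := by
  by_contra hcon
  push Not at hcon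
  obtain ⟨i, rfl⟩ := (M.adj_iff _ _).1 hxu
  obtain ⟨j, rfl⟩ := (M.adj_iff _ _).1 hxv
  obtain ⟨k, rfl⟩ := (M.adj_iff _ _).1 hxw
  have h₃ := isCluster_setOf_connectedIn (H := L.starGraph) hw
  have hw₃ : M.nb x k ∈ {z | ConnectedIn L.starGraph A (M.nb x k) z} := .refl hw
  set C₃ := {z | ConnectedIn L.starGraph A (M.nb x k) z}
  have cl : ∀ C, L.IsStarCluster A C → ∀ k, M.nb x k ∈ C → M.nb x (k + 1) ∈ A →
      M.nb x (k + 1) ∈ C := fun C hC k hk hk' => hC.mem_of_adj hk hk' (M.star_nb_succ x k)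
  have dj : ∀ C C' z, L.IsStarCluster A C → L.IsStarCluster A C' → C ≠ C' → z ∈ C → z ∉ C' :=
    fun C C' z h h' hne hz hz' => hne (h.eq_of_mem h' hz hz')
  have n13 : C₁ ≠ C₃ := fun h => hcon.1 (h ▸ hw₃)
  have n23 : C₂ ≠ C₃ := fun h => hcon.2 (h ▸ hw₃)
  obtain ⟨p, hp, hp'⟩ := exists_free_after hu hcon.1 (cl C₁ h₁)
  obtain ⟨q, hq, hq'⟩ := exists_free_after hv hcon.2 (cl C₂ h₂)
  obtain ⟨r, hr, hr'⟩ := exists_free_after hw₃ (dj _ _ _ h₁ h₃ n13 hu) (cl C₃ h₃)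
  have npq : p ≠ q := fun h => dj _ _ _ h₁ h₂ hne hp (h ▸ hq)
  have npr : p ≠ r := fun h => dj _ _ _ h₁ h₃ n13 hp (h ▸ hr)
  have nqr : q ≠ r := fun h => dj _ _ _ h₂ h₃ n23 hq (h ▸ hr)
  obtain ⟨s, t, -, hst⟩ := M.exists_two_of_ncard hx
  have e1 := (hst _).1 hp'
  have e2 := (hst _).1 hq'
  have e3 := (hst _).1 hr'
  have m1 : p + 1 ≠ q + 1 := fun h => npq (add_right_cancel h)
  have m2 : p + 1 ≠ r + 1 := fun h => npr (add_right_cancel h)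
  have m3 : q + 1 ≠ r + 1 := fun h => nqr (add_right_cancel h)
  rcases e1 with e1 | e1 <;> rcases e2 with e2 | e2 <;> rcases e3 with e3 | e3 <;> simp_all

/-- Since `deg > 2`, some neighbour is occupied, and all occupied ones share its `*`-cluster.
Counting the neighbours outside this cluster is then the same as counting those outside `A`, as
clause (2) of interlocking requires. -/
theorem exists_cluster_of_clumped (M : PlaneMap L) {x : Vertex} (hx : L.freeDeg A x = 2) (hc : L.Clumped A x) :
    ∃ C, L.IsStarCluster A C ∧ (∃ u ∈ C, L.graph.Adj x u) ∧
      L.graph.neighborSet x \ C = L.graph.neighborSet x \ A := by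
  obtain ⟨i, hi⟩ : ∃ i, M.nb x i ∈ A := by
    by_contra hcon
    push Not at hcon
    rw [freeDeg, M.ncard_neighborSet_diff, filter_true_of_mem fun i _ => hcon i, card_univ,
      Fintype.card_fin] at hx
    have := deg_ge (L := L)
    omega
  have hC := isCluster_setOf_connectedIn (H := L.starGraph) hi
  refine ⟨_, hC, ⟨_, .refl hi, M.adj_nb x i⟩, ?_⟩
  ext v
  refine and_congr_right fun hv => not_congr ⟨fun h => hC.2.1 h, fun h => ?_⟩
  rcases hc _ hi (M.adj_nb x i) v h hv with rfl | h'
  · exact .refl hi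
  · exact .of_adj hi h h'

/-- A `*`-cluster violating this would be interlocked with one in `D`, and hence part of `D`. The
contour lies in the exterior of `A` by `Filling.boundary_subset`, so in the exterior of any two
`*`-clusters of `A`, as interlocking demands. -/
theorem Filling.unlocked (h : M.Filling A D B) (hD : L.IsInterlockedCluster A D)
    (hne : ((D : Set Vertex) ∩ L.exterior (A \ D)).Nonempty) :
    L.Unlocked A B (L.exteriorStarBoundary (B : Set Vertex)) := by
  have hext : ∀ x ∈ L.exteriorStarBoundary (B : Set Vertex), ∀ S ⊆ A, x ∈ L.exterior S :=
    fun x hx S hS => exterior_anti hS (h.boundary_subset hD hne hx)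
  have hsep : ∀ C C', L.IsStarCluster A C → L.IsStarCluster A C' → C ≠ C' →
      ∀ u ∈ C, ∀ v ∈ C', ¬ L.starGraph.Adj u v := fun C C' hC hC' hn u hu v hv huv =>
    hn (hC.eq_of_mem hC' (hC.mem_of_adj hu (hC'.2.1 hv) huv) hv)
  have hsub : ∀ C, L.IsStarCluster A C → ∀ u ∈ C, u ∈ B → C ⊆ (D : Set Vertex) := by
    intro C hC u hu huB
    obtain ⟨C', hC', huC', hC'D⟩ := hD.exists_cluster (h.inter u huB (hC.2.1 hu))
    rwa [hC.eq_of_mem hC' hu huC']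
  refine ⟨fun u hu v hv huv => ?_, fun v => h.notMem hD, fun a b hrow hstar =>
    ⟨mem_exterior_of_row hrow, hstar.imp fun u hu => ?_⟩, ?_, ?_⟩
  -- `u` may be a filled gate, but the face it shares with `v` meets `D` too.
  · obtain ⟨-, F, ⟨k, hk⟩, m, hm⟩ := M.star_iff.1 huv
    have hF : F ∈ M.facesOf D := by
      rw [← h.faces]
      exact M.mem_facesOf.2 ⟨k, hk ▸ hu⟩
    obtain ⟨l, hl⟩ := M.mem_facesOf.1 hF
    apply h.sub
    by_cases e : M.cyc F l = v
    · exact e ▸ hl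
    · exact hD.mem_of_adj hl hv (M.star_iff.2 ⟨e, F, ⟨l, rfl⟩, m, hm⟩)
  · exact hu
  · intro x hx h2 u huA hxu huB v hvA hxv
    by_contra hvB
    have hC₁ := isCluster_setOf_connectedIn (H := L.starGraph) huA
    have hC₂ := isCluster_setOf_connectedIn (H := L.starGraph) hvA
    have hu : u ∈ {z | ConnectedIn L.starGraph A u z} := .refl huA
    have hv : v ∈ {z | ConnectedIn L.starGraph A v z} := .refl hvA
    set C₁ := {z | ConnectedIn L.starGraph A u z}
    set C₂ := {z | ConnectedIn L.starGraph A v z}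
    have hC₁D := hsub C₁ hC₁ u hu huB
    have hn : C₁ ≠ C₂ := fun e => hvB (h.sub (hC₁D (e ▸ hv)))
    have hsubA : C₁ ∪ C₂ ⊆ A := Set.union_subset hC₁.2.1 hC₂.2.1
    refine hvB (h.sub (hD.subset_of_interlocked hC₁ hC₂ hC₁D ⟨hsep _ _ hC₁ hC₂ hn,
      Or.inl ⟨x, hext x hx _ hsubA, ?_, ⟨u, hxu, hu⟩, v, hxv, hv⟩⟩ hv))
    rw [← h2, freeDeg]
    congr 1
    ext w
    exact and_congr_right fun hw => not_congr ⟨fun h => hsubA h, fun h =>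
      M.mem_or_mem_of_freeDeg hC₁ hC₂ hn h2 hu hxu hv hxv h hw⟩
  · intro x hx y hy hxy hx2 hy2 hxB hxc hyB hyc
    obtain ⟨C₁, hC₁, ⟨u, hu, hxu⟩, e₁⟩ := M.exists_cluster_of_clumped hx2 hxc
    obtain ⟨C₂, hC₂, ⟨v, hv, hyv⟩, e₂⟩ := M.exists_cluster_of_clumped hy2 hyc
    have hC₁D := hsub C₁ hC₁ u hu (hxB u (hC₁.2.1 hu) hxu)
    have hvB := hyB v (hC₂.2.1 hv) hyv
    have hn : C₁ ≠ C₂ := fun e => hvB (h.sub (hC₁D (e ▸ hv)))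
    have hsubA : C₁ ∪ C₂ ⊆ A := Set.union_subset hC₁.2.1 hC₂.2.1
    refine hvB (h.sub (hD.subset_of_interlocked hC₁ hC₂ hC₁D ⟨hsep _ _ hC₁ hC₂ hn,
      Or.inr ⟨x, hext x hx _ hsubA, y, hext y hy _ hsubA, hxy, ?_, ?_, ?_, ?_⟩⟩ hv))
    · rw [e₁]; exact hx2
    · refine Set.eq_empty_iff_forall_notMem.2 fun w hw => ?_
      have : w ∉ L.graph.neighborSet x \ A := fun h' => h'.2 (hC₂.2.1 hw.2)
      rw [← e₁] at this
      have hw1 : w ∈ C₁ := by_contra fun h' => this ⟨hw.1, h'⟩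
      exact hn (hC₁.eq_of_mem hC₂ hw1 hw.2)
    · rw [e₂]; exact hy2
    · refine Set.eq_empty_iff_forall_notMem.2 fun w hw => ?_
      have : w ∉ L.graph.neighborSet y \ A := fun h' => h'.2 (hC₁.2.1 hw.2)
      rw [← e₂] at this
      have hw1 : w ∈ C₂ := by_contra fun h' => this ⟨hw.1, h'⟩
      exact hn (hC₁.eq_of_mem hC₂ hw.2 hw1)

end PlaneMap

end RegularLattice

/-! ### Rows -/

namespace RegularLattice

open Finset

open scoped Classical

theorem freeDeg_eq {L : RegularLattice} (M : PlaneMap L) (A : Set Vertex) (x : Vertex) :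
    L.freeDeg A x = ∑ i, if M.nb x i ∈ A then 0 else 1 := by
  rw [freeDeg, M.ncard_neighborSet_diff, card_filter]
  exact sum_congr rfl fun i _ => by simp only [ite_not]

section Row

variable {A G : Set Vertex} {B : Finset Vertex} {a b σ : ℤ}

/-! ### Left ends of rows: the square lattice -/

theorem square_adj_iff {a b a' b' : ℤ} : square.graph.Adj (a, b) (a', b') ↔
    (a' = a + 1 ∧ b' = b) ∨ (a' = a ∧ b' = b + 1) ∨ (a' = a - 1 ∧ b' = b) ∨ a' = a ∧ b' = b - 1 := by
  refine (squareNb_adj_iff _ _).trans ?_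
  simp only [squareNb, Fin.exists_fin_succ, Matrix.cons_val_zero, Matrix.cons_val_succ,
    Prod.mk.injEq]
  simp [eq_comm]

theorem square_adj_cases {u : Vertex} (hσ : σ = 1 ∨ σ = -1) (h : square.graph.Adj (a, b) u) :
    u = (a + 1, b) ∨ u = (a - 1, b) ∨ u = (a, b + σ) ∨ u = (a, b - σ) := by
  have := square_adj_iff.1 h
  simp only [Prod.ext_iff]
  omega

theorem square_star {a b a' b' : ℤ} (h : (a ≠ a' ∨ b ≠ b') ∧ a ≤ a' + 1 ∧ a' ≤ a + 1 ∧
    b ≤ b' + 1 ∧ b' ≤ b + 1) : square.starGraph.Adj (a, b) (a', b') := by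
  refine ⟨fun h' => ?_, _, ⟨min a a', min b b', rfl⟩, ?_⟩
  · rw [Prod.mk.injEq] at h'
    omega
  simp only [Set.mem_insert_iff, Set.mem_singleton_iff, Prod.mk.injEq]
  omega

theorem freeDeg_square (hσ : σ = 1 ∨ σ = -1) : square.freeDeg A (a, b) =
    (if (a + 1, b) ∈ A then 0 else 1) + (if (a - 1, b) ∈ A then 0 else 1) +
      (if (a, b + σ) ∈ A then 0 else 1) + if (a, b - σ) ∈ A then 0 else 1 := by
  rw [freeDeg_eq squareMap]
  change (∑ i : Fin 4, if squareNb (a, b) i ∈ A then 0 else 1) = _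
  rw [Fin.sum_univ_four]
  rcases hσ with rfl | rfl <;> simp [squareNb, sub_eq_add_neg] <;> ring

/-- Suppose every vertex of `G` in the row has two free neighbours. Then the occupied neighbours of
`(a - 1, b)` form a corner in `B`, and those of `(a - 2, b)` form the opposite corner outside `B`.
That is a double lock. -/
theorem square_row (h : square.Unlocked A B G) (hσ : σ = 1 ∨ σ = -1) (hab : (a, b) ∈ B)
    (hl : ∀ t < a, (t, b) ∉ B) (hn : ∀ t < a, (t, b + σ) ∉ B) :
    ∃ v ∈ G, square.freeDeg A v ≠ 2 ∧ v.2 = b := by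
  by_contra hcon
  have hcon' : ∀ t, (t, b) ∈ G → square.freeDeg A (t, b) = 2 := fun t ht => by
    by_contra h'; exact hcon ⟨_, ht, h', rfl⟩
  have hx : (a - 1, b) ∈ G := h.mem_of_row _ _ (fun t ht => hl t (by omega))
    ⟨_, hab, square_star (by omega)⟩
  have hu : (a - 1, b + σ) ∉ A := h.notMem _ (h.mem_of_row _ _ (fun t ht => hn t (by omega))
    ⟨_, hab, square_star (by omega)⟩)
  have hx2 := hcon' _ hx
  have hx2' := hx2
  have f1 : (a - 1, b - σ) ∈ A → (a - 1, b - σ) ∈ B := fun h' =>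
    h.mem_of_star _ hab _ h' (square_star (by omega))
  -- If it were occupied, being outside `B`, then by `no_lock` no occupied neighbour could be in
  -- `B`, and the other three would be free.
  have hy : (a - 2, b) ∉ A := by
    intro hy
    have hyB := hl (a - 2) (by omega)
    have key : ∀ u, u ∈ A → square.graph.Adj (a - 1, b) u → u ∉ B := fun u h1 h2 h3 =>
      hyB (h.no_lock _ hx hx2 u h1 h2 h3 _ hy (square_adj_iff.2 (by omega)))
    have k1 : (a, b) ∉ A := fun h' => key _ h' (square_adj_iff.2 (by omega)) hab
    have k2 : (a - 1, b - σ) ∉ A := fun h' =>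
      key _ h' (square_adj_iff.2 (by omega)) (f1 h')
    rw [freeDeg_square hσ, sub_add_cancel, if_neg k1, if_neg hu, if_neg k2] at hx2'
    omega
  rw [freeDeg_square hσ, sub_add_cancel, sub_sub, one_add_one_eq_two, if_neg hy, if_neg hu] at hx2'
  have k1 : (a, b) ∈ A := by by_contra h'; simp [h'] at hx2'; omega
  have k2 : (a - 1, b - σ) ∈ A := by by_contra h'; simp [h'] at hx2'
  have hyG : (a - 2, b) ∈ G := h.mem_of_row _ _ (fun t ht => hl t (by omega))
    ⟨_, f1 k2, square_star (by omega)⟩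
  have hy2 := hcon' _ hyG
  have hy2' := hy2
  have e1 : a - 2 + 1 = a - 1 := by ring
  have e2 : a - 2 - 1 = a - 3 := by ring
  rw [freeDeg_square hσ, e1, e2, if_neg (h.notMem _ hx)] at hy2'
  have n1 : (a - 3, b) ∉ B := hl _ (by omega)
  have n2 : (a - 2, b + σ) ∉ B := hn _ (by omega)
  have f2 : (a - 2, b - σ) ∈ A → (a - 2, b - σ) ∈ B := fun h' => h.mem_of_star _ (f1 k2) _ h'
    (square_star (by omega))
  -- If it were occupied, it would be in `B`; `no_lock` would free the two neighbours outside `B`,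
  -- giving three free ones with `(a - 1, b)`.
  have n3 : (a - 2, b - σ) ∉ A := by
    intro h'
    have := h.no_lock _ hyG hy2 _ h' (square_adj_iff.2 (by omega)) (f2 h')
    have m1 : (a - 3, b) ∉ A := fun h' => n1 (this _ h' (square_adj_iff.2 (by omega)))
    have m2 : (a - 2, b + σ) ∉ A := fun h' => n2 (this _ h' (square_adj_iff.2 (by omega)))
    simp [m1, m2, h'] at hy2'
  have nx : ∀ u ∈ A, square.graph.Adj (a - 1, b) u → u = (a, b) ∨ u = (a - 1, b - σ) := by
    intro u huA hxu
    rcases square_adj_cases hσ hxu with rfl | rfl | rfl | rfl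
    · rw [sub_add_cancel]; exact Or.inl rfl
    · rw [sub_sub] at huA; exact absurd huA hy
    · exact absurd huA hu
    · exact Or.inr rfl
  have ny : ∀ u ∈ A, square.graph.Adj (a - 2, b) u → u = (a - 3, b) ∨ u = (a - 2, b + σ) := by
    intro u huA hyu
    rcases square_adj_cases hσ hyu with rfl | rfl | rfl | rfl
    · rw [e1] at huA; exact absurd huA (h.notMem _ hx)
    · rw [e2]; exact Or.inl rfl
    · exact Or.inr rfl
    · exact absurd huA n3
  refine h.no_double_lock _ hx _ hyG (square_adj_iff.2 (by omega)) hx2 hy2 ?_ ?_ ?_ ?_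
  · intro u huA hxu
    rcases nx u huA hxu with rfl | rfl
    exacts [hab, f1 k2]
  · intro u huA hxu v hvA hxv
    rcases nx u huA hxu with rfl | rfl <;> rcases nx v hvA hxv with rfl | rfl
    exacts [Or.inl rfl, Or.inr (square_star (by omega)), Or.inr (square_star (by omega)), Or.inl rfl]
  · intro u huA hxu
    rcases ny u huA hxu with rfl | rfl
    exacts [n1, n2]
  · intro u huA hxu v hvA hxv
    rcases ny u huA hxu with rfl | rfl <;> rcases ny v hvA hxv with rfl | rfl
    exacts [Or.inl rfl, Or.inr (square_star (by omega)), Or.inr (square_star (by omega)), Or.inl rfl]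

/-! ### Left ends of rows: the triangular lattice -/

theorem triangular_adj_iff {a b a' b' : ℤ} : triangular.graph.Adj (a, b) (a', b') ↔
    (a' = a + 1 ∧ b' = b) ∨ (a' = a ∧ b' = b + 1) ∨ (a' = a - 1 ∧ b' = b + 1) ∨
      (a' = a - 1 ∧ b' = b) ∨ (a' = a ∧ b' = b - 1) ∨ a' = a + 1 ∧ b' = b - 1 := by
  change (a', b') - (a, b) ∈ _ ↔ _
  simp only [Prod.mk_sub_mk, Set.mem_insert_iff, Set.mem_singleton_iff, Prod.mk.injEq]
  omega

theorem triangular_star {a b a' b' : ℤ} (h : (a' = a + 1 ∧ b' = b) ∨ (a' = a ∧ b' = b + 1) ∨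
    (a' = a - 1 ∧ b' = b + 1) ∨ (a' = a - 1 ∧ b' = b) ∨ (a' = a ∧ b' = b - 1) ∨
    a' = a + 1 ∧ b' = b - 1) : triangular.starGraph.Adj (a, b) (a', b') :=
  triangularMap.star_of_adj (triangular_adj_iff.2 h)

theorem freeDeg_triangular : triangular.freeDeg A (a, b) =
    (if (a + 1, b) ∈ A then 0 else 1) + (if (a, b + 1) ∈ A then 0 else 1) +
      (if (a - 1, b + 1) ∈ A then 0 else 1) + (if (a - 1, b) ∈ A then 0 else 1) +
      (if (a, b - 1) ∈ A then 0 else 1) + if (a + 1, b - 1) ∈ A then 0 else 1 := by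
  rw [freeDeg_eq triangularMap]
  change (∑ i : Fin 6, if triNb (a, b) i ∈ A then 0 else 1) = _
  rw [Fin.sum_univ_six]
  rfl

/-- Here `(a - 1, b)` alone suffices. Its common neighbours with `(a, b)` are `(a - 1, b + 1)` and
`(a, b - 1)`, whence `t < a` above but `t ≤ a` below. The case distinction is needed because `(a,
b)` may be a filled gate and so not in `A`. -/
theorem triangular_row (h : triangular.Unlocked A B G) (hab : (a, b) ∈ B)
    (hl : ∀ t < a, (t, b) ∉ B)
    (hn : (∀ t < a, (t, b + 1) ∉ B) ∨ (∀ t ≤ a, (t, b - 1) ∉ B)) :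
    ∃ v ∈ G, triangular.freeDeg A v ≠ 2 ∧ v.2 = b := by
  by_contra hcon
  have hx : (a - 1, b) ∈ G := h.mem_of_row _ _ (fun t ht => hl t (by omega))
    ⟨_, hab, triangular_star (by omega)⟩
  have hx2 : triangular.freeDeg A (a - 1, b) = 2 := by
    by_contra h'; exact hcon ⟨_, hx, h', rfl⟩
  have hx2' := hx2
  have e2 : a - 1 - 1 = a - 2 := by ring
  rw [freeDeg_triangular, sub_add_cancel, e2] at hx2'
  have n1 : (a - 2, b) ∉ B := hl _ (by omega)
  have key : ∀ p q p' q', (p, q) ∈ A → triangular.graph.Adj (a - 1, b) (p, q) → (p, q) ∈ B →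
      (p', q') ∈ A → triangular.graph.Adj (a - 1, b) (p', q') → (p', q') ∈ B :=
    fun p q p' q' h1 h2 h3 h4 h5 => h.no_lock _ hx hx2 _ h1 h2 h3 _ h4 h5
  rcases hn with hn | hn
  · have hu : (a - 1, b + 1) ∉ A := h.notMem _ (h.mem_of_row _ _ (fun t ht => hn t (by omega))
      ⟨_, hab, triangular_star (by omega)⟩)
    have n2 : (a - 2, b + 1) ∉ B := hn _ (by omega)
    by_cases k : (a, b) ∈ A
    · have m1 : (a - 2, b) ∉ A := fun h' => n1 (key _ _ _ _ k (triangular_adj_iff.2 (by omega)) hab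
        h' (triangular_adj_iff.2 (by omega)))
      have m2 : (a - 2, b + 1) ∉ A := fun h' => n2 (key _ _ _ _ k
        (triangular_adj_iff.2 (by omega)) hab h' (triangular_adj_iff.2 (by omega)))
      rw [if_pos k, if_neg hu, if_neg m1, if_neg m2] at hx2'
      omega
    · rw [if_neg k, if_neg hu] at hx2'
      have m1 : (a - 2, b) ∈ A := by by_contra h'; simp [h'] at hx2'; omega
      have m2 : (a, b - 1) ∈ A := by by_contra h'; simp [h'] at hx2'; omega
      exact n1 (key _ _ _ _ m2 (triangular_adj_iff.2 (by omega))
        (h.mem_of_star _ hab _ m2 (triangular_star (by omega))) m1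
        (triangular_adj_iff.2 (by omega)))
  · have hu : (a, b - 1) ∉ A := h.notMem _ (h.mem_of_row _ _ (fun t ht => hn t (by omega))
      ⟨_, hab, triangular_star (by omega)⟩)
    have n2 : (a - 1, b - 1) ∉ B := hn _ (by omega)
    by_cases k : (a, b) ∈ A
    · have m1 : (a - 2, b) ∉ A := fun h' => n1 (key _ _ _ _ k (triangular_adj_iff.2 (by omega)) hab
        h' (triangular_adj_iff.2 (by omega)))
      have m2 : (a - 1, b - 1) ∉ A := fun h' => n2 (key _ _ _ _ k
        (triangular_adj_iff.2 (by omega)) hab h' (triangular_adj_iff.2 (by omega)))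
      rw [if_pos k, if_neg hu, if_neg m1, if_neg m2] at hx2'
      omega
    · rw [if_neg k, if_neg hu] at hx2'
      have m1 : (a - 2, b) ∈ A := by by_contra h'; simp [h'] at hx2'; omega
      have m2 : (a - 1, b + 1) ∈ A := by by_contra h'; simp [h'] at hx2'; omega
      exact n1 (key _ _ _ _ m2 (triangular_adj_iff.2 (by omega))
        (h.mem_of_star _ hab _ m2 (triangular_star (by omega))) m1
        (triangular_adj_iff.2 (by omega)))

/-! ### Left ends of rows: the hexagonal lattice -/

theorem hexagonal_adj_iff {δ a' b' : ℤ}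
    (hδ : (δ = 1 ∧ (a + b) % 2 = 0) ∨ (δ = -1 ∧ (a + b) % 2 = 1)) :
    hexagonal.graph.Adj (a, b) (a', b') ↔
      (a' = a + 1 ∧ b' = b) ∨ (a' = a - 1 ∧ b' = b) ∨ a' = a ∧ b' = b + δ := by
  simp only [graph, hexagonalGraph, Int.even_iff, abs_eq (zero_le_one' ℤ)]
  omega

theorem hexagonal_star (c d : ℤ) {a b a' b' : ℤ} (h : (a ≠ a' ∨ b ≠ b') ∧ (c + d) % 2 = 0 ∧ c ≤ a ∧
    a ≤ c + 2 ∧ c ≤ a' ∧ a' ≤ c + 2 ∧ d ≤ b ∧ b ≤ d + 1 ∧ d ≤ b' ∧ b' ≤ d + 1) :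
    hexagonal.starGraph.Adj (a, b) (a', b') := by
  refine ⟨fun h' => ?_, _, ⟨c, d, Int.even_iff.2 h.2.1, rfl⟩, ?_⟩
  · rw [Prod.mk.injEq] at h'
    omega
  simp only [Set.mem_insert_iff, Set.mem_singleton_iff, Prod.mk.injEq]
  omega

theorem freeDeg_hexagonal {δ : ℤ}
    (hδ : (δ = 1 ∧ (a + b) % 2 = 0) ∨ (δ = -1 ∧ (a + b) % 2 = 1)) :
    hexagonal.freeDeg A (a, b) = (if (a + 1, b) ∈ A then 0 else 1) +
      (if (a - 1, b) ∈ A then 0 else 1) + if (a, b + δ) ∈ A then 0 else 1 := by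
  rw [freeDeg_eq hexagonalMap]
  change (∑ i : Fin 3, if hexNb (a, b) i ∈ A then 0 else 1) = _
  rw [Fin.sum_univ_three]
  rcases hδ with ⟨rfl, h⟩ | ⟨rfl, h⟩
  · simp [hexNb, Int.even_iff, h]; ring
  · simp [hexNb, Int.even_iff, h, sub_eq_add_neg]; ring

/-- Both `(a - 1, b)` and `(a - 2, b)` share a hexagon with `(a, b)`. With two free neighbours each,
one of the pairs of adjacent vertices among `(a - 1, b)`, `(a - 2, b)`, `(a - 3, b)` is a double
lock. -/
theorem hexagonal_row (h : hexagonal.Unlocked A B G) (hσ : σ = 1 ∨ σ = -1) (hab : (a, b) ∈ B)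
    (hl : ∀ t < a, (t, b) ∉ B) (hn : ∀ t < a, (t, b + σ) ∉ B) :
    ∃ v ∈ G, hexagonal.freeDeg A v ≠ 2 ∧ v.2 = b := by
  by_contra hcon
  have hcon' : ∀ t, (t, b) ∈ G → hexagonal.freeDeg A (t, b) = 2 := fun t ht => by
    by_contra h'; exact hcon ⟨_, ht, h', rfl⟩
  obtain ⟨ε, hε⟩ : ∃ ε : ℤ, (ε = 1 ∧ (a + b) % 2 = 0) ∨ (ε = -1 ∧ (a + b) % 2 = 1) := by
    rcases Int.emod_two_eq_zero_or_one (a + b) with h | h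
    exacts [⟨1, Or.inl ⟨rfl, h⟩⟩, ⟨-1, Or.inr ⟨rfl, h⟩⟩]
  have adjx : ∀ {p q}, hexagonal.graph.Adj (a - 1, b) (p, q) ↔
      (p = a ∧ q = b) ∨ (p = a - 2 ∧ q = b) ∨ p = a - 1 ∧ q = b - ε := fun {p q} => by
    rw [hexagonal_adj_iff (δ := -ε) (by omega)]; omega
  have adjy : ∀ {p q}, hexagonal.graph.Adj (a - 2, b) (p, q) ↔
      (p = a - 1 ∧ q = b) ∨ (p = a - 3 ∧ q = b) ∨ p = a - 2 ∧ q = b + ε := fun {p q} => by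
    rw [hexagonal_adj_iff (δ := ε) (by omega)]; omega
  have adjz : ∀ {p q}, hexagonal.graph.Adj (a - 3, b) (p, q) ↔
      (p = a - 2 ∧ q = b) ∨ (p = a - 4 ∧ q = b) ∨ p = a - 3 ∧ q = b - ε := fun {p q} => by
    rw [hexagonal_adj_iff (δ := -ε) (by omega)]; omega
  have hx : (a - 1, b) ∈ G := h.mem_of_row _ _ (fun t ht => hl t (by omega))
    ⟨_, hab, hexagonal_star (a - 2) (b + (ε - 1) / 2) (by omega)⟩
  have hy : (a - 2, b) ∈ G := h.mem_of_row _ _ (fun t ht => hl t (by omega))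
    ⟨_, hab, hexagonal_star (a - 2) (b + (ε - 1) / 2) (by omega)⟩
  have hxA := h.notMem _ hx
  have hyA := h.notMem _ hy
  have hx2 := hcon' _ hx
  have hy2 := hcon' _ hy
  have hx2' := hx2
  have hy2' := hy2
  rw [freeDeg_hexagonal (δ := -ε) (by omega), sub_add_cancel, show a - 1 - 1 = a - 2 by ring,
    if_neg hyA] at hx2'
  rw [freeDeg_hexagonal (δ := ε) (by omega), show a - 2 + 1 = a - 1 by ring,
    show a - 2 - 1 = a - 3 by ring, if_neg hxA] at hy2'
  rw [← sub_eq_add_neg] at hx2'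
  have f1 : (a - 1, b - ε) ∈ A → (a - 1, b - ε) ∈ B := fun h' => h.mem_of_star _ hab _ h'
    (hexagonal_star (a - 1) (b - 1 - (ε - 1) / 2) (by omega))
  have f2 : (a - 2, b + ε) ∈ A → (a - 2, b + ε) ∈ B := fun h' => h.mem_of_star _ hab _ h'
    (hexagonal_star (a - 2) (b + (ε - 1) / 2) (by omega))
  have nx : ∀ u ∈ A, hexagonal.graph.Adj (a - 1, b) u → u = (a, b) ∨ u = (a - 1, b - ε) := by
    rintro ⟨p, q⟩ huA hxu
    rcases adjx.1 hxu with ⟨rfl, rfl⟩ | ⟨rfl, rfl⟩ | ⟨rfl, rfl⟩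
    exacts [Or.inl rfl, absurd huA hyA, Or.inr rfl]
  have hxB : ∀ u ∈ A, hexagonal.graph.Adj (a - 1, b) u → u ∈ B := by
    intro u huA hxu
    rcases nx u huA hxu with rfl | rfl
    exacts [hab, f1 huA]
  have hxc : hexagonal.Clumped A (a - 1, b) := by
    intro u huA hxu v hvA hxv
    rcases nx u huA hxu with rfl | rfl <;> rcases nx v hvA hxv with rfl | rfl
    · exact Or.inl rfl
    · exact Or.inr (hexagonal_star (a - 1) (b - 1 - (ε - 1) / 2) (by omega))
    · exact Or.inr (hexagonal_star (a - 1) (b - 1 - (ε - 1) / 2) (by omega))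
    · exact Or.inl rfl
  have ny : ∀ u ∈ A, hexagonal.graph.Adj (a - 2, b) u → u = (a - 3, b) ∨ u = (a - 2, b + ε) := by
    rintro ⟨p, q⟩ huA hxu
    rcases adjy.1 hxu with ⟨rfl, rfl⟩ | ⟨rfl, rfl⟩ | ⟨rfl, rfl⟩
    exacts [absurd huA hxA, Or.inl rfl, Or.inr rfl]
  -- If it were occupied, it would be the only occupied neighbour of `(a - 2, b)` and outside `B`: a
  -- double lock with `(a - 1, b)`.
  have hz : (a - 3, b) ∉ A := by
    intro hz
    have k : (a - 2, b + ε) ∉ A := by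
      intro h'; rw [if_pos hz, if_pos h'] at hy2'; omega
    have ny' : ∀ u ∈ A, hexagonal.graph.Adj (a - 2, b) u → u = (a - 3, b) := fun u huA hyu =>
      (ny u huA hyu).resolve_right fun e => k (e ▸ huA)
    refine h.no_double_lock _ hx _ hy (adjx.2 (by omega)) hx2 hy2 hxB hxc ?_ ?_
    · intro u huA hyu
      rw [ny' u huA hyu]
      exact hl _ (by omega)
    · intro u huA hyu v hvA hyv
      exact Or.inl ((ny' u huA hyu).trans (ny' v hvA hyv).symm)
  have k : (a - 2, b + ε) ∈ A := by
    by_contra h'; rw [if_neg hz, if_neg h'] at hy2'; omega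
  -- The occupied neighbour `(a - 2, b + ε)` is in `B`, so the row known to be empty on the left is
  -- the other one. This puts the occupied neighbour of `(a - 3, b)` outside `B`, for the second
  -- double lock.
  have hσε : σ = -ε := by
    by_contra h'
    have : σ = ε := by omega
    exact hn _ (by omega) (this ▸ f2 k)
  have hzG : (a - 3, b) ∈ G := h.mem_of_row _ _ (fun t ht => hl t (by omega))
    ⟨_, f2 k, hexagonal_star (a - 4) (b + (ε - 1) / 2) (by omega)⟩
  have hz2 := hcon' _ hzG
  have hz2' := hz2
  rw [freeDeg_hexagonal (δ := -ε) (by omega), show a - 3 + 1 = a - 2 by ring,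
    show a - 3 - 1 = a - 4 by ring, if_neg hyA, ← sub_eq_add_neg] at hz2'
  have nz : ∀ u ∈ A, hexagonal.graph.Adj (a - 3, b) u → u = (a - 4, b) ∨ u = (a - 3, b - ε) := by
    rintro ⟨p, q⟩ huA hxu
    rcases adjz.1 hxu with ⟨rfl, rfl⟩ | ⟨rfl, rfl⟩ | ⟨rfl, rfl⟩
    exacts [absurd huA hyA, Or.inl rfl, Or.inr rfl]
  have ny' : ∀ u ∈ A, hexagonal.graph.Adj (a - 2, b) u → u = (a - 2, b + ε) := fun u huA hyu =>
    (ny u huA hyu).resolve_left fun e => hz (e ▸ huA)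
  refine h.no_double_lock _ hy _ hzG (adjy.2 (by omega)) hy2 hz2 ?_ ?_ ?_ ?_
  · intro u huA hyu
    rw [ny' u huA hyu]
    exact f2 k
  · intro u huA hyu v hvA hyv
    exact Or.inl ((ny' u huA hyu).trans (ny' v hvA hyv).symm)
  · intro u huA hzu
    rcases nz u huA hzu with rfl | rfl
    · exact hl _ (by omega)
    · rw [sub_eq_add_neg b, ← hσε]
      exact hn _ (by omega)
  · intro u huA hzu v hvA hzv
    have : ¬ ((a - 4, b) ∈ A ∧ (a - 3, b - ε) ∈ A) := by
      rintro ⟨h1, h2⟩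
      rw [if_pos h1, if_pos h2] at hz2'
      omega
    rcases nz u huA hzu with rfl | rfl <;> rcases nz v hvA hzv with rfl | rfl
    exacts [Or.inl rfl, absurd ⟨huA, hvA⟩ this, absurd ⟨hvA, huA⟩ this, Or.inl rfl]

end Row

end RegularLattice

/-! ### Counting vertices with an unusual number of free neighbours -/

namespace RegularLattice

open Finset

open scoped Classical

variable {L : RegularLattice} {A G : Set Vertex} {B : Finset Vertex}

theorem Unlocked.row (h : L.Unlocked A B G) {a b : ℤ} (hab : (a, b) ∈ B)
    (hl : ∀ t < a, (t, b) ∉ B)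
    (hn : (∀ t < a, (t, b + 1) ∉ B) ∨ (∀ t ≤ a, (t, b - 1) ∉ B)) :
    ∃ v ∈ G, L.freeDeg A v ≠ 2 ∧ v.2 = b := by
  cases L
  · exact hn.elim (fun hn => square_row h (Or.inl rfl) hab hl hn) fun hn =>
      square_row h (Or.inr rfl) hab hl fun t ht => hn t ht.le
  · exact triangular_row h hab hl hn
  · exact hn.elim (fun hn => hexagonal_row h (Or.inl rfl) hab hl hn) fun hn =>
      hexagonal_row h (Or.inr rfl) hab hl fun t ht => hn t ht.le

theorem exists_leftmost {b : ℤ} (hb : b ∈ B.image Prod.snd) :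
    ∃ a, (a, b) ∈ B ∧ ∀ t < a, (t, b) ∉ B := by
  obtain ⟨⟨a₀, b⟩, hv, rfl⟩ := mem_image.1 hb
  obtain ⟨⟨a, b'⟩, ha, hmin⟩ := exists_min_image (B.filter fun v => v.2 = b) Prod.fst
    ⟨(a₀, b), mem_filter.2 ⟨hv, rfl⟩⟩
  obtain ⟨haB, hb'⟩ := mem_filter.1 ha
  obtain rfl : b' = b := hb'
  exact ⟨a, haB, fun t ht h => absurd (hmin (t, b') (mem_filter.2 ⟨h, rfl⟩)) (not_le.2 ht)⟩

/-- There are at least half as many vertices with an unusual number of free neighbours as there are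
rows. -/
theorem Unlocked.card_rows_le (h : L.Unlocked A B G) {S : Finset Vertex}
    (hS : ∀ v ∈ G, L.freeDeg A v ≠ 2 → v ∈ S) : (B.image Prod.snd).card ≤ 2 * S.card := by
  set R := B.image Prod.snd
  have hR : ∀ {a b}, (a, b) ∈ B → b ∈ R := fun h => mem_image.2 ⟨_, h, rfl⟩
  -- A row without a vertex of `S` is dented: the row above extends strictly further to the left,
  -- the row below at least as far. Two consecutive rows cannot both be dented.
  have hsub : (R \ S.image Prod.snd).image (· + 1) ⊆ S.image Prod.snd := by
    intro b' hb'
    obtain ⟨b, hb, rfl⟩ := mem_image.1 hb'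
    obtain ⟨hbR, hbS⟩ := mem_sdiff.1 hb
    have dent : ∀ b ∉ S.image Prod.snd, ∀ a, (a, b) ∈ B → (∀ t < a, (t, b) ∉ B) →
        (∃ t < a, (t, b + 1) ∈ B) ∧ ∃ t ≤ a, (t, b - 1) ∈ B := by
      intro b hb a hab hl
      by_contra hcon
      rw [not_and_or] at hcon
      push Not at hcon
      obtain ⟨v, hv, hv2, rfl⟩ := h.row hab hl hcon
      exact hb (mem_image_of_mem _ (hS v hv hv2))
    obtain ⟨a, hab, hl⟩ := exists_leftmost hbR
    obtain ⟨⟨t, ht, htB⟩, -⟩ := dent b hbS a hab hl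
    by_contra hcon
    obtain ⟨a', hab', hl'⟩ := exists_leftmost (hR htB)
    obtain ⟨-, t', ht', htB'⟩ := dent _ hcon a' hab' hl'
    rw [add_sub_cancel_right] at htB'
    refine hl t' ?_ htB'
    by_contra hlt
    exact hl' t (by omega) htB
  have h1 := card_le_card hsub
  rw [card_image_of_injective _ (add_left_injective 1)] at h1
  have h2 : (S.image Prod.snd).card ≤ S.card := card_image_le
  have h3 := card_le_card_sdiff_add_card (s := R) (t := S.image Prod.snd)
  omega

/-! ### A second direction of rows -/

/-- A reflection of the lattice that exchanges two directions of rows. -/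
def flip : RegularLattice → Vertex → Vertex
  | hexagonal => fun v => ((v.1 - v.2) / 2 + 2 * v.2, (v.1 - v.2 + 1) / 2)
  | _ => Prod.swap

theorem flip_flip (v : Vertex) : L.flip (L.flip v) = v := by
  cases L
  · rfl
  · rfl
  · simp only [flip, Prod.ext_iff]; omega

theorem flip_adj {u v : Vertex} (h : L.graph.Adj u v) : L.graph.Adj (L.flip u) (L.flip v) := by
  obtain ⟨a, b⟩ := u
  obtain ⟨a', b'⟩ := v
  cases L
  · change square.graph.Adj (b, a) (b', a')
    rw [square_adj_iff] at h ⊢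
    omega
  · change triangular.graph.Adj (b, a) (b', a')
    rw [triangular_adj_iff] at h ⊢
    omega
  · change hexagonal.graph.Adj (_, _) (_, _)
    rcases Int.emod_two_eq_zero_or_one (a + b) with hp | hp
    · rw [hexagonal_adj_iff (Or.inl ⟨rfl, hp⟩)] at h
      rw [hexagonal_adj_iff (Or.inl ⟨rfl, by omega⟩)]
      omega
    · rw [hexagonal_adj_iff (Or.inr ⟨rfl, hp⟩)] at h
      rw [hexagonal_adj_iff (Or.inr ⟨rfl, by omega⟩)]
      omega

theorem flip_star {u v : Vertex} (h : L.starGraph.Adj u v) :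
    L.starGraph.Adj (L.flip u) (L.flip v) := by
  refine ⟨fun e => h.1 (by rw [← flip_flip (L := L) u, e, flip_flip]), ?_⟩
  obtain ⟨-, F, hF, hu, hv⟩ := h
  suffices ∃ F', L.IsFace F' ∧ ∀ w ∈ F, L.flip w ∈ F' from
    this.imp fun F' h => ⟨h.1, h.2 u hu, h.2 v hv⟩
  clear hu hv
  cases L
  · obtain ⟨a, b, rfl⟩ := hF
    refine ⟨_, ⟨b, a, rfl⟩, ?_⟩
    rintro w (rfl | rfl | rfl | rfl) <;> simp [flip]
  · obtain ⟨a, b, rfl | rfl⟩ := hF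
    · refine ⟨_, ⟨b, a, Or.inl rfl⟩, ?_⟩
      rintro w (rfl | rfl | rfl) <;> simp [flip]
    · refine ⟨_, ⟨b, a, Or.inr rfl⟩, ?_⟩
      rintro w (rfl | rfl | rfl) <;> simp [flip]
  · obtain ⟨a, b, hab, rfl⟩ := hF
    obtain ⟨m, rfl⟩ : ∃ m, a = b + 2 * m := ⟨(a - b) / 2, by rw [Int.even_iff] at hab; omega⟩
    refine ⟨_, ⟨m + 2 * b, m, ⟨m + b, by ring⟩, rfl⟩, ?_⟩
    rintro w (rfl | rfl | rfl | rfl | rfl | rfl) <;>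
      simp only [flip, Set.mem_insert_iff, Set.mem_singleton_iff, Prod.mk.injEq] <;> omega

theorem flip_adj_iff {u v : Vertex} : L.graph.Adj (L.flip u) (L.flip v) ↔ L.graph.Adj u v :=
  ⟨fun h => by simpa only [flip_flip] using flip_adj h, flip_adj⟩

theorem flip_star_iff {u v : Vertex} :
    L.starGraph.Adj (L.flip u) (L.flip v) ↔ L.starGraph.Adj u v :=
  ⟨fun h => by simpa only [flip_flip] using flip_star h, flip_star⟩

theorem flip_injective : Function.Injective L.flip := fun u v h => by
  rw [← flip_flip (L := L) u, h, flip_flip]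

theorem flip_mem_exterior {S : Set Vertex} {v : Vertex} (h : v ∈ L.exterior (L.flip ⁻¹' S)) :
    L.flip v ∈ L.exterior S := by
  rw [mem_exterior_iff] at h ⊢
  refine ⟨h.1, (h.2.image (flip_injective (L := L)).injOn).mono ?_⟩
  rintro _ ⟨z, hz, rfl⟩
  exact connectedIn_iff.2 ⟨h.1, (connectedIn_iff.1 hz).2.lift _ fun a b hab =>
    ⟨hab.1, hab.2.1, flip_adj hab.2.2⟩⟩

theorem freeDeg_flip (v : Vertex) : L.freeDeg (L.flip ⁻¹' A) v = L.freeDeg A (L.flip v) := by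
  rw [freeDeg, freeDeg, ← Set.ncard_image_of_injective _ (flip_injective (L := L))]
  congr 1
  ext w
  constructor
  · rintro ⟨z, hz, rfl⟩
    exact ⟨flip_adj hz.1, hz.2⟩
  · rintro ⟨h1, h2⟩
    refine ⟨L.flip w, ⟨?_, ?_⟩, flip_flip w⟩
    · exact flip_adj_iff.1 (by rwa [flip_flip])
    · rwa [Set.mem_preimage, flip_flip]

theorem Clumped.flip {v : Vertex} (h : L.Clumped (L.flip ⁻¹' A) v) : L.Clumped A (L.flip v) := by
  intro u hu hvu w hw hvw
  have := h (L.flip u) (by rwa [Set.mem_preimage, flip_flip])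
    (flip_adj_iff.1 (by rwa [flip_flip])) (L.flip w) (by rwa [Set.mem_preimage, flip_flip])
    (flip_adj_iff.1 (by rwa [flip_flip]))
  rwa [flip_injective.eq_iff, flip_star_iff] at this

theorem mem_image_flip {v : Vertex} : v ∈ B.image L.flip ↔ L.flip v ∈ B := by
  rw [mem_image]
  constructor
  · rintro ⟨u, hu, rfl⟩
    rwa [flip_flip]
  · exact fun h => ⟨_, h, flip_flip v⟩

/-- Only `mem_of_row` is not a mere transport, as it refers to horizontal rays; it is proved afresh,
`flip` preserving exteriors. -/
theorem Unlocked.flip (h : L.Unlocked A B (L.exteriorStarBoundary (B : Set Vertex))) :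
    L.Unlocked (L.flip ⁻¹' A) (B.image L.flip)
      (L.flip ⁻¹' L.exteriorStarBoundary (B : Set Vertex)) where
  mem_of_star u hu v hv huv := mem_image_flip.2
    (h.mem_of_star _ (mem_image_flip.1 hu) _ hv (flip_star huv))
  notMem v hv := h.notMem _ hv
  mem_of_row a b hrow := by
    rintro ⟨u, hu, huv⟩
    refine ⟨flip_mem_exterior (mem_exterior_of_row fun t ht h' => hrow t ht ?_),
      _, mem_image_flip.1 hu, flip_star huv⟩
    exact mem_image_flip.2 h'
  no_lock x hx h2 u hu hxu huB v hv hxv := mem_image_flip.2 (h.no_lock _ hx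
    (by rwa [← freeDeg_flip]) _ hu (flip_adj hxu) (mem_image_flip.1 huB) _ hv (flip_adj hxv))
  no_double_lock x hx y hy hxy hx2 hy2 hxB hxc hyB hyc := by
    refine h.no_double_lock _ hx _ hy (flip_adj hxy) (by rwa [← freeDeg_flip])
      (by rwa [← freeDeg_flip]) (fun u hu hxu => ?_) hxc.flip (fun u hu hyu => ?_) hyc.flip
    · have := hxB (L.flip u) (by rwa [Set.mem_preimage, flip_flip])
        (flip_adj_iff.1 (by rwa [flip_flip]))
      rwa [mem_image_flip, flip_flip] at this
    · have := hyB (L.flip u) (by rwa [Set.mem_preimage, flip_flip])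
        (flip_adj_iff.1 (by rwa [flip_flip]))
      rwa [mem_image_flip, flip_flip] at this

/-- Two rows of different directions meet in at most two vertices. -/
theorem card_le_rows : B.card ≤
    2 * ((B.image Prod.snd).card * ((B.image L.flip).image Prod.snd).card) := by
  rw [← card_product]
  have hmaps : ∀ v ∈ B, ((v.2, (L.flip v).2) : ℤ × ℤ) ∈
      B.image Prod.snd ×ˢ (B.image L.flip).image Prod.snd := fun v hv =>
    mem_product.2 ⟨mem_image.2 ⟨v, hv, rfl⟩, mem_image.2 ⟨_, mem_image_of_mem _ hv, rfl⟩⟩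
  refine card_le_mul_card_image_of_maps_to hmaps 2 ?_
  rintro ⟨b, s⟩ -
  have hsub : (B.filter fun v => (v.2, (L.flip v).2) = (b, s)) ⊆
      match L with
      | hexagonal => {(b + 2 * s, b), (b + 2 * s - 1, b)}
      | _ => {(s, b)} := by
    rintro ⟨a, b'⟩ hv
    have hv := (mem_filter.1 hv).2
    cases L <;> simp [RegularLattice.flip] at hv ⊢ <;> omega
  refine (card_le_card hsub).trans ?_
  cases L
  · simp
  · simp
  · exact card_le_two

/-- There are at most `2 * S.card` rows in each direction, and each pair of rows accounts for at
most two vertices. -/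
theorem Unlocked.card_le (h : L.Unlocked A B (L.exteriorStarBoundary (B : Set Vertex)))
    {S : Finset Vertex}
    (hS : ∀ v ∈ L.exteriorStarBoundary (B : Set Vertex), L.freeDeg A v ≠ 2 → v ∈ S) :
    B.card ≤ 8 * S.card ^ 2 := by
  have h1 := h.card_rows_le hS
  have h2 := h.flip.card_rows_le (S := S.image L.flip) fun v hv h2 => by
    rw [mem_image_flip]
    exact hS _ hv (by rwa [← freeDeg_flip])
  have h3 : (S.image L.flip).card ≤ S.card := card_image_le
  have h4 := card_le_rows (L := L) (B := B)
  calc B.card ≤ _ := h4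
    _ ≤ 2 * ((2 * S.card) * (2 * S.card)) := by
      gcongr
      exact h2.trans (by omega)
    _ = 8 * S.card ^ 2 := by ring

end RegularLattice

/-! ### Short walks in the support of a circulation -/

namespace RegularLattice

open Finset

open scoped Classical

section Circulation

variable {α : Type*} {G : SimpleGraph α} {w : α → α → ℕ}

/-- The total weight of the edges of a walk. -/
def walkWeight (w : α → α → ℕ) {x y : α} (p : G.Walk x y) : ℕ :=
  (p.darts.map fun d => w d.fst d.snd).sum

theorem walkWeight_nil {x : α} : walkWeight w (.nil : G.Walk x x) = 0 := rfl

theorem walkWeight_cons {x y z : α} (h : G.Adj x y) (p : G.Walk y z) :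
    walkWeight w (p.cons h) = w x y + walkWeight w p := by
  simp [walkWeight]

theorem walkWeight_concat {x y z : α} (p : G.Walk x y) (h : G.Adj y z) :
    walkWeight w (p.concat h) = walkWeight w p + w y z := by
  simp [walkWeight, SimpleGraph.Walk.darts_concat]

theorem walkWeight_bypass_le [DecidableEq α] {x y : α} (p : G.Walk x y) :
    walkWeight w p.bypass ≤ walkWeight w p := by
  exact (p.darts_bypass_sublist_darts.map _).sum_le_sum fun _ _ => Nat.zero_le _

/-- Counts the level sets crossed by an edge whose ends have distances `a` and `b`. -/
theorem sum_separated_le (m a b : ℕ) :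
    ∑ t ∈ range m, (if (a ≤ t ↔ b ≤ t) then (0 : ℤ) else 1) ≤ |(a : ℤ) - b| := by
  have e : ∀ t, (if (a ≤ t ↔ b ≤ t) then (0 : ℤ) else 1) ≤ if t ∈ Ico (min a b) (max a b)
      then 1 else 0 := by
    intro t
    simp only [mem_Ico]
    split_ifs <;> omega
  refine (sum_le_sum fun t _ => e t).trans ?_
  rw [sum_boole]
  refine (Nat.cast_le.2 (card_le_card (t := Ico (min a b) (max a b)) fun t ht =>
    (mem_filter.1 ht).2)).trans ?_
  rw [Nat.card_Ico]
  rcases abs_cases ((a : ℤ) - b) with h | h <;> omega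

/-- In the support of a circulation, any two points are joined by a walk of at most half of the
total weight. -/
theorem exists_walk_le {T : Finset α} {J : α → α → ℤ} (hJ0 : ∀ u v, 0 ≤ J u v)
    (hJ : ∀ u ∈ T, ∑ v ∈ T, J u v = ∑ v ∈ T, J v u) (hadj : ∀ u v, J u v ≠ 0 → G.Adj u v)
    (hw : ∀ u v, w u v = w v u) {x : α} (hx : x ∈ T)
    (hconn : ∀ v ∈ T, Relation.ReflTransGen
      (fun a b => (J a b ≠ 0 ∨ J b a ≠ 0) ∧ a ∈ T ∧ b ∈ T) x v) {y : α} (hy : y ∈ T) :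
    ∃ p : G.Walk x y, (∀ z ∈ p.support, z ∈ T) ∧
      2 * (walkWeight w p : ℤ) ≤ ∑ u ∈ T, ∑ v ∈ T, J u v * w u v := by
  have hreach : ∀ v ∈ T, ∃ n, ∃ p : G.Walk x v, (∀ z ∈ p.support, z ∈ T) ∧ walkWeight w p = n := by
    intro v hv
    have := hconn v hv
    clear hv
    induction this with
    | refl => exact ⟨_, .nil, by simpa using hx, rfl⟩
    | @tail a b _ hab ih =>
      obtain ⟨n, p, hp, -⟩ := ih
      have h' : G.Adj a b := hab.1.elim (hadj _ _) fun h => (hadj _ _ h).symm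
      refine ⟨_, p.concat h', fun z hz => ?_, rfl⟩
      rw [SimpleGraph.Walk.support_concat, List.mem_append,
        List.mem_singleton] at hz
      rcases hz with hz | rfl
      exacts [hp z hz, hab.2.2]
  let d : α → ℕ := fun v => sInf {n | ∃ p : G.Walk x v, (∀ z ∈ p.support, z ∈ T) ∧
    walkWeight w p = n}
  have hd : ∀ v ∈ T, ∃ p : G.Walk x v, (∀ z ∈ p.support, z ∈ T) ∧ walkWeight w p = d v :=
    fun v hv => Nat.sInf_mem (hreach v hv)
  have hd_le : ∀ a ∈ T, ∀ b ∈ T, G.Adj a b → d b ≤ d a + w a b := by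
    intro a ha b hb hab
    obtain ⟨p, hp, hpd⟩ := hd a ha
    refine Nat.sInf_le ⟨p.concat hab, fun z hz => ?_, by rw [walkWeight_concat, hpd]⟩
    rw [SimpleGraph.Walk.support_concat, List.mem_append,
      List.mem_singleton] at hz
    rcases hz with hz | rfl
    exacts [hp z hz, hb]
  obtain ⟨p, hp, hpd⟩ := hd y hy
  refine ⟨p, hp, ?_⟩
  rw [hpd]
  have hdx : d x = 0 := Nat.le_zero.1 (Nat.sInf_le ⟨.nil, by simpa using hx, rfl⟩)
  -- `d` is the weighted distance from `x` within `T`. The set `d ≤ t` separates `x` from `y`; some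
  -- flow crosses its boundary as the support is connected, and as much flows back, which gives 2.
  -- An edge crosses at most `w` levels, so summing over `t` bounds `2 * d y`.
  have hlevel : ∀ t ∈ range (d y), 2 ≤ ∑ u ∈ T, ∑ v ∈ T,
      J u v * (if (d u ≤ t ↔ d v ≤ t) then (0 : ℤ) else 1) := by
    intro t ht
    rw [mem_range] at ht
    set S := T.filter fun v => d v ≤ t with hS
    have hcut := cut_balanced (J := J) (filter_subset _ _ : S ⊆ T) (fun u hu => hJ u (mem_filter.1 hu).1)
    have hsplit : ∑ u ∈ T, ∑ v ∈ T, J u v * (if (d u ≤ t ↔ d v ≤ t) then (0 : ℤ) else 1) =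
        ∑ u ∈ S, ∑ v ∈ T \ S, J u v + ∑ u ∈ S, ∑ v ∈ T \ S, J v u := by
      have hST : S ⊆ T := filter_subset _ _
      have m1 : ∀ u ∈ S, d u ≤ t := fun u hu => (mem_filter.1 hu).2
      have m2 : ∀ u ∈ T \ S, ¬ d u ≤ t := fun u hu h' =>
        (mem_sdiff.1 hu).2 (mem_filter.2 ⟨(mem_sdiff.1 hu).1, h'⟩)
      rw [← sum_sdiff hST, add_comm, sum_comm (s := S) (t := T \ S) (f := fun u v => J v u)]
      congr 1
      · refine sum_congr rfl fun u hu => ?_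
        rw [← sum_sdiff hST, add_comm, sum_eq_zero, zero_add]
        · exact sum_congr rfl fun v hv => by simp [m1 u hu, m2 v hv]
        · exact fun v hv => by simp [m1 u hu, m1 v hv]
      · refine sum_congr rfl fun u hu => ?_
        rw [← sum_sdiff hST, sum_eq_zero, zero_add]
        · exact sum_congr rfl fun v hv => by simp [m2 u hu, m1 v hv]
        · exact fun v hv => by simp [m2 u hu, m2 v hv]
    obtain ⟨a, b, haS, hbS, hab, haT, hbT⟩ : ∃ a b, d a ≤ t ∧ ¬ d b ≤ t ∧
        (J a b ≠ 0 ∨ J b a ≠ 0) ∧ a ∈ T ∧ b ∈ T := by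
      by_contra hcon
      push Not at hcon
      have key : ∀ v, Relation.ReflTransGen
          (fun a b => (J a b ≠ 0 ∨ J b a ≠ 0) ∧ a ∈ T ∧ b ∈ T) x v → d v ≤ t := by
        intro v hv
        induction hv with
        | refl => omega
        | @tail b c _ hbc ih =>
          by_contra h'
          exact hcon b c ih (not_le.1 h') hbc.1 hbc.2.1 hbc.2.2
      have := key y (hconn y hy)
      omega
    have haS' : a ∈ S := mem_filter.2 ⟨haT, haS⟩
    have hbS' : b ∈ T \ S := mem_sdiff.2 ⟨hbT, fun h => hbS (mem_filter.1 h).2⟩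
    have hpos : ∀ K : α → α → ℤ, (∀ u v, 0 ≤ K u v) → K a b ≠ 0 →
        1 ≤ ∑ u ∈ S, ∑ v ∈ T \ S, K u v := by
      intro K hK hab
      have h1 : K a b ≤ ∑ v ∈ T \ S, K a v := single_le_sum (fun v _ => hK a v) hbS'
      have h2 : ∑ v ∈ T \ S, K a v ≤ ∑ u ∈ S, ∑ v ∈ T \ S, K u v :=
        single_le_sum (f := fun u => ∑ v ∈ T \ S, K u v)
          (fun u _ => sum_nonneg fun v _ => hK u v) haS'
      have := hK a b
      omega
    rw [hsplit]
    rcases hab with hab | hab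
    · have := hpos J hJ0 hab
      linarith
    · have := hpos (fun u v => J v u) (fun u v => hJ0 v u) hab
      linarith
  have h1 := sum_le_sum hlevel
  rw [sum_const, card_range, nsmul_eq_mul, mul_comm] at h1
  refine h1.trans ?_
  rw [sum_comm]
  refine sum_le_sum fun u hu => ?_
  rw [sum_comm]
  refine sum_le_sum fun v hv => ?_
  rw [← mul_sum]
  by_cases h0 : J u v = 0
  · simp [h0]
  refine mul_le_mul_of_nonneg_left ((sum_separated_le _ _ _).trans ?_) (hJ0 u v)
  have e1 := hd_le u hu v hv (hadj u v h0)
  have e2 := hd_le v hv u hu (hadj u v h0).symm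
  rw [hw v u] at e2
  rw [abs_le]
  omega

/-- The weights of edges which favour the vertices of `S`. -/
noncomputable def favour (N : ℕ) (S : Finset α) (u v : α) : ℕ :=
  2 * N - ((if u ∈ S then 1 else 0) + if v ∈ S then 1 else 0)

theorem favour_comm {N : ℕ} {S : Finset α} (u v : α) : favour N S u v = favour N S v u := by
  simp only [favour, add_comm]

theorem cast_favour {R : Type*} [Ring R] {N : ℕ} (hN : 1 ≤ N) {S : Finset α} (u v : α) :
    (favour N S u v : R) = 2 * N - ((if u ∈ S then 1 else 0) + if v ∈ S then 1 else 0) := by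
  rw [favour, Nat.cast_sub (by split_ifs <;> omega)]
  push_cast
  rfl

end Circulation

end RegularLattice

/-! ### Short paths on the contour -/

namespace RegularLattice

open Finset

open scoped Classical

namespace PlaneMap

variable {L : RegularLattice} (M : PlaneMap L) {B : Finset Vertex}

/-- A contour edge is recovered from the face on its left and its position there, and `len` counts
such pairs. -/
theorem sum_dart_le (T : Finset Vertex) :
    ∑ u ∈ T, ∑ v ∈ T, (if M.Dart B u v then (1 : ℤ) else 0) ≤ M.len B := by
  rw [← sum_product' T T fun u v => if M.Dart B u v then (1 : ℤ) else 0, len,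
    ← sum_product' (M.facesOf B) univ fun F k =>
      if M.cyc F k ∉ B ∧ M.cyc F (k + 1) ∉ B then (1 : ℤ) else 0, sum_boole, sum_boole]
  refine Nat.cast_le.2 (card_le_card_of_surjOn (fun x => (M.cyc x.1 x.2, M.cyc x.1 (x.2 + 1))) ?_)
  rintro ⟨u, v⟩ huv
  have huv : M.Dart B u v := (mem_filter.1 huv).2
  obtain ⟨hu, hv, i, rfl, hF⟩ := huv
  obtain ⟨k, h1, h2, -⟩ := M.pos u i
  refine ⟨(M.lf u i, k), mem_filter.2 ⟨mem_product.2 ⟨hF, mem_univ _⟩, ?_⟩, ?_⟩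
  · simp only [h1, h2]
    exact ⟨hu, hv⟩
  · simp only [h1, h2]

/-- Between any two vertices of the contour there is a short path on the contour, where the vertices
of `S` are favoured. -/
theorem exists_path (hB : L.StarConnected (B : Set Vertex)) {x y : Vertex}
    (hx : x ∈ L.exteriorStarBoundary (B : Set Vertex))
    (hy : y ∈ L.exteriorStarBoundary (B : Set Vertex)) (hxy : x ≠ y) {S : Finset Vertex}
    (hS : ∀ v ∈ S, v ∈ L.exteriorStarBoundary (B : Set Vertex)) {N : ℕ} (hN : 1 ≤ N) :
    ∃ p : L.graph.Walk x y, p.IsPath ∧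
      (∀ z ∈ p.support, z ∈ L.exteriorStarBoundary (B : Set Vertex)) ∧
      (walkWeight (favour N S) p : ℤ) + S.card ≤ N * M.len B := by
  set T := (M.nbhd B).filter fun v => v ∈ L.exteriorStarBoundary (B : Set Vertex) with hT
  have hTmem : ∀ v, v ∈ T ↔ v ∈ L.exteriorStarBoundary (B : Set Vertex) := fun v =>
    ⟨fun h => (mem_filter.1 h).2, fun h => mem_filter.2
      ⟨((mem_exteriorStarBoundary (M := M)).1 h).2, h⟩⟩
  have hstep : ∀ u ∈ T, ∀ v, M.Step B u v → v ∈ T := fun u hu v huv => by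
    rw [hTmem] at hu ⊢
    exact (mem_exteriorStarBoundary (M := M)).2 ⟨mem_exterior_of_connectedIn hu.1
      (.of_adj huv.notMem.1 huv.notMem.2 huv.adj), huv.mem_nbhd.2⟩
  set J : Vertex → Vertex → ℤ := fun u v => if M.Dart B u v then 1 else 0 with hJ
  have hJne : ∀ u v, J u v ≠ 0 ↔ M.Dart B u v := fun u v => by simp [hJ]
  have hJ0 : ∀ u v, 0 ≤ J u v := fun u v => by simp only [hJ]; split_ifs <;> simp
  have hbal : ∀ u ∈ T, ∑ v ∈ T, J u v = ∑ v ∈ T, J v u := fun u hu =>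
    M.balanced fun v hv => hstep u hu v hv
  have hconn : ∀ u ∈ T, ∀ v ∈ T, Relation.ReflTransGen
      (fun a b => (J a b ≠ 0 ∨ J b a ≠ 0) ∧ a ∈ T ∧ b ∈ T) u v := fun u hu v hv =>
    (contour_steps (M := M) hB ((hTmem u).1 hu) ((hTmem v).1 hv)).lift id fun a b h => by
      simp only [hJne, hTmem]
      exact h
  set w := favour N S
  obtain ⟨p, hp, hpw⟩ := exists_walk_le (G := L.graph) (w := w) hJ0 hbal
    (fun u v h => ((hJne u v).1 h).adj) favour_comm
    ((hTmem x).2 hx) (hconn x ((hTmem x).2 hx)) ((hTmem y).2 hy)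
  refine ⟨p.bypass, p.bypass_isPath, fun z hz => (hTmem z).1 (hp z
    (p.support_bypass_subset_support hz)), ?_⟩
  have hle : (walkWeight w p.bypass : ℤ) ≤ walkWeight w p := Nat.cast_le.2 (walkWeight_bypass_le p)
  -- The contour has another vertex, so some contour edge ends at `u`; by balance at least one
  -- leaves it.
  have hout : ∀ u ∈ T, 1 ≤ ∑ v ∈ T, J u v := by
    intro u hu
    obtain ⟨v, hv, huv⟩ : ∃ v ∈ T, u ≠ v := by
      by_cases h : u = x
      · exact ⟨y, (hTmem y).2 hy, h ▸ hxy⟩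
      · exact ⟨x, (hTmem x).2 hx, h⟩
    obtain ⟨b, ⟨hb, -, hbT⟩, -⟩ := ((hconn u hu v hv).cases_head).resolve_left huv
    have h1 : ∀ K : Vertex → ℤ, (∀ v, 0 ≤ K v) → K b ≠ 0 → 1 ≤ ∑ v ∈ T, K v := fun K hK hb =>
      (by have := hK b; omega : 1 ≤ K b).trans (single_le_sum (fun v _ => hK v) hbT)
    rcases hb with hb | hb
    · exact h1 _ (fun v => hJ0 u v) hb
    · rw [hbal u hu]
      exact h1 (fun v => J v u) (fun v => hJ0 v u) hb
  have hST : S ⊆ T := fun v hv => (hTmem v).2 (hS v hv)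
  have hwJ : ∀ u v, J u v * w u v =
      2 * N * J u v - (if u ∈ S then J u v else 0) - if v ∈ S then J u v else 0 := by
    intro u v
    rw [cast_favour hN]
    split_ifs <;> ring
  -- A vertex of `S` lowers the weights of the edges leaving it and, by balance, of as many entering
  -- it. The total is thus at most `2 * N * len - 2 * |S|`, and the path costs half of that.
  have hsum : ∑ u ∈ T, ∑ v ∈ T, J u v * w u v = 2 * N * ∑ u ∈ T, ∑ v ∈ T, J u v -
      2 * ∑ u ∈ S, ∑ v ∈ T, J u v := by
    have e1 : ∑ u ∈ T, ∑ v ∈ T, (if u ∈ S then J u v else 0) = ∑ u ∈ S, ∑ v ∈ T, J u v := by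
      rw [← sum_subset hST fun u _ hu => by simp [hu]]
      exact sum_congr rfl fun u hu => by simp [hu]
    have e2 : ∑ u ∈ T, ∑ v ∈ T, (if v ∈ S then J u v else 0) = ∑ u ∈ S, ∑ v ∈ T, J u v := by
      rw [sum_comm, ← sum_subset hST fun u _ hu => by simp [hu]]
      exact sum_congr rfl fun u hu => by simp [hu, hbal u (hST hu)]
    simp only [hwJ, sum_sub_distrib, e1, e2, ← mul_sum]
    ring
  have hS1 : (S.card : ℤ) ≤ ∑ u ∈ S, ∑ v ∈ T, J u v := by
    have := sum_le_sum fun u (hu : u ∈ S) => hout u (hST hu)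
    simpa using this
  have hlen : ∑ u ∈ T, ∑ v ∈ T, J u v ≤ M.len B := M.sum_dart_le T
  have := mul_le_mul_of_nonneg_left hlen (by positivity : (0 : ℤ) ≤ 2 * N)
  linarith

end PlaneMap

end RegularLattice

/-! ### Superharmonic functions along paths -/

namespace RegularLattice

open Finset

open scoped Classical

variable {L : RegularLattice}

/-- The rate at which harmonic functions grow along a path with no other free neighbours. -/
noncomputable def growth : RegularLattice → ℝ
  | square => 2 + √3
  | triangular => 3 + 2 * √2
  | hexagonal => (3 + √5) / 2

theorem lam_eq : L.lam = L.growth ^ L.tunnelRate := by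
  cases L <;> simp [lam, growth, tunnelRate]

/-- `growth` solves `t + 1 / t = deg`; hence `deg - growth` is its inverse, the ratio of the
decaying solution. -/
theorem growth_mul : L.growth * (L.deg - L.growth) = 1 := by
  cases L
  · have := Real.sq_sqrt (show (0 : ℝ) ≤ 3 by norm_num)
    simp only [growth, deg]; push_cast; linarith
  · have := Real.sq_sqrt (show (0 : ℝ) ≤ 2 by norm_num)
    simp only [growth, deg]; push_cast; linarith
  · have := Real.sq_sqrt (show (0 : ℝ) ≤ 5 by norm_num)
    simp only [growth, deg]; push_cast; linarith

theorem growth_bounds : 2 < L.growth ∧ 2 * ((L.deg : ℝ) - L.growth) ≤ L.growth - 1 / L.deg := by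
  cases L
  · have h : (17 / 10 : ℝ) ≤ √3 := Real.le_sqrt_of_sq_le (by norm_num)
    simp only [growth, deg]; push_cast; constructor <;> linarith
  · have h : (14 / 10 : ℝ) ≤ √2 := Real.le_sqrt_of_sq_le (by norm_num)
    simp only [growth, deg]; push_cast; constructor <;> linarith
  · have h : (22 / 10 : ℝ) ≤ √5 := Real.le_sqrt_of_sq_le (by norm_num)
    simp only [growth, deg]; push_cast; constructor <;> linarith

theorem growth_lt_deg : L.growth < L.deg := by
  have h1 := growth_mul (L := L)
  have h2 := (growth_bounds (L := L)).1
  by_contra h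
  have := mul_nonpos_of_nonneg_of_nonpos (by linarith : 0 ≤ L.growth)
    (by linarith : (L.deg : ℝ) - L.growth ≤ 0)
  linarith

theorem deg_pos' : (0 : ℝ) < L.deg := by
  have := growth_lt_deg (L := L)
  linarith [(growth_bounds (L := L)).1]

/-- A third free neighbour lowers the rate to `growth - 1 / deg`; `N` expresses this as a saving of
`1 / N` in the exponent, so that integer edge weights can record it. -/
theorem exists_rate (L : RegularLattice) :
    ∃ N : ℕ, 1 ≤ N ∧ L.growth - 1 / L.deg ≤ L.growth ^ (1 - 1 / (N : ℝ)) := by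
  have h1 := (growth_bounds (L := L)).1
  have hd := deg_pos' (L := L)
  have hlt := growth_lt_deg (L := L)
  have hd1 : 1 / (L.deg : ℝ) < 1 := by rw [div_lt_one hd]; linarith
  have hd0 : 0 < 1 / (L.deg : ℝ) := by positivity
  set a := L.growth
  set b := a - 1 / L.deg
  have hb : 0 < b := by simp only [b]; linarith
  obtain ⟨N, hN⟩ := pow_unbounded_of_one_lt a (show 1 < a / b by
    rw [one_lt_div hb]; simp only [b]; linarith)
  have hN0 : N ≠ 0 := by rintro rfl; rw [pow_zero] at hN; linarith
  refine ⟨N, Nat.one_le_iff_ne_zero.2 hN0, ?_⟩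
  have h2 : a ^ (1 / (N : ℝ)) ≤ a / b := by
    calc a ^ (1 / (N : ℝ)) ≤ ((a / b) ^ N) ^ (1 / (N : ℝ)) :=
          Real.rpow_le_rpow (by linarith) hN.le (by positivity)
      _ = a / b := by
          rw [one_div, Real.pow_rpow_inv_natCast (by positivity) hN0]
  rw [Real.rpow_sub (by linarith), Real.rpow_one, le_div_iff₀ (by positivity)]
  rw [le_div_iff₀ hb] at h2
  linarith

/-- A non-negative function which is superharmonic outside `A`. -/
structure Superharmonic (M : PlaneMap L) (A : Set Vertex) (u : Vertex → ℝ) : Prop where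
  nonneg : ∀ z, 0 ≤ u z
  sum_le : ∀ z ∉ A, ∑ i, u (M.nb z i) ≤ L.deg * u z

section

variable {M : PlaneMap L} {A : Set Vertex} {u : Vertex → ℝ} {x y z : Vertex}

theorem Superharmonic.le (h : Superharmonic M A u) (hz : z ∉ A) (hzy : L.graph.Adj z y) :
    u y ≤ L.deg * u z := by
  obtain ⟨i, rfl⟩ := (M.adj_iff _ _).1 hzy
  exact (single_le_sum (f := fun i => u (M.nb z i)) (fun i _ => h.nonneg _) (mem_univ i)).trans
    (h.sum_le z hz)

theorem Superharmonic.add_le (h : Superharmonic M A u) (hz : z ∉ A) (hzy : L.graph.Adj z y)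
    (hzx : L.graph.Adj z x) (hxy : y ≠ x) : u y + u x ≤ L.deg * u z := by
  obtain ⟨i, rfl⟩ := (M.adj_iff _ _).1 hzy
  obtain ⟨j, rfl⟩ := (M.adj_iff _ _).1 hzx
  have hij : i ≠ j := fun e => hxy (e ▸ rfl)
  have := sum_le_univ_sum_of_nonneg (f := fun i => u (M.nb z i)) (s := {i, j})
    fun i => h.nonneg _
  rw [sum_pair hij] at this
  exact this.trans (h.sum_le z hz)

/-- There is a third free neighbour `k`; it is off `A` itself, so its value is at least `u z / deg`.
-/
theorem Superharmonic.add_le_of_freeDeg (h : Superharmonic M A u) (hz : z ∉ A)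
    (hzy : L.graph.Adj z y) (hzx : L.graph.Adj z x) (hxy : y ≠ x) (hx : x ∉ A) (hy : y ∉ A)
    (h2 : L.freeDeg A z ≠ 2) : u y + u x ≤ (L.deg - 1 / L.deg) * u z := by
  obtain ⟨i, rfl⟩ := (M.adj_iff _ _).1 hzy
  obtain ⟨j, rfl⟩ := (M.adj_iff _ _).1 hzx
  have hij : i ≠ j := fun e => hxy (e ▸ rfl)
  obtain ⟨k, hk, hki, hkj⟩ : ∃ k, M.nb z k ∉ A ∧ k ≠ i ∧ k ≠ j := by
    by_contra hcon
    push Not at hcon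
    apply h2
    rw [freeDeg, M.ncard_neighborSet_diff, ← card_pair hij]
    congr 1
    ext k
    simp only [mem_filter, mem_univ, true_and, mem_insert, mem_singleton]
    constructor
    · intro hk
      by_contra h'
      rw [not_or] at h'
      exact h'.2 (hcon k hk h'.1)
    · rintro (rfl | rfl)
      exacts [hy, hx]
  have hsum := sum_le_univ_sum_of_nonneg (f := fun i => u (M.nb z i)) (s := {k, i, j})
    fun i => h.nonneg _
  rw [sum_insert (by simp [hki, hkj]), sum_pair hij] at hsum
  have h3 := h.le hk (M.adj_nb z k).symm
  have h4 : 1 / (L.deg : ℝ) * u z ≤ u (M.nb z k) := by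
    rw [one_div, inv_mul_le_iff₀ deg_pos']
    exact h3
  have h5 := h.sum_le z hz
  linarith

/-- The growth of a superharmonic function along a path. -/
theorem Superharmonic.le_of_path (h : Superharmonic M A u) {N : ℕ} (hN : 1 ≤ N)
    (hrate : L.growth - 1 / L.deg ≤ L.growth ^ (1 - 1 / (N : ℝ))) {S : Finset Vertex}
    (hS : ∀ v ∈ S, L.freeDeg A v ≠ 2) (q : L.graph.Walk z x) : ∀ {y} (hyz : L.graph.Adj y z),
    (SimpleGraph.Walk.cons hyz q).IsPath →
    (∀ v ∈ (SimpleGraph.Walk.cons hyz q).support, v ∉ A) →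
    ∀ W : ℝ, W = u x * L.growth ^ (((walkWeight (favour N S) (SimpleGraph.Walk.cons hyz q) : ℝ) +
      (if x ∈ S then 1 else 0) + if y ∈ S then 1 else 0) / (2 * N)) →
    u y - (L.deg - L.growth) * u z ≤ W ∧ u y ≤ 2 * W := by
  have hN0 : (0 : ℝ) < N := by exact_mod_cast hN
  obtain ⟨hg2, hgb⟩ := growth_bounds (L := L)
  have hβ : 0 < L.deg - L.growth := sub_pos.2 growth_lt_deg
  have hmul := growth_mul (L := L)
  have hd := deg_pos' (L := L)
  have hd0 : 0 < 1 / (L.deg : ℝ) := by positivity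
  induction q with
  | nil =>
    rename_i x
    intro y hyx hp hA W hW
    have hexp : (((walkWeight (favour N S)
        (SimpleGraph.Walk.cons hyx .nil) : ℝ) +
      (if x ∈ S then 1 else 0) + if y ∈ S then 1 else 0) / (2 * N)) = 1 := by
      rw [walkWeight_cons, walkWeight_nil, add_zero, cast_favour hN,
        div_eq_one_iff_eq (by positivity)]
      ring_nf
    rw [hexp, Real.rpow_one] at hW
    have hx : x ∉ A := hA x (by simp)
    have h1 := h.le hx hyx.symm
    have h2 := h.nonneg x
    have h3 : (L.deg - L.growth) * u x ≤ L.growth * u x :=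
      mul_le_mul_of_nonneg_right (by linarith) h2
    subst hW
    constructor <;> linarith
  | @cons z z' x hzz' q ih =>
    intro y hyz hp hA W hW
    obtain ⟨hp', hy⟩ := (SimpleGraph.Walk.cons_isPath_iff _ _).1 hp
    set W' := u x * L.growth ^ (((walkWeight (favour N S) (SimpleGraph.Walk.cons hzz' q) : ℝ) +
      (if x ∈ S then 1 else 0) + if z ∈ S then 1 else 0) / (2 * N)) with hW'
    have hA' : ∀ v ∈ (SimpleGraph.Walk.cons hzz' q).support, v ∉ A := fun v hv =>
      hA v (List.mem_cons_of_mem _ hv)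
    obtain ⟨ih1, ih2⟩ := ih hzz' hp' hA' W' rfl
    have hW'0 : 0 ≤ W' := mul_nonneg (h.nonneg _) (by positivity)
    have hzA : z ∉ A := hA' z (by simp)
    have hz'A : z' ∉ A := hA' z' (by simp)
    have hyA : y ∉ A := hA y (by simp)
    have hyz' : y ≠ z' := fun e => hy (by rw [e]; simp)
    -- Half the weight of each edge is assigned to each end. An inner vertex thus contributes the
    -- exponent 1, or `1 - 1 / N` in `S`; the two indicators in `W` remove the discount at the ends
    -- of the path.
    have hWW : W = W' * L.growth ^ (1 - (if z ∈ S then 1 else 0) / (N : ℝ)) := by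
      rw [hW, hW', mul_assoc, ← Real.rpow_add (by linarith)]
      congr 2
      rw [walkWeight_cons hyz, Nat.cast_add, cast_favour hN]
      generalize (walkWeight (favour N S) (SimpleGraph.Walk.cons hzz' q) : ℝ) = t
      field_simp
      ring_nf
    obtain ⟨a, ha1, ha2, haW, hau⟩ : ∃ a, L.growth - 1 / L.deg ≤ a ∧ a ≤ L.growth ∧ a * W' ≤ W ∧
        u y + u z' ≤ (a + (L.deg - L.growth)) * u z := by
      by_cases hzS : z ∈ S
      · refine ⟨L.growth - 1 / L.deg, le_rfl, by linarith, ?_, ?_⟩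
        · rw [hWW, if_pos hzS, mul_comm]
          exact mul_le_mul_of_nonneg_left hrate hW'0
        · have := h.add_le_of_freeDeg hzA hyz.symm hzz' hyz' hz'A hyA (hS z hzS)
          linarith
      · refine ⟨L.growth, by linarith, le_rfl, ?_, ?_⟩
        · rw [hWW, if_neg hzS, zero_div, sub_zero, Real.rpow_one, mul_comm]
        · have := h.add_le hzA hyz.symm hzz' hyz'
          linarith
    have ha0 : 0 < a := by linarith
    -- Superharmonicity at `z` bounds the left side by `a * u z - u z'`. As `a * (deg - growth) ≤
    -- 1`, this is at most `a` times the same quantity one step further on.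
    have k1 : u y - (L.deg - L.growth) * u z ≤ W := by
      have e1 : a * (L.deg - L.growth) * u z' ≤ 1 * u z' := by
        refine mul_le_mul_of_nonneg_right ?_ (h.nonneg _)
        rw [← hmul]
        exact mul_le_mul_of_nonneg_right ha2 hβ.le
      have e2 := mul_le_mul_of_nonneg_left ih1 ha0.le
      linarith
    refine ⟨k1, ?_⟩
    -- The subtracted term is at most `2 * (deg - growth) * W'`, hence at most `a * W'` and so at
    -- most `W`; this is where the factor 2 comes from.
    have e3 := mul_le_mul_of_nonneg_left ih2 hβ.le
    have e4 : 2 * (L.deg - L.growth) * W' ≤ a * W' :=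
      mul_le_mul_of_nonneg_right (by linarith) hW'0
    linarith

end

end RegularLattice

/-! ### Hitting probabilities -/

namespace RegularLattice

open Finset

open scoped Classical

variable {L : RegularLattice} {M : PlaneMap L} {A : Set Vertex} {y : Vertex}

/-- The probability that simple random walk reaches `y` before `A` within `n` steps. -/
noncomputable def hitProb (M : PlaneMap L) (A : Set Vertex) (y : Vertex) : ℕ → Vertex → ℝ
  | 0, z => if z = y then 1 else 0
  | n + 1, z => if z = y then 1 else if z ∈ A then 0 else
      (L.deg : ℝ)⁻¹ * ∑ i, hitProb M A y n (M.nb z i)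

theorem hitProb_self (n : ℕ) : hitProb M A y n y = 1 := by
  cases n <;> simp [hitProb]

theorem hitProb_nonneg (n : ℕ) (z : Vertex) : 0 ≤ hitProb M A y n z := by
  induction n generalizing z with
  | zero => simp only [hitProb]; split_ifs <;> simp
  | succ n ih =>
    simp only [hitProb]
    split_ifs
    · simp
    · simp
    · exact mul_nonneg (by positivity) (sum_nonneg fun i _ => ih _)

theorem hitProb_le_one (n : ℕ) (z : Vertex) : hitProb M A y n z ≤ 1 := by
  induction n generalizing z with
  | zero => simp only [hitProb]; split_ifs <;> simp
  | succ n ih =>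
    simp only [hitProb]
    split_ifs
    · simp
    · simp
    · rw [inv_mul_le_iff₀ deg_pos']
      have := sum_le_sum fun i (_ : i ∈ (univ : Finset (Fin L.deg))) => ih (M.nb z i)
      simpa using this

theorem hitProb_mono (z : Vertex) : Monotone fun n => hitProb M A y n z := by
  refine monotone_nat_of_le_succ fun n => ?_
  induction n generalizing z with
  | zero =>
    by_cases h : z = y
    · rw [h, hitProb_self, hitProb_self]
    · refine le_trans (le_of_eq ?_) (hitProb_nonneg 1 z)
      simp [hitProb, h]
  | succ n ih =>
    rw [hitProb, hitProb]
    split_ifs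
    · rfl
    · rfl
    · gcongr with i
      exact ih _

theorem bddAbove_hitProb (z : Vertex) : BddAbove (Set.range fun n => hitProb M A y n z) :=
  ⟨1, by rintro _ ⟨n, rfl⟩; exact hitProb_le_one n z⟩

/-- Off `y` this is the limit of the one-step recursion; at `y` the value is 1, and no value exceeds
1. -/
theorem superharmonic_hitProb : Superharmonic M A fun z => ⨆ n, hitProb M A y n z where
  nonneg z := (hitProb_nonneg 0 z).trans (le_ciSup (bddAbove_hitProb z) 0)
  sum_le z hz := by
    refine le_of_tendsto' (tendsto_finsetSum _ fun i _ =>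
      tendsto_atTop_ciSup (hitProb_mono (M.nb z i)) (bddAbove_hitProb _)) fun n => ?_
    by_cases h : z = y
    · subst h
      have h1 : ∑ i, hitProb M A z n (M.nb z i) ≤ L.deg := by
        have := sum_le_sum fun i (_ : i ∈ (univ : Finset (Fin L.deg))) =>
          hitProb_le_one (M := M) (A := A) (y := z) n (M.nb z i)
        simpa using this
      have h2 := le_ciSup (bddAbove_hitProb (M := M) (A := A) (y := z) z) 0
      rw [hitProb_self] at h2
      exact h1.trans (le_mul_of_one_le_right deg_pos'.le h2)
    · have h2 := le_ciSup (bddAbove_hitProb (M := M) (A := A) (y := y) z) (n + 1)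
      rw [hitProb, if_neg h, if_neg hz, inv_mul_le_iff₀ deg_pos'] at h2
      exact h2

section RandomWalk

variable {Ω : Type*} [MeasurableSpace Ω] {P : Measure Ω} [IsProbabilityMeasure P]
  {S : ℕ → Ω → Vertex} {x : Vertex}

/-- Induction on the number `n` of remaining steps, over all pasts that avoid `A`: the cylinder
splits according to the next position, and `step` gives each piece its weight. -/
theorem IsRandomWalk.le_cylinder (h : L.IsRandomWalk P S x) (hy : y ∉ A) (n k : ℕ)
    (p : ℕ → Vertex) (hp : ∀ i < k, p i ∉ A) :
    P.real {ω | ∀ i ≤ k, S i ω = p i} * hitProb M A y n (p k) ≤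
      P.real ({ω | ∀ i ≤ k, S i ω = p i} ∩ {ω | ∃ m, S m ω = y ∧ ∀ j ≤ m, S j ω ∉ A}) := by
  have hmeas : MeasurableSet {ω | ∃ m, S m ω = y ∧ ∀ j ≤ m, S j ω ∉ A} := by
    have : {ω | ∃ m, S m ω = y ∧ ∀ j ≤ m, S j ω ∉ A} =
        ⋃ m, S m ⁻¹' {y} ∩ ⋂ j ∈ Set.Iic m, S j ⁻¹' Aᶜ := by ext; simp
    rw [this]
    exact MeasurableSet.iUnion fun m => (h.measurable m .of_discrete).inter
      (MeasurableSet.biInter (Set.to_countable _) fun j _ => h.measurable j .of_discrete)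
  have hcase : ∀ n k, ∀ p : ℕ → Vertex, (∀ i < k, p i ∉ A) → p k = y →
      P.real {ω | ∀ i ≤ k, S i ω = p i} * hitProb M A y n (p k) ≤
      P.real ({ω | ∀ i ≤ k, S i ω = p i} ∩ {ω | ∃ m, S m ω = y ∧ ∀ j ≤ m, S j ω ∉ A}) := by
    intro n k p hp hk
    rw [hk, hitProb_self, mul_one]
    refine measureReal_mono fun ω hω => ⟨hω, k, (hω k le_rfl).trans hk, fun j hj => ?_⟩
    rw [hω j hj]
    rcases hj.lt_or_eq with hj | rfl
    · exact hp j hj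
    · rwa [hk]
  induction n generalizing k p with
  | zero =>
    by_cases hk : p k = y
    · exact hcase _ k p hp hk
    · simp only [hitProb, if_neg hk, mul_zero]
      exact measureReal_nonneg
  | succ n ih =>
    by_cases hk : p k = y
    · exact hcase _ k p hp hk
    by_cases hkA : p k ∈ A
    · simp only [hitProb, if_neg hk, if_pos hkA, mul_zero]
      exact measureReal_nonneg
    let q : Fin L.deg → ℕ → Vertex := fun i => Function.update p (k + 1) (M.nb (p k) i)
    have hq : ∀ i, ∀ j ≤ k, q i j = p j := fun i j hj =>
      Function.update_of_ne (by omega) _ _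
    have hq1 : ∀ i, q i (k + 1) = M.nb (p k) i := fun i => Function.update_self _ _ _
    have hmeas' : ∀ i, MeasurableSet {ω | ∀ j ≤ k + 1, S j ω = q i j} := by
      intro i
      have : {ω | ∀ j ≤ k + 1, S j ω = q i j} = ⋂ j ∈ Set.Iic (k + 1), S j ⁻¹' {q i j} := by
        ext; simp
      rw [this]
      exact MeasurableSet.biInter (Set.to_countable _) fun j _ => h.measurable j .of_discrete
    have hstep : ∀ i, P.real {ω | ∀ j ≤ k + 1, S j ω = q i j} =
        P.real {ω | ∀ j ≤ k, S j ω = p j} * (L.deg : ℝ)⁻¹ := by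
      intro i
      rw [h.step k (q i), hq i k le_rfl, hq1, if_pos (M.adj_nb _ _)]
      congr 2
      ext ω
      exact forall₂_congr fun j hj => by rw [hq i j hj]
    have hsub : (⋃ i, {ω | ∀ j ≤ k + 1, S j ω = q i j} ∩
        {ω | ∃ m, S m ω = y ∧ ∀ j ≤ m, S j ω ∉ A}) ⊆
        {ω | ∀ i ≤ k, S i ω = p i} ∩ {ω | ∃ m, S m ω = y ∧ ∀ j ≤ m, S j ω ∉ A} := by
      refine Set.iUnion_subset fun i ω hω => ⟨fun j hj => ?_, hω.2⟩
      rw [hω.1 j (by omega), hq i j hj]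
    have hdisj : Pairwise (Function.onFun Disjoint fun i => {ω | ∀ j ≤ k + 1, S j ω = q i j} ∩
        {ω | ∃ m, S m ω = y ∧ ∀ j ≤ m, S j ω ∉ A}) := by
      intro i i' hii'
      refine Set.disjoint_left.2 fun ω h1 h2 => hii' (M.nb_inj (p k) ?_)
      rw [← hq1, ← hq1, ← h1.1 _ le_rfl, ← h2.1 _ le_rfl]
    refine le_trans ?_ (measureReal_mono hsub)
    rw [measureReal_iUnion_fintype hdisj fun i => (hmeas' i).inter hmeas]
    simp only [hitProb, if_neg hk, if_neg hkA]
    rw [← mul_assoc, mul_sum]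
    refine sum_le_sum fun i _ => ?_
    have := ih (k + 1) (q i) (fun j hj => by
      rw [hq i j (by omega)]
      rcases (Nat.lt_succ_iff.1 hj).lt_or_eq with hj | rfl
      exacts [hp j hj, hkA])
    rwa [hstep, hq1] at this

theorem IsRandomWalk.hitProb_le (h : L.IsRandomWalk P S x) (hy : y ∉ A) :
    ⨆ n, hitProb M A y n x ≤ P.real {ω | hittingTime (fun n => S n ω) {y} <
      hittingTime (fun n => S n ω) A} := by
  refine ciSup_le fun n => ?_
  have h0 : P.real {ω | ∀ i ≤ 0, S i ω = (fun _ => x : ℕ → Vertex) i} = 1 := by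
    have : {ω | ∀ i ≤ 0, S i ω = (fun _ => x : ℕ → Vertex) i} =ᵐ[P] Set.univ := by
      filter_upwards [h.start] with ω hω
      simp only [eq_iff_iff]
      exact ⟨fun _ => trivial, fun _ i hi => by rw [Nat.le_zero.1 hi, hω]⟩
    rw [measureReal_congr this, probReal_univ]
  have h1 := h.le_cylinder (M := M) hy n 0 (fun _ => x) (by simp)
  rw [h0, one_mul] at h1
  refine h1.trans (measureReal_mono ?_)
  rintro ω ⟨-, m, hm, hmA⟩
  refine lt_of_le_of_lt (b := (m : ℕ∞)) (iInf₂_le m hm) ?_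
  -- `A` is avoided up to time `m` inclusive, so it is hit at `m + 1` at the earliest; this makes
  -- the inequality strict.
  have : ((m + 1 : ℕ) : ℕ∞) ≤ hittingTime (fun n => S n ω) A := le_iInf₂ fun j hj => by
    refine Nat.cast_le.2 ?_
    by_contra hlt
    exact hmA j (by omega) hj
  exact lt_of_lt_of_le (by exact_mod_cast Nat.lt_succ_self m) this

end RandomWalk

end RegularLattice

/-! ### The lower bound -/

namespace RegularLattice

open Finset

open scoped Classical

variable {L : RegularLattice} {M : PlaneMap L} {A : Set Vertex} {D B : Finset Vertex}

/-- The growth of a superharmonic function between two points of the contour. -/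
theorem Superharmonic.le_of_filling {u : Vertex → ℝ} (hu : Superharmonic M A u) {N : ℕ}
    (hN : 1 ≤ N) (hrate : L.growth - 1 / L.deg ≤ L.growth ^ (1 - 1 / (N : ℝ)))
    (h : M.Filling A D B) (hD : L.IsInterlockedCluster A D)
    (hne : ((D : Set Vertex) ∩ L.exterior (A \ D)).Nonempty) {x y : Vertex}
    (hx : x ∈ L.exteriorStarBoundary (B : Set Vertex))
    (hy : y ∈ L.exteriorStarBoundary (B : Set Vertex)) :
    u y ≤ 2 * (u x * L.growth ^ ((L.tunnelRate * D.card + L.mergeGain / 2 + 1 : ℝ) -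
      √(D.card : ℝ) / (6 * N))) := by
  have hN1 : (1 : ℝ) ≤ N := by exact_mod_cast hN
  have hg := (growth_bounds (L := L)).1
  have hk : (1 : ℝ) ≤ L.tunnelRate := by cases L <;> simp [tunnelRate]
  have hsqrt : √(D.card : ℝ) ≤ D.card := by
    rcases Nat.eq_zero_or_pos D.card with h0 | h0
    · simp [h0]
    · exact Real.sqrt_le_self_iff.2 (Or.inr (by exact_mod_cast h0))
  -- The path argument needs at least one edge; for `y = x` the exponent is simply non-negative.
  by_cases hxy : y = x
  · subst hxy
    have h0 : (0 : ℝ) ≤ (L.tunnelRate * D.card + L.mergeGain / 2 + 1 : ℝ) -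
        √(D.card : ℝ) / (6 * N) := by
      have h1 : √(D.card : ℝ) / (6 * N) ≤ √(D.card : ℝ) :=
        div_le_self (Real.sqrt_nonneg _) (by linarith)
      have h2 : (D.card : ℝ) ≤ L.tunnelRate * D.card :=
        le_mul_of_one_le_left (Nat.cast_nonneg _) hk
      have h3 : (0 : ℝ) ≤ L.mergeGain := Nat.cast_nonneg _
      linarith
    have h1 := Real.one_le_rpow (x := L.growth) (by linarith) h0
    have h2 := le_mul_of_one_le_right (hu.nonneg y) h1
    have h3 := hu.nonneg y
    linarith
  set S := (M.nbhd B).filter fun v => v ∈ L.exteriorStarBoundary (B : Set Vertex) ∧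
    L.freeDeg A v ≠ 2 with hS
  have hcard : B.card ≤ 8 * S.card ^ 2 := (h.unlocked hD hne).card_le fun v hv hv2 =>
    mem_filter.2 ⟨((PlaneMap.mem_exteriorStarBoundary (M := M)).1 hv).2, hv, hv2⟩
  obtain ⟨p, hp, hpB, hw⟩ := M.exists_path h.conn hy hx hxy
    (fun v (hv : v ∈ S) => (mem_filter.1 hv).2.1) hN
  cases p with
  | nil => exact absurd rfl hxy
  | @cons _ z _ hyz q =>
    have key := (hu.le_of_path hN hrate (fun v (hv : v ∈ S) => (mem_filter.1 hv).2.2) q hyz hp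
      (fun v hv => h.notMem hD (hpB v hv)) _ rfl).2
    refine key.trans (mul_le_mul_of_nonneg_left (mul_le_mul_of_nonneg_left
      (Real.rpow_le_rpow_of_exponent_le (by linarith) ?_) (hu.nonneg x)) (by norm_num))
    have hw' : (walkWeight (favour N S) (SimpleGraph.Walk.cons hyz q) : ℝ) + S.card ≤
        N * (2 * L.tunnelRate * D.card + L.mergeGain) := by
      have h1 := mul_le_mul_of_nonneg_left h.len_le (Nat.cast_nonneg N)
      have h2 := hw.trans h1
      exact_mod_cast h2
    -- The constant 8 is raised to the square 9; the saving `|S| / (2 * N)` is then at least `√|D| /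
    -- (6 * N)`.
    have hDS : √(D.card : ℝ) ≤ 3 * S.card := by
      rw [Real.sqrt_le_left (by positivity)]
      have h1 : D.card ≤ 9 * S.card ^ 2 := (card_le_card h.sub).trans (hcard.trans (by omega))
      calc (D.card : ℝ) ≤ (9 * S.card ^ 2 : ℕ) := by exact_mod_cast h1
        _ = (3 * S.card : ℝ) ^ 2 := by push_cast; ring
    have hg1 : ∀ v : Vertex, (if v ∈ S then (1 : ℝ) else 0) ≤ 1 := fun v => by split_ifs <;> norm_num
    have hgx := hg1 x
    have hgy := hg1 y
    generalize (walkWeight (favour N S) (SimpleGraph.Walk.cons hyz q) : ℝ) = t at hw' ⊢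
    rw [div_le_iff₀ (by positivity)]
    have e : ((L.tunnelRate * D.card + L.mergeGain / 2 + 1 : ℝ) - √(D.card : ℝ) / (6 * N)) *
        (2 * N) = N * (2 * L.tunnelRate * D.card + L.mergeGain) + 2 * N - √(D.card : ℝ) / 3 := by
      field_simp
      ring
    rw [e]
    linarith

theorem exists_hitting_bound (L : RegularLattice) :
    ∃ c : ℝ, 0 < c ∧ ∃ K : ℝ, 0 < K ∧
      ∀ A D : Set Vertex,
        L.IsInterlockedCluster A D → D.Finite → (D ∩ L.exterior (A \ D)).Nonempty →
        ∀ x ∈ L.exteriorStarBoundary D, ∀ y ∈ L.exteriorStarBoundary D,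
        ∀ {Ω : Type*} [MeasurableSpace Ω] (P : Measure Ω)
          [IsProbabilityMeasure P] (S : ℕ → Ω → Vertex),
          L.IsRandomWalk P S x →
          K * L.lam ^ (-(D.ncard : ℝ) + c * √(D.ncard : ℝ)) ≤
            P.real {ω | hittingTime (fun n => S n ω) {y} < hittingTime (fun n => S n ω) A} := by
  obtain ⟨N, hN, hrate⟩ := exists_rate L
  have hN0 : (0 : ℝ) < N := by exact_mod_cast hN
  have hg := (growth_bounds (L := L)).1
  have hg0 : 0 < L.growth := by linarith
  have hk : (0 : ℝ) < L.tunnelRate := by cases L <;> simp [tunnelRate]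
  have hd := deg_pos' (L := L)
  have hd1 : (1 : ℝ) ≤ L.deg := by linarith [growth_lt_deg (L := L)]
  -- Division by `tunnelRate` passes from powers of `growth` to powers of `lam`. In the second
  -- constant, 2 comes from `Superharmonic.le_of_path`, `deg ^ 2` from moving `x` and `y` onto the
  -- contour, and the power from the additive terms of the exponent.
  refine ⟨1 / (6 * N * L.tunnelRate), by positivity,
    (2 * L.deg ^ 2 * L.growth ^ (L.mergeGain / 2 + 1 : ℝ))⁻¹, by positivity, ?_⟩
  intro A D hD hfin hne x hx y hy Ω _ P _ S hS
  lift D to Finset Vertex using hfin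
  set M := planeMap L
  obtain ⟨B, hB⟩ := M.exists_filling hD
  obtain ⟨hxA, x', hx', hxx'⟩ := hB.exists_boundary hD hx
  obtain ⟨hyA, y', hy', hyy'⟩ := hB.exists_boundary hD hy
  refine le_trans ?_ (hS.hitProb_le (M := M) hyA)
  have hu : Superharmonic M A fun z => ⨆ n, hitProb M A y n z := superharmonic_hitProb
  have huy : 1 ≤ ⨆ n, hitProb M A y n y := by
    have := le_ciSup (bddAbove_hitProb (M := M) (A := A) (y := y) y) 0
    rwa [hitProb_self] at this
  set u := fun z => ⨆ n, hitProb M A y n z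
  change _ ≤ u x
  change 1 ≤ u y at huy
  have hle : ∀ v w, v ∉ A → w = v ∨ L.graph.Adj v w → u w ≤ L.deg * u v := by
    rintro v w hv (rfl | hvw)
    · exact le_mul_of_one_le_left (hu.nonneg _) hd1
    · exact hu.le hv hvw
  have h1 := hle y' y (hB.notMem hD hy') (hyy'.imp Eq.symm SimpleGraph.Adj.symm)
  have h2 := hle x x' hxA hxx'
  have h3 := hu.le_of_filling hN hrate hB hD hne hx' hy'
  rw [Set.ncard_coe_finset, lam_eq, ← Real.rpow_natCast L.growth, ← Real.rpow_mul hg0.le,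
    inv_mul_le_iff₀ (by positivity)]
  have e : (L.tunnelRate : ℝ) * (-(D.card : ℝ) + 1 / (6 * N * L.tunnelRate) * √(D.card : ℝ)) =
      (L.mergeGain / 2 + 1 : ℝ) -
        ((L.tunnelRate * D.card + L.mergeGain / 2 + 1 : ℝ) - √(D.card : ℝ) / (6 * N)) := by
    field_simp
    ring
  rw [e, Real.rpow_sub hg0, div_le_iff₀ (by positivity)]
  set W := L.growth ^ ((L.tunnelRate * D.card + L.mergeGain / 2 + 1 : ℝ) - √(D.card : ℝ) / (6 * N))
  have hW : 0 < W := by positivity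
  have h4 : 1 ≤ 2 * L.deg ^ 2 * (u x * W) := by
    calc 1 ≤ u y := huy
      _ ≤ L.deg * u y' := h1
      _ ≤ L.deg * (2 * (u x' * W)) := by gcongr
      _ ≤ L.deg * (2 * (L.deg * u x * W)) := by gcongr
      _ = 2 * L.deg ^ 2 * (u x * W) := by ring
  have h5 : 0 ≤ L.growth ^ (L.mergeGain / 2 + 1 : ℝ) := by positivity
  calc L.growth ^ (L.mergeGain / 2 + 1 : ℝ) ≤
        L.growth ^ (L.mergeGain / 2 + 1 : ℝ) * (2 * L.deg ^ 2 * (u x * W)) :=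
        le_mul_of_one_le_right h5 h4
    _ = _ := by ring

end RegularLattice

theorem mainTheorem4 (L : RegularLattice) :
    ∃ c : ℝ, 0 < c ∧ ∃ K : ℝ, 0 < K ∧
      ∀ A D : Set RegularLattice.Vertex,
        L.IsInterlockedCluster A D → D.Finite → (D ∩ L.exterior (A \ D)).Nonempty →
        ∀ x ∈ L.exteriorStarBoundary D, ∀ y ∈ L.exteriorStarBoundary D,
        ∀ {Ω : Type*} [MeasurableSpace Ω] (P : MeasureTheory.Measure Ω)
          [MeasureTheory.IsProbabilityMeasure P] (S : ℕ → Ω → RegularLattice.Vertex),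
          L.IsRandomWalk P S x →
          K * L.lam ^ (-(D.ncard : ℝ) + c * √(D.ncard : ℝ)) ≤
            P.real {ω | RegularLattice.hittingTime (fun n => S n ω) {y} <
              RegularLattice.hittingTime (fun n => S n ω) A} :=
  RegularLattice.exists_hitting_bound L
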